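/- Let $\mathbb k$ be a field of characteristic $0$. An $A_\infty$-algebra over $\mathbb k$ is a $\mathbb Z$-graded vector space $A$ (non-unital, no boundedness assumed) with degree $1$ maps $d_n:(sA)^{\otimes n}\to sA$, $n\ge 1$, where $(sA)^i=A^{i+1}$, satisfying $\sum_{a+b+c=n}d_{a+c+1}(1^{\otimes a}\otimes d_b\otimes 1^{\otimes c})=0$ for all $n\geq 1$; we write $m_n:A^{\otimes n}\to A$ for the corresponding desuspended maps. A morphism $f:A\to B$ is a collection of degree $0$ maps $f_n:(sA)^{\otimes n}\to sB$, $n\ge1$, with $\sum_{a+b+c=n}f_{a+c+1}(1^{\otimes a}\otimes d_b\otimes 1^{\otimes c})=\sum_{i_1+\dots+i_r=n}d_r(f_{i_1}\otimes\dots\otimes f_{i_r})$; it is a quasi-isomorphism if $f_1:(sA,d_1)\to(sB,d_1)$ is one. Such an $f$ makes $B$ an $A_\infty$-$A$-bimodule by restriction of scalars. We say that $f$ admits a homotopy retract if there is a morphism $r:B\to A$ of $A_\infty$-$A$-bimodules, with components $r_{p,q}:(sA)^{\otimes p}\otimes sB\otimes (sA)^{\otimes q}\to sA$, such that $r_{0,0}\circ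 f_1$ induces the identity on the cohomology of $(sA,d_1)$. An $A_\infty$-algebra is minimal if $d_1=0$; a minimal model of $A$ is a minimal $A_\infty$-algebra $M$ together with a quasi-isomorphism $M\to A$. Finally, $A$ is formal if there is a quasi-isomorphism of $A_\infty$-algebras $H(A)\to A$, where the cohomology $H(A)$ of $(sA,d_1)$ carries the $A_\infty$-structure whose only non-zero operation is the product induced by $d_2$. Theorem B. Let $f:A\to B$ be a morphism of $A_\infty$-algebras over $\mathbb k$ that admits a homotopy retract. If $B$ is formal, then $A$ is formal. More generally, for every $k\in\mathbb N\cup\{\infty\}$, if $B$ has a minimal model with $m_i=0$ for all integers $i$ with $3\le i\le k$, then $A$ has a minimal model with $m_i=0$ for all integers $i$ with $3\le i\le k$. -/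

import Mathlib

open scoped DirectSum

universe u v w

namespace AInf

/-! ### Graded vector spaces, suspension and Koszul signs -/

/-- A `ℤ`-graded vector space over `k`: a vector space that is the direct sum of the
subspaces `deg i`, `i : ℤ`. -/
structure GradedSpace (k : Type u) [Field k] where
  carrier : Type v
  [addCommGroup : AddCommGroup carrier]
  [module : Module k carrier]
  deg : ℤ → Submodule k carrier
  [decomposition : DirectSum.Decomposition deg]

attribute [instance] GradedSpace.addCommGroup GradedSpace.module GradedSpace.decomposition

namespace GradedSpace

variable {k : Type u} [Field k]

instance : CoeSort (GradedSpace.{u, v} k) (Type v) := ⟨GradedSpace.carrier⟩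

/-- The grading of the suspension `sV`: it has the same underlying space as `V`, with
`(sV)ⁱ = Vⁱ⁺¹`. -/
def sdeg (V : GradedSpace.{u, v} k) (i : ℤ) : Submodule k V := V.deg (i + 1)

/-- The linear map `sV → sV` that multiplies the elements of `(sV)ⁱ` by `(-1)ⁱ`, so the elements
of `Vⁱ` by `(-1)ⁱ⁻¹`. It carries the Koszul sign that arises when a map of degree `1` moves past an
element of `sV`. -/
noncomputable def koszul (V : GradedSpace.{u, v} k) : V →ₗ[k] V :=
  (DirectSum.toModule k ℤ V fun i => (((i - 1).negOnePow : ℤˣ) : ℤ) • (V.deg i).subtype) ∘ₗ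
    (DirectSum.decomposeLinearEquiv V.deg).toLinearMap

theorem koszul_of_mem_deg (V : GradedSpace.{u, v} k) {i : ℤ} {x : V} (hx : x ∈ V.deg i) :
    V.koszul x = (((i - 1).negOnePow : ℤˣ) : ℤ) • x := by
  lift x to V.deg i using hx
  simp only [koszul, LinearMap.comp_apply, LinearEquiv.coe_coe,
    DirectSum.decomposeLinearEquiv_apply_coe, DirectSum.toModule_lof]
  rfl

theorem koszul_of_mem (V : GradedSpace.{u, v} k) {i : ℤ} {x : V} (hx : x ∈ V.sdeg i) :
    V.koszul x = ((i.negOnePow : ℤˣ) : ℤ) • x := by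
  have := V.koszul_of_mem_deg hx
  simpa using this

/-- The projection of `V` to its component of degree `i`. -/
noncomputable def proj (V : GradedSpace.{u, v} k) (i : ℤ) : V →ₗ[k] V :=
  (V.deg i).subtype ∘ₗ DirectSum.component k ℤ (fun i => V.deg i) i ∘ₗ
    (DirectSum.decomposeLinearEquiv V.deg).toLinearMap

theorem proj_same (V : GradedSpace.{u, v} k) {i : ℤ} {x : V} (hx : x ∈ V.deg i) :
    V.proj i x = x := by
  exact DirectSum.decompose_of_mem_same V.deg hx

theorem proj_ne (V : GradedSpace.{u, v} k) {i j : ℤ} {x : V} (hx : x ∈ V.deg i) (h : i ≠ j) :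
    V.proj j x = 0 := by
  exact DirectSum.decompose_of_mem_ne V.deg hx h

theorem proj_mem (V : GradedSpace.{u, v} k) (i : ℤ) (x : V) : V.proj i x ∈ V.deg i := by
  simp [proj]

/-- Two linear maps agree if they agree on homogeneous elements. -/
theorem hom_ext {V : GradedSpace.{u, v} k} {W : Type w} [AddCommGroup W] [Module k W]
    {g h : V →ₗ[k] W} (H : ∀ i, ∀ x ∈ V.deg i, g x = h x) : g = h := by
  refine DirectSum.decompose_lhom_ext V.deg fun i => ?_
  ext x
  exact H i x x.2

end GradedSpace

/-! ### Operations on words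

Multilinear maps `φₙ : V^{⊗n} → W` are evaluated on words (lists) of elements of `V`. -/

section Words

variable {k : Type u} [Field k] {V : Type v} [AddCommGroup V] [Module k V]
  {W : Type w} [AddCommGroup W] [Module k W]

/-- The value of a collection of maps `φₙ : V^{⊗n} → W` on the word `x₁ ⊗ ⋯ ⊗ xₙ`. -/
def evalWord (φ : (n : ℕ) → MultilinearMap k (fun _ : Fin n => V) W) (l : List V) : W :=
  φ l.length l.get

theorem evalWord_of_zero_mem (φ : (n : ℕ) → MultilinearMap k (fun _ : Fin n => V) W)
    {l : List V} (h : (0 : V) ∈ l) : evalWord φ l = 0 := by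
  obtain ⟨i, hi⟩ := List.get_of_mem h
  exact (φ l.length).map_coord_zero i hi

end Words

section InsertSum

variable {V : Type v} {W : Type w} [AddCommGroup W]

/-- The sum `∑_{a+b+c=n} g (1^{⊗a} ⊗ d_b ⊗ 1^{⊗c})` on a word of length `n`, with `d` of
degree `1`; the sign rule puts `ε` (which is `V.koszul` below) on the first `a` letters. -/
def insertSum (ε : V → V) (d : List V → V) (g : List V → W) (l : List V) : W :=
  ∑ p ∈ Finset.HasAntidiagonal.antidiagonal l.length, ∑ q ∈ Finset.HasAntidiagonal.antidiagonal p.2,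
    g ((l.take p.1).map ε ++ d ((l.drop p.1).take q.1) :: l.drop (p.1 + q.1))

theorem insertSum_nil (ε : V → V) (d : List V → V) (g : List V → W) :
    insertSum ε d g [] = g [d []] := by
  simp [insertSum]

theorem insertSum_one (ε : V → V) (d : List V → V) (g : List V → W) (x : V) :
    insertSum ε d g [x] = g [d [], x] + g [d [x]] + g [ε x, d []] := by
  simp [insertSum, Finset.Nat.antidiagonal_succ]

theorem insertSum_two (ε : V → V) (d : List V → V) (g : List V → W) (x y : V) :
    insertSum ε d g [x, y] = g [d [], x, y] + g [d [x], y] + g [d [x, y]] +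
      (g [ε x, d [], y] + g [ε x, d [y]]) + g [ε x, ε y, d []] := by
  simp [insertSum, Finset.Nat.antidiagonal_succ]
  abel

theorem insertSum_three (ε : V → V) (d : List V → V) (g : List V → W) (x y z : V) :
    insertSum ε d g [x, y, z] =
      g [d [], x, y, z] + g [d [x], y, z] + g [d [x, y], z] + g [d [x, y, z]] +
      (g [ε x, d [], y, z] + g [ε x, d [y], z] + g [ε x, d [y, z]]) +
      (g [ε x, ε y, d [], z] + g [ε x, ε y, d [z]]) + g [ε x, ε y, ε z, d []] := by
  simp [insertSum, Finset.Nat.antidiagonal_succ]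
  abel

end InsertSum

/-! ### `A∞`-algebras -/

/-- A (non-unital) `A∞`-algebra over `k`: a graded vector space `A` with maps
`dₙ : (sA)^{⊗n} → sA` of degree `1` for `n ≥ 1` (and `d₀ = 0` by convention) such that
`∑_{a+b+c=n} d_{a+c+1} (1^{⊗a} ⊗ d_b ⊗ 1^{⊗c}) = 0` for all `n`. -/
structure AInfAlgebra (k : Type u) [Field k] extends GradedSpace.{u, v} k where
  d : (n : ℕ) → MultilinearMap k (fun _ : Fin n => carrier) carrier
  d_zero : d 0 = 0
  d_mem : ∀ (n : ℕ) (i : Fin n → ℤ) (x : Fin n → carrier),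
    (∀ j, x j ∈ toGradedSpace.sdeg (i j)) → d n x ∈ toGradedSpace.sdeg (∑ j, i j + 1)
  relation : ∀ l : List carrier,
    insertSum toGradedSpace.koszul (evalWord d) (evalWord d) l = 0

namespace AInfAlgebra

variable {k : Type u} [Field k]

instance : CoeSort (AInfAlgebra.{u, v} k) (Type v) := ⟨fun A => A.carrier⟩

/-- The operations of an `A∞`-algebra, on words. -/
def op (A : AInfAlgebra.{u, v} k) : List A → A := evalWord A.d

/-- A morphism `A → B` of `A∞`-algebras: maps `fₙ : (sA)^{⊗n} → sB` of degree `0` for `n ≥ 1`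
(and `f₀ = 0` by convention) such that for all `n`
`∑_{a+b+c=n} f_{a+c+1} (1^{⊗a} ⊗ d_b ⊗ 1^{⊗c}) = ∑_{i₁+⋯+iᵣ=n} dᵣ (f_{i₁} ⊗ ⋯ ⊗ f_{iᵣ})`. -/
structure Hom (A : AInfAlgebra.{u, v} k) (B : AInfAlgebra.{u, w} k) where
  f : (n : ℕ) → MultilinearMap k (fun _ : Fin n => A.carrier) B.carrier
  f_zero : f 0 = 0
  f_mem : ∀ (n : ℕ) (i : Fin n → ℤ) (x : Fin n → A),
    (∀ j, x j ∈ A.sdeg (i j)) → f n x ∈ B.sdeg (∑ j, i j)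
  relation : ∀ l : List A, insertSum A.koszul A.op (evalWord f) l =
    ∑ c : Composition l.length, B.op ((l.splitWrtComposition c).map (evalWord f))

/-- The components of a morphism of `A∞`-algebras, on words. -/
def Hom.op {A : AInfAlgebra.{u, v} k} {B : AInfAlgebra.{u, w} k} (f : Hom A B) : List A → B :=
  evalWord f.f

end AInfAlgebra

/-! ### `A∞`-bimodules

The operations `d_{p,q} : (sA)^{⊗p} ⊗ sM ⊗ (sA)^{⊗q} → sM` of an `A∞`-bimodule `M` over `A` are
given as a function `List A → M → List A → M`. -/

section Bimodules

variable {k : Type u} [Field k]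

/-- The operations `d_{p,q} = d_{p+q+1}` of an `A∞`-algebra as a bimodule over itself. -/
def selfOp (A : AInfAlgebra.{u, v} k) : List A → A → List A → A :=
  fun l m l' => A.op (l ++ m :: l')

theorem sum_composition_one {M : Type*} [AddCommMonoid M] (g : Composition 1 → M) :
    ∑ c, g c = g (Composition.ones 1) := by
  refine Fintype.sum_eq_single _ fun c hc => (hc ?_).elim
  have : Fintype.card (Composition 1) = 1 := by rw [composition_card]; rfl
  exact (Fintype.card_le_one_iff.1 this.le) _ _

theorem sum_composition_zero {M : Type*} [AddCommMonoid M] (g : Composition 0 → M) :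
    ∑ c, g c = g (Composition.ones 0) := by
  refine Fintype.sum_eq_single _ fun c hc => (hc ?_).elim
  have : Fintype.card (Composition 0) = 1 := by rw [composition_card]; rfl
  exact (Fintype.card_le_one_iff.1 this.le) _ _

/-- Restriction of scalars along a morphism `f : A → B` of `A∞`-algebras: from the operations of a
bimodule `M` over `B` one obtains those of `M` as a bimodule over `A`, namely
`∑ d_{r,s} (f_{i₁} ⊗ ⋯ ⊗ f_{iᵣ} ⊗ 1 ⊗ f_{j₁} ⊗ ⋯ ⊗ f_{jₛ})` over all `i₁+⋯+iᵣ=p`,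
`j₁+⋯+jₛ=q`. -/
def restrictOp {A : AInfAlgebra.{u, v} k} {B : AInfAlgebra.{u, w} k} (f : AInfAlgebra.Hom A B)
    {M : Type*} [AddCommGroup M] (dM : List B → M → List B → M) : List A → M → List A → M :=
  fun l m l' => ∑ c : Composition l.length, ∑ c' : Composition l'.length,
    dM ((l.splitWrtComposition c).map f.op) m ((l'.splitWrtComposition c').map f.op)

theorem restrictOp_nil {A : AInfAlgebra.{u, v} k} {B : AInfAlgebra.{u, w} k} (f : AInfAlgebra.Hom A B)
    {M : Type*} [AddCommGroup M] (dM : List B → M → List B → M) (m : M) :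
    restrictOp f dM [] m [] = dM [] m [] := by
  unfold restrictOp
  show ∑ c : Composition 0, ∑ c' : Composition 0, _ = _
  rw [sum_composition_zero, sum_composition_zero]
  rfl

/-- The value of a collection of maps `r_{p,q} : (sA)^{⊗p} ⊗ sM ⊗ (sA)^{⊗q} → sN` on
`x₁ ⊗ ⋯ ⊗ x_p ⊗ m ⊗ y₁ ⊗ ⋯ ⊗ y_q`. -/
def evalBiWord {A : Type*} [AddCommGroup A] [Module k A] {M : Type*} [AddCommGroup M] [Module k M]
    {N : Type*} [AddCommGroup N] [Module k N]
    (r : (p q : ℕ) → MultilinearMap k (fun _ : Fin p => A)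
      (M →ₗ[k] MultilinearMap k (fun _ : Fin q => A) N))
    (l : List A) (m : M) (l' : List A) : N :=
  r l.length l'.length l.get m l'.get

theorem evalBiWord_of_zero_mem_left {A : Type*} [AddCommGroup A] [Module k A]
    {M : Type*} [AddCommGroup M] [Module k M] {N : Type*} [AddCommGroup N] [Module k N]
    (r : (p q : ℕ) → MultilinearMap k (fun _ : Fin p => A)
      (M →ₗ[k] MultilinearMap k (fun _ : Fin q => A) N))
    {l : List A} (h : (0 : A) ∈ l) (m : M) (l' : List A) : evalBiWord r l m l' = 0 := by
  obtain ⟨i, hi⟩ := List.get_of_mem h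
  rw [evalBiWord, (r l.length l'.length).map_coord_zero i hi]
  rfl

theorem evalBiWord_of_zero_mem_right {A : Type*} [AddCommGroup A] [Module k A]
    {M : Type*} [AddCommGroup M] [Module k M] {N : Type*} [AddCommGroup N] [Module k N]
    (r : (p q : ℕ) → MultilinearMap k (fun _ : Fin p => A)
      (M →ₗ[k] MultilinearMap k (fun _ : Fin q => A) N))
    (l : List A) (m : M) {l' : List A} (h : (0 : A) ∈ l') : evalBiWord r l m l' = 0 := by
  obtain ⟨i, hi⟩ := List.get_of_mem h
  exact (r l.length l'.length l.get m).map_coord_zero i hi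

/-- A morphism `M → N` of `A∞`-bimodules over `A`, the bimodule structures being given by their
operations `dM`, `dN`: maps `r_{p,q} : (sA)^{⊗p} ⊗ sM ⊗ (sA)^{⊗q} → sN` of degree `0` such that
for all `p, q` one has, on `(sA)^{⊗p} ⊗ sM ⊗ (sA)^{⊗q}`,
`∑_{a+b+c=p+q+1} r_{a,c} (1^{⊗a} ⊗ d_b ⊗ 1^{⊗c}) =
  ∑_{x+i=p, j+y=q} d_{x,y} (1^{⊗x} ⊗ r_{i,j} ⊗ 1^{⊗y})`.
On the left hand side, `d_b` is an operation of `A` applied to letters before the one in `M`, an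
operation of `M`, or an operation of `A` applied to letters after the one in `M`. -/
structure BimoduleHom (A : AInfAlgebra.{u, v} k) (M N : GradedSpace k)
    (dM : List A → M → List A → M) (dN : List A → N → List A → N) where
  r : (p q : ℕ) → MultilinearMap k (fun _ : Fin p => A.carrier)
    (M.carrier →ₗ[k] MultilinearMap k (fun _ : Fin q => A.carrier) N.carrier)
  r_mem : ∀ (p q : ℕ) (i : Fin p → ℤ) (e : ℤ) (j : Fin q → ℤ)
    (x : Fin p → A) (m : M) (y : Fin q → A),
    (∀ t, x t ∈ A.sdeg (i t)) → m ∈ M.sdeg e → (∀ t, y t ∈ A.sdeg (j t)) →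
      r p q x m y ∈ N.sdeg (∑ t, i t + e + ∑ t, j t)
  relation : ∀ (l : List A) (m : M) (l' : List A),
    insertSum A.koszul A.op (fun t => evalBiWord r t m l') l +
      (∑ s ∈ Finset.HasAntidiagonal.antidiagonal l.length, ∑ t ∈ Finset.HasAntidiagonal.antidiagonal l'.length,
        evalBiWord r ((l.take s.1).map A.koszul) (dM (l.drop s.1) m (l'.take t.1)) (l'.drop t.1)) +
      insertSum A.koszul A.op (fun t => evalBiWord r (l.map A.koszul) (M.koszul m) t) l' =
    ∑ s ∈ Finset.HasAntidiagonal.antidiagonal l.length, ∑ t ∈ Finset.HasAntidiagonal.antidiagonal l'.length,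
      dN (l.take s.1) (evalBiWord r (l.drop s.1) m (l'.take t.1)) (l'.drop t.1)

/-- The component `r_{0,0} : sM → sN` of a morphism of bimodules. -/
def BimoduleHom.linearPart {A : AInfAlgebra.{u, v} k} {M N : GradedSpace k}
    {dM : List A → M → List A → M} {dN : List A → N → List A → N}
    (r : BimoduleHom A M N dM dN) : M →ₗ[k] N where
  toFun m := evalBiWord r.r [] m []
  map_add' := by simp [evalBiWord]
  map_smul' := by simp [evalBiWord]

end Bimodules

/-! ### Cohomology -/

section Cohomology

variable {k : Type u} [Field k]

/-- The cohomology `ker d / im d` of an endomorphism `d` with `d² = 0`. -/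
abbrev HModule {V : Type v} [AddCommGroup V] [Module k V] (d : V →ₗ[k] V) : Type v :=
  LinearMap.ker d ⧸ (LinearMap.range d).comap (LinearMap.ker d).subtype

/-- The map induced in cohomology by a linear map that commutes with the differentials. -/
def HMap {V : Type v} [AddCommGroup V] [Module k V] {W : Type w} [AddCommGroup W] [Module k W]
    {d : V →ₗ[k] V} {d' : W →ₗ[k] W} (g : V →ₗ[k] W) (h : ∀ x, g (d x) = d' (g x)) :
    HModule d →ₗ[k] HModule d' :=
  Submodule.mapQ _ _
    (g.restrict (p := LinearMap.ker d) (q := LinearMap.ker d') fun x hx => by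
      rw [LinearMap.mem_ker] at hx ⊢
      rw [← h, hx, map_zero])
    (by
      rintro ⟨x, hx⟩ ⟨y, hy⟩
      exact ⟨g y, by rw [← h, hy]; rfl⟩)

/-- The component of arity `1` of a collection of multilinear maps, as a linear map. -/
def arityOne {V : Type v} [AddCommGroup V] [Module k V] {W : Type w} [AddCommGroup W] [Module k W]
    (φ : (n : ℕ) → MultilinearMap k (fun _ : Fin n => V) W) : V →ₗ[k] W where
  toFun x := evalWord φ [x]
  map_add' x y := by
    have h := (φ 1).map_update_add (fun _ => (0 : V)) 0 x y
    have e : ∀ z : V, Function.update (fun _ : Fin 1 => (0 : V)) 0 z = [z].get := by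
      intro z; funext i; rw [Subsingleton.elim i 0]; simp
    simp only [e] at h; exact h
  map_smul' c x := by
    have h := (φ 1).map_update_smul (fun _ => (0 : V)) 0 c x
    have e : ∀ z : V, Function.update (fun _ : Fin 1 => (0 : V)) 0 z = [z].get := by
      intro z; funext i; rw [Subsingleton.elim i 0]; simp
    simp only [e] at h; exact h

/-- The component of arity `2` of a collection of multilinear maps, as a bilinear map. -/
def arityTwo {V : Type v} [AddCommGroup V] [Module k V] {W : Type w} [AddCommGroup W] [Module k W]
    (φ : (n : ℕ) → MultilinearMap k (fun _ : Fin n => V) W) : V →ₗ[k] V →ₗ[k] W :=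
  have e : ∀ y z : V, (φ 2) (Fin.cons y (fun _ => z)) = evalWord φ [y, z] := by
    intro y z
    show _ = φ 2 [y, z].get
    congr 1
    funext i
    fin_cases i <;> rfl
  LinearMap.mk₂ k (fun x y => evalWord φ [x, y])
    (fun x x' y => by simp only [← e]; exact (φ 2).cons_add (fun _ => y) x x')
    (fun c x y => by simp only [← e]; exact (φ 2).cons_smul (fun _ => y) c x)
    (fun x y y' => by
      have h := (φ 2).map_update_add ![x, 0] 1 y y'
      have e' : ∀ z : V, Function.update ![x, 0] 1 z = [x, z].get := by
        intro z; funext i; fin_cases i <;> simp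
      simp only [e'] at h; exact h)
    (fun c x y => by
      have h := (φ 2).map_update_smul ![x, 0] 1 c y
      have e' : ∀ z : V, Function.update ![x, 0] 1 z = [x, z].get := by
        intro z; funext i; fin_cases i <;> simp
      simp only [e'] at h; exact h)

namespace AInfAlgebra

/-- The differential `d₁` of an `A∞`-algebra. -/
def d₁ (A : AInfAlgebra.{u, v} k) : A.carrier →ₗ[k] A.carrier := arityOne A.d

/-- The operation `d₂` of an `A∞`-algebra. -/
def d₂ (A : AInfAlgebra.{u, v} k) : A.carrier →ₗ[k] A.carrier →ₗ[k] A.carrier := arityTwo A.d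

theorem op_nil (A : AInfAlgebra.{u, v} k) : A.op [] = 0 := by
  show A.d 0 _ = 0
  rw [A.d_zero]; rfl

theorem op_of_zero_mem (A : AInfAlgebra.{u, v} k) {l : List A} (h : (0 : A) ∈ l) : A.op l = 0 :=
  evalWord_of_zero_mem A.d h

theorem op_one (A : AInfAlgebra.{u, v} k) (x : A) : A.op [x] = A.d₁ x := rfl

theorem op_two (A : AInfAlgebra.{u, v} k) (x y : A) : A.op [x, y] = A.d₂ x y := rfl

theorem d₁_d₁ (A : AInfAlgebra.{u, v} k) (x : A) : A.d₁ (A.d₁ x) = 0 := by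
  have h : insertSum A.koszul A.op A.op [x] = 0 := A.relation [x]
  simpa [insertSum_one, op_nil, op_of_zero_mem, op_one] using h

theorem d₁_d₂ (A : AInfAlgebra.{u, v} k) (x y : A) :
    A.d₁ (A.d₂ x y) + A.d₂ (A.d₁ x) y + A.d₂ (A.koszul x) (A.d₁ y) = 0 := by
  have h : insertSum A.koszul A.op A.op [x, y] = 0 := A.relation [x, y]
  simp [insertSum_two, op_nil, op_of_zero_mem, op_one, op_two] at h
  rw [← h]
  abel

theorem d₂_d₂ (A : AInfAlgebra.{u, v} k) {x y z : A} (hx : A.d₁ x = 0) (hy : A.d₁ y = 0)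
    (hz : A.d₁ z = 0) :
    A.d₂ (A.d₂ x y) z + A.d₂ (A.koszul x) (A.d₂ y z) = - A.d₁ (A.op [x, y, z]) := by
  have h : insertSum A.koszul A.op A.op [x, y, z] = 0 := A.relation [x, y, z]
  simp [insertSum_three, op_nil, op_of_zero_mem, op_one, op_two,
    hx, hy, hz] at h
  rw [eq_neg_iff_add_eq_zero, ← h]
  abel

theorem d₁_mem (A : AInfAlgebra.{u, v} k) {i : ℤ} {x : A} (hx : x ∈ A.deg i) :
    A.d₁ x ∈ A.deg (i + 1) := by
  have h := A.d_mem 1 (fun _ => i - 1) [x].get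
    (fun j => by
      rw [Subsingleton.elim j 0]
      simpa [GradedSpace.sdeg] using hx)
  simp [GradedSpace.sdeg] at h
  exact h

theorem d₂_mem (A : AInfAlgebra.{u, v} k) {i j : ℤ} {x y : A} (hx : x ∈ A.sdeg i)
    (hy : y ∈ A.sdeg j) : A.d₂ x y ∈ A.sdeg (i + j + 1) := by
  have h := A.d_mem 2 ![i, j] [x, y].get
    (fun t => by fin_cases t <;> simpa)
  simp at h
  exact h

theorem proj_d₁ (A : AInfAlgebra.{u, v} k) (i : ℤ) (x : A) :
    A.proj (i + 1) (A.d₁ x) = A.d₁ (A.proj i x) := by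
  suffices h : A.proj (i + 1) ∘ₗ A.d₁ = A.d₁ ∘ₗ A.proj i from LinearMap.congr_fun h x
  refine GradedSpace.hom_ext fun j x hx => ?_
  simp only [LinearMap.comp_apply]
  by_cases hij : j = i
  · subst hij
    rw [A.proj_same hx, A.proj_same (A.d₁_mem hx)]
  · rw [A.proj_ne hx hij, A.proj_ne (A.d₁_mem hx) (by simpa using hij), map_zero]

theorem koszul_d₁ (A : AInfAlgebra.{u, v} k) (x : A) :
    A.koszul (A.d₁ x) = - A.d₁ (A.koszul x) := by
  suffices h : A.koszul ∘ₗ A.d₁ = - A.d₁ ∘ₗ A.koszul from LinearMap.congr_fun h x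
  refine GradedSpace.hom_ext fun i x hx => ?_
  have e : i + 1 - 1 = (i - 1) + 1 := by ring
  simp only [LinearMap.comp_apply, LinearMap.neg_apply]
  rw [A.koszul_of_mem_deg hx, A.koszul_of_mem_deg (A.d₁_mem hx), e, Int.negOnePow_succ,
    map_zsmul]
  simp

/-- The projection of cohomology to its component of degree `i`. -/
noncomputable def HProj (A : AInfAlgebra.{u, v} k) (i : ℤ) : HModule A.d₁ →ₗ[k] HModule A.d₁ :=
  Submodule.mapQ _ _
    ((A.proj i).restrict (p := LinearMap.ker A.d₁) (q := LinearMap.ker A.d₁) fun x hx => by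
      rw [LinearMap.mem_ker] at hx ⊢
      rw [← proj_d₁, hx, map_zero])
    (by
      rintro ⟨x, hx⟩ ⟨y, hy⟩
      refine ⟨A.proj (i - 1) y, ?_⟩
      rw [← proj_d₁, hy]
      simp)

/-- The cohomology class of a cocycle. -/
def cls (A : AInfAlgebra.{u, v} k) (x : A) (hx : A.d₁ x = 0) : HModule A.d₁ :=
  Submodule.Quotient.mk ⟨x, hx⟩

theorem cls_surj (A : AInfAlgebra.{u, v} k) (h : HModule A.d₁) : ∃ x hx, h = A.cls x hx := by
  obtain ⟨⟨x, hx⟩, rfl⟩ := Submodule.Quotient.mk_surjective _ h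
  exact ⟨x, hx, rfl⟩

theorem cls_eq (A : AInfAlgebra.{u, v} k) {x y : A} (hx : A.d₁ x = 0) (hy : A.d₁ y = 0)
    (h : ∃ z, A.d₁ z = x - y) : A.cls x hx = A.cls y hy :=
  (Submodule.Quotient.eq _).2 h

/-- The grading of cohomology: the classes of degree `i` are those of the cocycles of
degree `i`. -/
def HDeg (A : AInfAlgebra.{u, v} k) (i : ℤ) : Submodule k (HModule A.d₁) :=
  ((A.deg i).comap (LinearMap.ker A.d₁).subtype).map (Submodule.mkQ _)

theorem mem_HDeg (A : AInfAlgebra.{u, v} k) {i : ℤ} {h : HModule A.d₁} :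
    h ∈ A.HDeg i ↔ ∃ x hx, x ∈ A.deg i ∧ h = A.cls x hx := by
  constructor
  · rintro ⟨⟨x, hx⟩, hm, rfl⟩
    exact ⟨x, hx, hm, rfl⟩
  · rintro ⟨x, hx, hm, rfl⟩
    exact ⟨⟨x, hx⟩, hm, rfl⟩

theorem HProj_same (A : AInfAlgebra.{u, v} k) {i : ℤ} {h : HModule A.d₁} (hh : h ∈ A.HDeg i) :
    A.HProj i h = h := by
  obtain ⟨x, hx, hm, rfl⟩ := A.mem_HDeg.1 hh
  exact congrArg Submodule.Quotient.mk (Subtype.ext (A.proj_same hm))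

theorem HProj_ne (A : AInfAlgebra.{u, v} k) {i j : ℤ} {h : HModule A.d₁} (hh : h ∈ A.HDeg i)
    (hij : i ≠ j) : A.HProj j h = 0 := by
  obtain ⟨x, hx, hm, rfl⟩ := A.mem_HDeg.1 hh
  exact congrArg Submodule.Quotient.mk
    (Subtype.ext (A.proj_ne hm hij) : _ = (0 : LinearMap.ker A.d₁))

theorem HDeg_isInternal (A : AInfAlgebra.{u, v} k) : DirectSum.IsInternal A.HDeg := by
  have key : ∀ (z : ⨁ i, A.HDeg i) (i : ℤ),
      A.HProj i (DirectSum.coeAddMonoidHom A.HDeg z) = z i := by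
    intro z i
    induction z using DirectSum.induction_on with
    | zero => simp
    | of j h =>
      rw [DirectSum.coeAddMonoidHom_of]
      by_cases hij : j = i
      · subst hij
        rw [A.HProj_same h.2, DirectSum.of_eq_same]
      · rw [A.HProj_ne h.2 hij, DirectSum.of_eq_of_ne _ _ _ (Ne.symm hij)]
        rfl
    | add a b ha hb => simp [map_add, ha, hb]
  constructor
  · intro z z' h
    refine DFinsupp.ext fun i => Subtype.ext ?_
    rw [← key z i, ← key z' i, h]
  · intro h
    obtain ⟨x, hx, rfl⟩ := A.cls_surj h
    have hp : ∀ i, A.d₁ (A.proj i x) = 0 := fun i => by rw [← proj_d₁, hx, map_zero]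
    classical
    refine ⟨∑ i ∈ (DirectSum.decompose A.deg x).support,
      DirectSum.of (fun i => A.HDeg i) i ⟨A.cls (A.proj i x) (hp i),
        A.mem_HDeg.2 ⟨_, _, A.proj_mem i x, rfl⟩⟩, ?_⟩
    rw [map_sum]
    simp only [DirectSum.coeAddMonoidHom_of]
    have e : (∑ i ∈ (DirectSum.decompose A.deg x).support,
        (⟨A.proj i x, hp i⟩ : LinearMap.ker A.d₁)) = ⟨x, hx⟩ := by
      apply Subtype.ext
      rw [AddSubmonoidClass.coe_finsetSum]
      exact DirectSum.sum_support_decompose A.deg x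
    unfold cls
    rw [← e]
    exact (map_sum (Submodule.mkQ _) _ _).symm

/-- The cohomology of an `A∞`-algebra, as a graded vector space. -/
noncomputable abbrev HSpace (A : AInfAlgebra.{u, v} k) : GradedSpace.{u, v} k where
  carrier := HModule A.d₁
  deg := A.HDeg
  decomposition := A.HDeg_isInternal.chooseDecomposition

theorem koszul_ker (A : AInfAlgebra.{u, v} k) {x : A} (hx : A.d₁ x = 0) : A.d₁ (A.koszul x) = 0 := by
  rw [← neg_eq_zero, ← koszul_d₁, hx, map_zero]

theorem koszul_cls (A : AInfAlgebra.{u, v} k) (x : A) (hx : A.d₁ x = 0) :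
    A.HSpace.koszul (A.cls x hx) = A.cls (A.koszul x) (A.koszul_ker hx) := by
  let K : HModule A.d₁ →ₗ[k] HModule A.d₁ := Submodule.mapQ _ _
    (A.koszul.restrict (p := LinearMap.ker A.d₁) (q := LinearMap.ker A.d₁) fun x hx =>
      A.koszul_ker hx)
    (by
      rintro ⟨x, hx⟩ ⟨y, hy⟩
      refine ⟨- A.koszul y, ?_⟩
      rw [map_neg, ← koszul_d₁, hy]
      rfl)
  have h : A.HSpace.koszul = K := by
    refine GradedSpace.hom_ext fun i h hh => ?_
    rw [A.HSpace.koszul_of_mem_deg hh]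
    obtain ⟨x, hx, hm, rfl⟩ := A.mem_HDeg.1 hh
    show _ = A.cls (A.koszul x) (A.koszul_ker hx)
    have : (⟨A.koszul x, A.koszul_ker hx⟩ : LinearMap.ker A.d₁) =
      (((i - 1).negOnePow : ℤˣ) : ℤ) • ⟨x, hx⟩ := Subtype.ext (A.koszul_of_mem_deg hm)
    unfold cls
    rw [this]
    exact (map_zsmul (Submodule.mkQ _) _ _).symm
  rw [h]
  rfl

theorem koszul_koszul (A : AInfAlgebra.{u, v} k) (x : A) : A.koszul (A.koszul x) = x := by
  suffices h : A.koszul ∘ₗ A.koszul = LinearMap.id from LinearMap.congr_fun h x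
  refine GradedSpace.hom_ext fun i x hx => ?_
  simp only [LinearMap.comp_apply, A.koszul_of_mem_deg hx, map_zsmul, smul_smul,
    LinearMap.id_apply]
  rcases Int.units_eq_one_or (i - 1).negOnePow with h | h <;> simp [h]

theorem d₂_ker (A : AInfAlgebra.{u, v} k) {x y : A} (hx : A.d₁ x = 0) (hy : A.d₁ y = 0) :
    A.d₁ (A.d₂ x y) = 0 := by
  simpa [hx, hy] using A.d₁_d₂ x y

/-- The class of `d₂ (x, y)`, as a bilinear function of the cocycles `x` and `y`. -/
def preProd (A : AInfAlgebra.{u, v} k) :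
    LinearMap.ker A.d₁ →ₗ[k] LinearMap.ker A.d₁ →ₗ[k] HModule A.d₁ :=
  LinearMap.mk₂ k
    (fun x y : LinearMap.ker A.d₁ => A.cls (A.d₂ x.1 y.1) (A.d₂_ker x.2 y.2))
    (fun x x' y => congrArg Submodule.Quotient.mk (Subtype.ext (A.d₂.map_add₂ x.1 x'.1 y.1)))
    (fun c x y => congrArg Submodule.Quotient.mk (Subtype.ext (A.d₂.map_smul₂ c x.1 y.1)))
    (fun x y y' => congrArg Submodule.Quotient.mk (Subtype.ext ((A.d₂ x.1).map_add y.1 y'.1)))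
    (fun c x y => congrArg Submodule.Quotient.mk (Subtype.ext ((A.d₂ x.1).map_smul c y.1)))

/-- The product on cohomology induced by `d₂`: it sends the classes of `x` and `y` to the class
of `d₂ (x, y)`. -/
def HProd (A : AInfAlgebra.{u, v} k) : HModule A.d₁ →ₗ[k] HModule A.d₁ →ₗ[k] HModule A.d₁ :=
  (Submodule.liftQ _
    (Submodule.liftQ _ A.preProd (by
      rintro ⟨x, hx⟩ ⟨u, hu⟩
      replace hu : A.d₁ u = x := hu
      subst hu
      refine LinearMap.ext fun y => (Submodule.Quotient.mk_eq_zero _).2 ⟨- A.d₂ u y.1, ?_⟩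
      have h := A.d₁_d₂ u y.1
      rw [show A.d₁ y.1 = 0 from y.2, map_zero, add_zero] at h
      rw [map_neg, neg_eq_iff_add_eq_zero]
      exact h)).flip (by
      rintro ⟨y, hy⟩ ⟨u, hu⟩
      replace hu : A.d₁ u = y := hu
      subst hu
      refine LinearMap.ext fun h => ?_
      obtain ⟨x, hx, rfl⟩ := A.cls_surj h
      refine (Submodule.Quotient.mk_eq_zero _).2 ⟨- A.d₂ (A.koszul x) u, ?_⟩
      have h := A.d₁_d₂ (A.koszul x) u
      rw [A.koszul_ker hx, A.koszul_koszul, map_zero, LinearMap.zero_apply, add_zero] at h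
      rw [map_neg, neg_eq_iff_add_eq_zero]
      exact h)).flip

theorem HProd_cls (A : AInfAlgebra.{u, v} k) {x y : A} (hx : A.d₁ x = 0) (hy : A.d₁ y = 0) :
    A.HProd (A.cls x hx) (A.cls y hy) = A.cls (A.d₂ x y) (A.d₂_ker hx hy) := rfl

/-- The operations on cohomology: `d₂` is the induced product, and `dₙ = 0` for `n ≠ 2`. -/
def HOps (A : AInfAlgebra.{u, v} k) :
    (n : ℕ) → MultilinearMap k (fun _ : Fin n => HModule A.d₁) (HModule A.d₁)
  | 2 => {
      toFun := fun x => A.HProd (x 0) (x 1)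
      map_update_add' := by
        intro inst x i y z
        rw [Subsingleton.elim inst (instDecidableEqFin 2)]
        fin_cases i <;> simp
      map_update_smul' := by
        intro inst x i c y
        rw [Subsingleton.elim inst (instDecidableEqFin 2)]
        fin_cases i <;> simp }
  | _ => 0

theorem HOps_ne (A : AInfAlgebra.{u, v} k) {n : ℕ} (hn : n ≠ 2) : A.HOps n = 0 := by
  match n, hn with
  | 0, _ => rfl
  | 1, _ => rfl
  | n + 3, _ => rfl

theorem evalWord_HOps_ne (A : AInfAlgebra.{u, v} k) {l : List (HModule A.d₁)} (hl : l.length ≠ 2) :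
    evalWord A.HOps l = 0 := by
  rw [evalWord, A.HOps_ne hl]
  rfl

theorem evalWord_HOps_two (A : AInfAlgebra.{u, v} k) (a b : HModule A.d₁) :
    evalWord A.HOps [a, b] = A.HProd a b := rfl

/-- The cohomology `H(A)` of an `A∞`-algebra `A`, as an `A∞`-algebra: all operations vanish,
except for `d₂`, which is the product induced by that of `A`. -/
noncomputable def cohomology (A : AInfAlgebra.{u, v} k) : AInfAlgebra.{u, v} k where
  toGradedSpace := A.HSpace
  d := A.HOps
  d_zero := rfl
  d_mem := by
    intro n i x hx
    by_cases hn : n = 2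
    · subst hn
      obtain ⟨a, ha, hma, ea⟩ := A.mem_HDeg.1 (hx 0)
      obtain ⟨b, hb, hmb, eb⟩ := A.mem_HDeg.1 (hx 1)
      show A.HProd (x 0) (x 1) ∈ A.HDeg _
      rw [ea, eb, HProd_cls, Fin.sum_univ_two]
      exact A.mem_HDeg.2 ⟨_, _, A.d₂_mem hma hmb, rfl⟩
    · rw [A.HOps_ne hn]
      exact Submodule.zero_mem _
  relation := by
    intro l
    by_cases hl : l.length = 3
    · match l, hl with
      | [a, b, c], _ =>
        have h0 : evalWord A.HOps [] = 0 := A.evalWord_HOps_ne (by simp)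
        have h1 : ∀ a, evalWord A.HOps [a] = 0 := fun a => A.evalWord_HOps_ne (by simp)
        have h3 : ∀ a b c, evalWord A.HOps [a, b, c] = 0 := fun a b c =>
          A.evalWord_HOps_ne (by simp)
        have h4 : ∀ a b c e, evalWord A.HOps [a, b, c, e] = 0 := fun a b c e =>
          A.evalWord_HOps_ne (by simp)
        suffices h : A.HProd (A.HProd a b) c + A.HProd (A.HSpace.koszul a) (A.HProd b c) = 0 by
          rw [insertSum_three]
          simp only [h0, h1, h3, h4, zero_add, add_zero]
          exact h
        obtain ⟨x, hx, rfl⟩ := A.cls_surj a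
        obtain ⟨y, hy, rfl⟩ := A.cls_surj b
        obtain ⟨z, hz, rfl⟩ := A.cls_surj c
        rw [koszul_cls, HProd_cls, HProd_cls, HProd_cls, HProd_cls]
        refine (Submodule.Quotient.mk_eq_zero _).2 ⟨- A.op [x, y, z], ?_⟩
        rw [map_neg, ← A.d₂_d₂ hx hy hz]
        rfl
    · refine Finset.sum_eq_zero fun p hp => Finset.sum_eq_zero fun q hq => ?_
      rw [Finset.HasAntidiagonal.mem_antidiagonal] at hp hq
      by_cases h2 : q.1 = 2
      · refine A.evalWord_HOps_ne ?_
        simp only [List.length_append, List.length_cons, List.length_map, List.length_take,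
          List.length_drop]
        omega
      · rw [A.evalWord_HOps_ne (l := (l.drop p.1).take q.1)]
        · exact evalWord_of_zero_mem _ (by simp)
        · rw [List.length_take, List.length_drop]
          omega

/-- An `A∞`-algebra is minimal if `d₁ = 0`. -/
def IsMinimal (A : AInfAlgebra.{u, v} k) : Prop := A.d 1 = 0

/-- The component `f₁` of a morphism of `A∞`-algebras, as a linear map. -/
def Hom.f₁ {A : AInfAlgebra.{u, v} k} {B : AInfAlgebra.{u, w} k} (f : Hom A B) :
    A.carrier →ₗ[k] B.carrier := arityOne f.f

theorem Hom.f₁_d₁ {A : AInfAlgebra.{u, v} k} {B : AInfAlgebra.{u, w} k} (f : Hom A B) (x : A) :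
    f.f₁ (A.d₁ x) = B.d₁ (f.f₁ x) := by
  have h := f.relation [x]
  rw [insertSum_one] at h
  simp [sum_composition_one, op_nil, evalWord_of_zero_mem, List.splitWrtComposition,
    List.splitWrtCompositionAux] at h
  exact h

/-- A morphism `f` of `A∞`-algebras is a quasi-isomorphism if `f₁ : (sA, d₁) → (sB, d₁)` induces
an isomorphism in cohomology. -/
def Hom.IsQuasiIso {A : AInfAlgebra.{u, v} k} {B : AInfAlgebra.{u, w} k} (f : Hom A B) : Prop :=
  Function.Bijective (HMap f.f₁ f.f₁_d₁)

/-- For a morphism `f : A → B` of `A∞`-algebras: the morphisms `B → A` of `A∞`-bimodules over `A`,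
where `B` is a bimodule over `A` by restriction of scalars along `f`. -/
abbrev Hom.Retraction {A : AInfAlgebra.{u, v} k} {B : AInfAlgebra.{u, w} k} (f : Hom A B) :=
  BimoduleHom A B.toGradedSpace A.toGradedSpace (restrictOp f (selfOp B)) (selfOp A)

theorem Hom.linearPart_d₁ {A : AInfAlgebra.{u, v} k} {B : AInfAlgebra.{u, w} k} (f : Hom A B)
    (r : f.Retraction) (m : B) : r.linearPart (B.d₁ m) = A.d₁ (r.linearPart m) := by
  have h := r.relation [] m []
  rw [insertSum_nil, insertSum_nil] at h
  simp only [op_nil, List.length_nil, Finset.Nat.antidiagonal_zero, Finset.sum_singleton,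
    List.take_nil, List.drop_nil, List.map_nil, restrictOp_nil] at h
  rw [evalBiWord_of_zero_mem_left _ (List.mem_singleton_self 0),
    evalBiWord_of_zero_mem_right _ _ _ (List.mem_singleton_self 0), zero_add, add_zero] at h
  exact h

/-- A morphism `f : A → B` of `A∞`-algebras admits a homotopy retract if there is a morphism
`r : B → A` of `A∞`-bimodules over `A` such that `r_{0,0} ∘ f₁` induces the identity in
cohomology. -/
def Hom.HasHomotopyRetract {A : AInfAlgebra.{u, v} k} {B : AInfAlgebra.{u, w} k} (f : Hom A B) : Prop :=
  ∃ r : f.Retraction,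
    HMap r.linearPart (f.linearPart_d₁ r) ∘ₗ HMap f.f₁ f.f₁_d₁ = LinearMap.id

/-- An `A∞`-algebra `A` is formal if there is a quasi-isomorphism `H(A) → A` of `A∞`-algebras. -/
def IsFormal (A : AInfAlgebra.{u, v} k) : Prop :=
  ∃ q : Hom A.cohomology A, q.IsQuasiIso

/-- `A` has a minimal model (a minimal `A∞`-algebra `M` with a quasi-isomorphism `M → A`) such that
`mᵢ = 0` for `3 ≤ i ≤ n`. The operation `mᵢ` is `dᵢ` up to suspensions, so that `mᵢ = 0` if and
only if `dᵢ = 0`. -/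
def HasMinimalModelUpTo (A : AInfAlgebra.{u, v} k) (n : ℕ∞) : Prop :=
  ∃ M : AInfAlgebra.{u, v} k, M.IsMinimal ∧ (∀ i : ℕ, 3 ≤ i → (i : ℕ∞) ≤ n → M.d i = 0) ∧
    ∃ q : Hom M A, q.IsQuasiIso

end AInfAlgebra

end Cohomology

end AInf

-- The vanishing of higher operations is detected by an Euler derivation. Extend the endomorphism
-- that multiplies `Vⁱ` by `i` to a coderivation of the tensor coalgebra. Since `dₙ` has degree `1`
-- on the suspension, it fails to commute with this coderivation by `(2 - n) • dₙ`
-- (`HasDeg.euler_word`). In characteristic `0`, a minimal structure therefore has only its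
-- operation of arity `2` exactly when its codifferential commutes with the Euler coderivation.
-- Commutation on words of length less than `N` controls the arities below `N`.
--
-- It is enough that some degree `0` coderivation commutes with the codifferential and has the Euler
-- endomorphism as its linear part. Such a coderivation is conjugate to the strict Euler
-- coderivation by an automorphism with identity linear part, because the coefficient `n - 1` that
-- has to be inverted in arity `n ≥ 2` is not zero (`exists_conj_teuler`). Conjugating the structure
-- on cohomology by that automorphism kills its operations (`Transfer.exists_minimalModel`).
--
-- Unlike a quasi-isomorphism, such a coderivation can be moved along a homotopy retract. If `δ` is
-- a coderivation of the bar construction of `B`, then `δ ∘ f` is a coderivation along `f`, that is,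
-- a Hochschild cochain of `A` with values in the bimodule `B`. The bimodule morphism `r` turns it
-- into a coderivation of `A` and respects commutation with the codifferentials
-- (`Hom.Retraction.push_comm`, `Hom.Retraction.exists_pullback`). Its linear part is `r₀₀ ∘ δ₁ ∘
-- f₁`. As `f₁` and `r₀₀` have degree `0` and compose to the identity in cohomology, this is again
-- the Euler endomorphism there.
--
-- Passing between an algebra and its cohomology uses homotopy transfer in a strong form. An
-- automorphism `Ψ` of the tensor coalgebra splits the bar construction into a minimal structure on
-- cohomology and a purely linear part (`exists_transfer`). Hence coderivations lift from cohomology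
-- and descend to it (`Transfer.exists_lift`, `Transfer.exists_descent`). A minimal model provides
-- the first one, by transport of its own Euler coderivation
-- (`Transfer.exists_coder_of_minimalModel`). The product of a minimal model on cohomology is forced
-- (`MinimalModel.m_pair`), so the vanishing of all other operations is formality itself.
--
-- Two devices run through the proof. Coalgebra maps and coderivations are determined by their
-- corestrictions, and they are built as fixed points that are contractive in the word length
-- (`exists_fixedPoint`). Coderivations are taken along a pair `(F', F)` whose left member carries
-- the Koszul sign, so that tensor products of maps need no sign rule.

universe x

namespace AInf

/-! ### Words in the tensor algebra, deconcatenation -/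

section TensorWords

open TensorAlgebra TensorProduct

variable {k : Type u} [Field k]
variable {V W X : Type*} [AddCommGroup V] [Module k V] [AddCommGroup W] [Module k W]
  [AddCommGroup X] [Module k X]

variable (k) in
/-- The word `x₁ ⊗ ⋯ ⊗ xₙ` in the tensor algebra. -/
def word (l : List V) : TensorAlgebra k V := (l.map (ι k)).prod

@[simp] theorem word_nil : word k ([] : List V) = 1 := rfl

@[simp] theorem word_cons (x : V) (l : List V) : word k (x :: l) = ι k x * word k l := by
  simp [word]

theorem word_append (l l' : List V) : word k (l ++ l') = word k l * word k l' := by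
  simp [word]

theorem word_eq_tprod (l : List V) : word k l = tprod k V l.length l.get := by
  rw [tprod_apply, word]
  congr 1
  conv_lhs => rw [← List.ofFn_get l, List.map_ofFn]
  rfl

theorem tprod_eq_word {n : ℕ} (x : Fin n → V) : tprod k V n x = word k (List.ofFn x) := by
  rw [tprod_apply, word, List.map_ofFn]; rfl

/-- The span contains `1` and is stable under left multiplication by letters, hence by the whole
algebra. -/
theorem span_words : Submodule.span k (Set.range (word k : List V → TensorAlgebra k V)) = ⊤ := by
  set S := Submodule.span k (Set.range (word k : List V → TensorAlgebra k V))
  have h1 : ∀ x : V, ∀ t ∈ S, ι k x * t ∈ S := by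
    intro x t ht
    induction ht using Submodule.span_induction with
    | mem t ht =>
      obtain ⟨l, rfl⟩ := ht
      exact Submodule.subset_span ⟨x :: l, by simp⟩
    | zero => simp
    | add a b _ _ ha hb => rw [mul_add]; exact S.add_mem ha hb
    | smul c a _ ha => rw [mul_smul_comm]; exact S.smul_mem c ha
  have h2 : ∀ s t : TensorAlgebra k V, t ∈ S → s * t ∈ S := by
    intro s
    induction s using TensorAlgebra.induction with
    | algebraMap r => intro t ht; rw [← Algebra.smul_def]; exact S.smul_mem r ht
    | ι x => exact h1 x
    | mul a b ha hb => intro t ht; rw [mul_assoc]; exact ha _ (hb _ ht)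
    | add a b ha hb => intro t ht; rw [add_mul]; exact S.add_mem (ha _ ht) (hb _ ht)
  refine eq_top_iff.2 fun t _ => ?_
  simpa using h2 t 1 (Submodule.subset_span ⟨[], rfl⟩)

theorem word_hom_ext {f g : TensorAlgebra k V →ₗ[k] X} (h : ∀ l, f (word k l) = g (word k l)) :
    f = g :=
  LinearMap.ext_on_range span_words h

/-! ### Linear maps from multilinear components; counit and projection to letters -/

/-- The linear map on the tensor algebra given by multilinear maps. -/
noncomputable def ofMultilinear (φ : (n : ℕ) → MultilinearMap k (fun _ : Fin n => V) X) :
    TensorAlgebra k V →ₗ[k] X :=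
  DirectSum.toModule k ℕ X (fun n => PiTensorProduct.lift (φ n)) ∘ₗ
    (toDirectSum (R := k) (M := V)).toLinearMap

theorem ofMultilinear_tprod (φ : (n : ℕ) → MultilinearMap k (fun _ : Fin n => V) X) {n : ℕ}
    (x : Fin n → V) : ofMultilinear φ (tprod k V n x) = φ n x := by
  rw [ofMultilinear, LinearMap.comp_apply, AlgHom.toLinearMap_apply,
    toDirectSum_tensorPower_tprod, ← DirectSum.lof_eq_of k, DirectSum.toModule_lof,
    PiTensorProduct.lift.tprod]

theorem ofMultilinear_word (φ : (n : ℕ) → MultilinearMap k (fun _ : Fin n => V) X) (l : List V) :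
    ofMultilinear φ (word k l) = evalWord φ l := by
  rw [word_eq_tprod, ofMultilinear_tprod]; rfl

/-- The linear map on the tensor algebra that agrees with `L n` on words of length `n`. -/
noncomputable def glue (L : ℕ → TensorAlgebra k V →ₗ[k] X) : TensorAlgebra k V →ₗ[k] X :=
  ofMultilinear fun n => (L n).compMultilinearMap (tprod k V n)

theorem glue_word (L : ℕ → TensorAlgebra k V →ₗ[k] X) (l : List V) :
    glue L (word k l) = L l.length (word k l) := by
  rw [glue, ofMultilinear_word, evalWord, LinearMap.compMultilinearMap_apply, ← word_eq_tprod]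

variable (k V) in
/-- The counit of the tensor coalgebra. -/
noncomputable def counit : TensorAlgebra k V →ₗ[k] k :=
  (algebraMapInv (R := k) (M := V)).toLinearMap

@[simp] theorem counit_one : counit k V 1 = 1 := by simp [counit]

@[simp] theorem counit_ι_mul (x : V) (t : TensorAlgebra k V) : counit k V (ι k x * t) = 0 := by
  simp [counit, algebraMapInv]

variable (k V) in
/-- The projection of the tensor coalgebra to its cogenerators. -/
noncomputable def pr : TensorAlgebra k V →ₗ[k] V := ιInv

@[simp] theorem pr_ι (x : V) : pr k V (ι k x) = x := ι_leftInverse x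

@[simp] theorem pr_one : pr k V 1 = 0 := by
  -- `ιInv` is the second component of the algebra map to the trivial square-zero extension `k ⊕ V`,
  -- which needs a right action on `V`; the commutative one is supplied here.
  let : Module kᵐᵒᵖ V := Module.compHom _ ((RingHom.id k).fromOpposite mul_comm)
  have : IsCentralScalar k V := ⟨fun r m => rfl⟩
  have h2 : ∀ t : TensorAlgebra k V, pr k V t = (toTrivSqZeroExt t).snd := fun t => rfl
  rw [h2, map_one, TrivSqZeroExt.snd_one]

-- This is the product rule in the square-zero extension: a letter has first component `0`, and the
-- first component of `t` is its counit.
@[simp] theorem pr_ι_mul (x : V) (t : TensorAlgebra k V) :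
    pr k V (ι k x * t) = counit k V t • x := by
  let : Module kᵐᵒᵖ V := Module.compHom _ ((RingHom.id k).fromOpposite mul_comm)
  have : IsCentralScalar k V := ⟨fun r m => rfl⟩
  have h : ∀ t : TensorAlgebra k V, (toTrivSqZeroExt t).fst = counit k V t := by
    intro t
    have : (TrivSqZeroExt.fstHom k k V).comp toTrivSqZeroExt = algebraMapInv (R := k) (M := V) := by
      ext; simp [algebraMapInv]
    exact AlgHom.congr_fun this t
  have h2 : ∀ t : TensorAlgebra k V, pr k V t = (toTrivSqZeroExt t).snd := fun t => rfl
  rw [h2, map_mul, toTrivSqZeroExt_ι, TrivSqZeroExt.snd_mul, h]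
  simp

theorem pr_word_of_length {l : List V} (h : l.length ≠ 1) : pr k V (word k l) = 0 := by
  match l, h with
  | [], _ => simp
  | x :: y :: l, _ => simp

/-! ### The deconcatenation coproduct -/

variable (k V) in
/-- The action of the tensor algebra that defines the deconcatenation coproduct. -/
noncomputable def deconcAction : TensorAlgebra k V →ₐ[k]
    Module.End k (TensorAlgebra k V × (TensorAlgebra k V ⊗[k] TensorAlgebra k V)) :=
  TensorAlgebra.lift k
    -- A pair stands for `(t, Δ t)`. The letter acts by the recursion `Δ (x t) = 1 ⊗ x t + (x ⊗ 1) Δ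
    -- t`, which needs `t` as well as `Δ t`.
    { toFun := fun v => LinearMap.prod (LinearMap.mulLeft k (ι k v) ∘ₗ LinearMap.fst k _ _)
        (TensorProduct.mk k _ _ 1 ∘ₗ LinearMap.mulLeft k (ι k v) ∘ₗ LinearMap.fst k _ _ +
          (LinearMap.mulLeft k (ι k v)).rTensor _ ∘ₗ LinearMap.snd k _ _)
      map_add' := by
        intro x y
        have e : LinearMap.mulLeft k (ι k x + ι k y) =
            LinearMap.mulLeft k (ι k x) + LinearMap.mulLeft k (ι k y) := by
          ext; simp [add_mul]
        refine LinearMap.ext fun p => Prod.ext ?_ ?_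
        · simp [add_mul]
        · simp only [LinearMap.prod_apply, Function.prod, LinearMap.add_apply,
            LinearMap.comp_apply, map_add, Prod.snd_add, e, LinearMap.rTensor_add]
          abel
      map_smul' := by
        intro c x
        have e : LinearMap.mulLeft k (c • ι k x) = c • LinearMap.mulLeft k (ι k x) := by
          ext; simp
        refine LinearMap.ext fun p => Prod.ext ?_ ?_
        · simp
        · simp only [LinearMap.prod_apply, Function.prod, LinearMap.add_apply, LinearMap.comp_apply,
            LinearMap.smul_apply, map_smul, RingHom.id_apply, Prod.smul_snd, smul_add, e,
            LinearMap.rTensor_smul] }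

theorem deconcAction_ι (x : V)
    (p : TensorAlgebra k V × (TensorAlgebra k V ⊗[k] TensorAlgebra k V)) :
    deconcAction k V (ι k x) p = (ι k x * p.1,
      1 ⊗ₜ (ι k x * p.1) + (LinearMap.mulLeft k (ι k x)).rTensor _ p.2) := by
  rw [deconcAction, lift_ι_apply]
  rfl

variable (k V) in
/-- The deconcatenation coproduct. -/
noncomputable def deconc :
    TensorAlgebra k V →ₗ[k] TensorAlgebra k V ⊗[k] TensorAlgebra k V where
  toFun t := (deconcAction k V t (1, 1 ⊗ₜ 1)).2
  map_add' := by simp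
  map_smul' := by simp

@[simp] theorem deconc_one : deconc k V 1 = 1 ⊗ₜ 1 := by simp [deconc]

theorem deconcAction_fst (t s : TensorAlgebra k V) (z) : (deconcAction k V t (s, z)).1 = t * s := by
  induction t using TensorAlgebra.induction generalizing s z with
  | algebraMap r => simp [Algebra.smul_def]
  | ι x => rw [deconcAction_ι]
  | mul a b ha hb =>
    rw [map_mul, Module.End.mul_apply, show deconcAction k V b (s, z) =
      ((deconcAction k V b (s, z)).1, (deconcAction k V b (s, z)).2) from rfl, ha, hb, mul_assoc]
  | add a b ha hb => rw [map_add, LinearMap.add_apply, Prod.fst_add, ha, hb, add_mul]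

@[simp] theorem deconc_ι_mul (x : V) (t : TensorAlgebra k V) : deconc k V (ι k x * t) =
    1 ⊗ₜ (ι k x * t) + (LinearMap.mulLeft k (ι k x)).rTensor _ (deconc k V t) := by
  have := deconcAction_fst t 1 (1 ⊗ₜ 1)
  rw [mul_one] at this
  simp only [deconc, LinearMap.coe_mk, AddHom.coe_mk, map_mul, Module.End.mul_apply,
    deconcAction_ι, this]

/-! ### Sums over factorisations of a word -/

/-- The sum of `G u v` over all factorisations `l = u ++ v`. -/
def splitSum {L M : Type*} [AddCommMonoid M] : List L → (List L → List L → M) → M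
  | [], G => G [] []
  | x :: l, G => G [] (x :: l) + splitSum l fun u v => G (x :: u) v

@[simp] theorem splitSum_nil {L M : Type*} [AddCommMonoid M] (G : List L → List L → M) :
    splitSum [] G = G [] [] := rfl

@[simp] theorem splitSum_cons {L M : Type*} [AddCommMonoid M] (x : L) (l : List L)
    (G : List L → List L → M) :
    splitSum (x :: l) G = G [] (x :: l) + splitSum l fun u v => G (x :: u) v := rfl

theorem splitSum_congr {L M : Type*} [AddCommMonoid M] {l : List L} {G G' : List L → List L → M}
    (h : ∀ u v, u ++ v = l → G u v = G' u v) : splitSum l G = splitSum l G' := by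
  induction l generalizing G G' with
  | nil => exact h [] [] rfl
  | cons x l ih =>
    rw [splitSum_cons, splitSum_cons, h [] _ rfl, ih fun u v huv => h (x :: u) v (by simp [huv])]

theorem splitSum_zero {L M : Type*} [AddCommMonoid M] (l : List L) :
    splitSum l (fun _ _ => (0 : M)) = 0 := by
  induction l with
  | nil => rfl
  | cons x l ih => simp [ih]

theorem splitSum_add {L M : Type*} [AddCommMonoid M] (l : List L) (G G' : List L → List L → M) :
    splitSum l (fun u v => G u v + G' u v) = splitSum l G + splitSum l G' := by
  induction l generalizing G G' with
  | nil => rfl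
  | cons x l ih => simp [ih]; abel

theorem map_splitSum {L M N F : Type*} [AddCommMonoid M] [AddCommMonoid N] [FunLike F M N]
    [AddMonoidHomClass F M N] (φ : F) (l : List L) (G : List L → List L → M) :
    φ (splitSum l G) = splitSum l fun u v => φ (G u v) := by
  induction l generalizing G with
  | nil => rfl
  | cons x l ih => simp [ih]

/-- Both sides run over the factorisations of `l` into three words; this is coassociativity of
deconcatenation. -/
theorem splitSum_assoc {L M : Type*} [AddCommMonoid M] (l : List L)
    (G : List L → List L → List L → M) :
    splitSum l (fun u v => splitSum v fun v1 v2 => G u v1 v2) =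
      splitSum l (fun u v => splitSum u fun u1 u2 => G u1 u2 v) := by
  induction l generalizing G with
  | nil => rfl
  | cons x l ih => simp [ih, splitSum_add, add_assoc]

theorem splitSum_map {L L' M : Type*} [AddCommMonoid M] (φ : L → L') (l : List L)
    (G : List L' → List L' → M) :
    splitSum (l.map φ) G = splitSum l fun u v => G (u.map φ) (v.map φ) := by
  induction l generalizing G with
  | nil => rfl
  | cons x l ih => simp [ih]

theorem splitSum_eq_antidiagonal {L M : Type*} [AddCommMonoid M] (l : List L)
    (G : List L → List L → M) :
    splitSum l G =
      ∑ p ∈ Finset.HasAntidiagonal.antidiagonal l.length, G (l.take p.1) (l.drop p.1) := by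
  induction l generalizing G with
  | nil => simp
  | cons x l ih => simp [ih, Finset.Nat.antidiagonal_succ]

theorem deconc_word (l : List V) :
    deconc k V (word k l) = splitSum l fun u v => word k u ⊗ₜ word k v := by
  induction l with
  | nil => simp
  | cons x l ih => simp [ih, map_splitSum]

/-! ### Convolution -/

/-- The convolution product. -/
noncomputable def conv (f g : TensorAlgebra k V →ₗ[k] TensorAlgebra k W) :
    TensorAlgebra k V →ₗ[k] TensorAlgebra k W :=
  LinearMap.mul' k _ ∘ₗ TensorProduct.map f g ∘ₗ deconc k V

theorem conv_word (f g : TensorAlgebra k V →ₗ[k] TensorAlgebra k W) (l : List V) :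
    conv f g (word k l) = splitSum l fun u v => f (word k u) * g (word k v) := by
  simp [conv, deconc_word, map_splitSum]

theorem map_deconc_word {Y : Type*} [AddCommGroup Y] [Module k Y] (f : TensorAlgebra k V →ₗ[k] X)
    (g : TensorAlgebra k V →ₗ[k] Y) (l : List V) :
    TensorProduct.map f g (deconc k V (word k l)) =
      splitSum l fun u v => f (word k u) ⊗ₜ g (word k v) := by
  simp [deconc_word, map_splitSum]

-- For a nonempty word the projection keeps only the factorisation that cuts after the first letter,
-- and multiplication glues the letter back. Applied to values of coalgebra maps and coderivations,
-- this yields their recursions `eq_conv`.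
variable (k V) in
theorem conv_ι_pr_id (t : TensorAlgebra k V) :
    conv (ι k ∘ₗ pr k V) LinearMap.id t = t - counit k V t • 1 := by
  suffices h : conv (ι k ∘ₗ pr k V) LinearMap.id =
      LinearMap.id - (counit k V).smulRight (1 : TensorAlgebra k V) from
    LinearMap.congr_fun h t
  refine word_hom_ext fun l => ?_
  rw [conv_word]
  match l with
  | [] => simp
  | x :: l =>
    simp only [splitSum_cons, word_nil, LinearMap.comp_apply, pr_one, map_zero, zero_mul, zero_add,
      word_cons, LinearMap.sub_apply, LinearMap.id_apply, LinearMap.smulRight_apply, counit_ι_mul,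
      zero_smul, sub_zero, pr_ι_mul]
    cases l with
    | nil => simp
    | cons y l => simp [splitSum_zero]

/-! ### Agreement on short words and contractive fixed points -/

/-- Agreement of two linear maps on the words of length less than `n`. -/
def EqBelow (n : ℕ) (f g : TensorAlgebra k V →ₗ[k] X) : Prop :=
  ∀ l : List V, l.length < n → f (word k l) = g (word k l)

theorem EqBelow.rfl' {n : ℕ} {f : TensorAlgebra k V →ₗ[k] X} : EqBelow n f f := fun _ _ => rfl

theorem EqBelow.symm {n : ℕ} {f g : TensorAlgebra k V →ₗ[k] X} (h : EqBelow n f g) :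
    EqBelow n g f := fun l hl => (h l hl).symm

theorem EqBelow.trans {n : ℕ} {f g g' : TensorAlgebra k V →ₗ[k] X} (h : EqBelow n f g)
    (h' : EqBelow n g g') : EqBelow n f g' := fun l hl => (h l hl).trans (h' l hl)

theorem EqBelow.mono {m n : ℕ} (hmn : m ≤ n) {f g : TensorAlgebra k V →ₗ[k] X}
    (h : EqBelow n f g) : EqBelow m f g := fun l hl => h l (hl.trans_le hmn)

theorem eq_of_eqBelow {f g : TensorAlgebra k V →ₗ[k] X} (h : ∀ n, EqBelow n f g) : f = g :=
  word_hom_ext fun l => h (l.length + 1) l (Nat.lt_succ_self _)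

/-- A contractive map on linear maps has a fixed point, which lies in any given closed set that is
preserved. -/
theorem exists_fixedPoint (Θ : (TensorAlgebra k V →ₗ[k] X) → TensorAlgebra k V →ₗ[k] X)
    (P : (TensorAlgebra k V →ₗ[k] X) → Prop) (h0 : P 0)
    (hcl : ∀ f, (∀ n, ∃ g, P g ∧ EqBelow n f g) → P f) (hP : ∀ f, P f → P (Θ f))
    (hΘ : ∀ n f g, P f → P g → EqBelow n f g → EqBelow (n + 1) (Θ f) (Θ g)) :
    ∃ f, P f ∧ Θ f = f := by
  have hit : ∀ n, P (Θ^[n] 0) := by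
    intro n
    induction n with
    | zero => exact h0
    | succ n ih => rw [Function.iterate_succ_apply']; exact hP _ ih
  have h1 : ∀ n, EqBelow n (Θ^[n] 0) (Θ^[n + 1] 0) := by
    intro n
    induction n with
    | zero => intro l hl; exact absurd hl (Nat.not_lt_zero _)
    | succ n ih =>
      rw [Function.iterate_succ_apply' Θ n, Function.iterate_succ_apply' Θ (n + 1)]
      exact hΘ _ _ _ (hit _) (hit _) ih
  have h2 : ∀ n m, n ≤ m → EqBelow n (Θ^[n] 0) (Θ^[m] 0) := by
    intro n m hm
    induction m, hm using Nat.le_induction with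
    | base => exact EqBelow.rfl'
    | succ m hm ih => exact ih.trans ((h1 m).mono hm)
  -- The limit of the iterates: words of length `n` see the iterate of index `n + 1`, from which
  -- point on the values are stationary.
  let f : TensorAlgebra k V →ₗ[k] X := glue fun n => Θ^[n + 1] 0
  have hf : ∀ n, EqBelow n f (Θ^[n] 0) := by
    intro n l hl
    rw [glue_word]
    exact h2 (l.length + 1) n hl l (Nat.lt_succ_self _)
  have hPf : P f := hcl f fun n => ⟨_, hit n, hf n⟩
  refine ⟨f, hPf, eq_of_eqBelow fun n => ?_⟩
  have := hΘ _ _ _ hPf (hit n) (hf n)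
  rw [← Function.iterate_succ_apply' Θ n] at this
  exact (this.trans (hf (n + 1)).symm).mono (Nat.le_succ n)

end TensorWords


/-! ### Coalgebra maps and coderivations -/

section Coderivations

open TensorAlgebra TensorProduct

variable {k : Type u} [Field k]
variable {U V W X : Type*} [AddCommGroup U] [Module k U] [AddCommGroup V] [Module k V]
  [AddCommGroup W] [Module k W] [AddCommGroup X] [Module k X]

/-- Maps of tensor coalgebras. -/
structure IsCoalgHom (F : TensorAlgebra k V →ₗ[k] TensorAlgebra k W) : Prop where
  map_one : F 1 = 1
  counit_comp : ∀ t, counit k W (F t) = counit k V t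
  deconc_comp : deconc k W ∘ₗ F = TensorProduct.map F F ∘ₗ deconc k V

/-- Coderivations along a pair of maps of tensor coalgebras. -/
structure IsCoder (F' F D : TensorAlgebra k V →ₗ[k] TensorAlgebra k W) : Prop where
  map_one : D 1 = 0
  counit_comp : ∀ t, counit k W (D t) = 0
  deconc_comp : deconc k W ∘ₗ D = (TensorProduct.map F' D + TensorProduct.map D F) ∘ₗ deconc k V

theorem IsCoalgHom.id : IsCoalgHom (LinearMap.id : TensorAlgebra k V →ₗ[k] TensorAlgebra k V) :=
  ⟨rfl, fun _ => rfl, by simp⟩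

theorem IsCoalgHom.comp {G : TensorAlgebra k V →ₗ[k] TensorAlgebra k W}
    {F : TensorAlgebra k U →ₗ[k] TensorAlgebra k V} (hG : IsCoalgHom G) (hF : IsCoalgHom F) :
    IsCoalgHom (G ∘ₗ F) where
  map_one := by simp [hF.map_one, hG.map_one]
  counit_comp t := by simp [hF.counit_comp, hG.counit_comp]
  deconc_comp := by
    rw [← LinearMap.comp_assoc, hG.deconc_comp, LinearMap.comp_assoc, hF.deconc_comp,
      ← LinearMap.comp_assoc, TensorProduct.map_comp]

theorem IsCoder.comp_hom {F' F D : TensorAlgebra k V →ₗ[k] TensorAlgebra k W}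
    {G : TensorAlgebra k U →ₗ[k] TensorAlgebra k V} (hD : IsCoder F' F D) (hG : IsCoalgHom G) :
    IsCoder (F' ∘ₗ G) (F ∘ₗ G) (D ∘ₗ G) where
  map_one := by simp [hG.map_one, hD.map_one]
  counit_comp t := by simp [hD.counit_comp]
  deconc_comp := by
    rw [← LinearMap.comp_assoc, hD.deconc_comp, LinearMap.comp_assoc, hG.deconc_comp,
      ← LinearMap.comp_assoc, LinearMap.add_comp, TensorProduct.map_comp, TensorProduct.map_comp]

theorem IsCoder.hom_comp {F' F D : TensorAlgebra k U →ₗ[k] TensorAlgebra k V}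
    {G : TensorAlgebra k V →ₗ[k] TensorAlgebra k W} (hG : IsCoalgHom G) (hD : IsCoder F' F D) :
    IsCoder (G ∘ₗ F') (G ∘ₗ F) (G ∘ₗ D) where
  map_one := by simp [hD.map_one]
  counit_comp t := by simp [hG.counit_comp, hD.counit_comp]
  deconc_comp := by
    rw [← LinearMap.comp_assoc, hG.deconc_comp, LinearMap.comp_assoc, hD.deconc_comp,
      ← LinearMap.comp_assoc, LinearMap.comp_add, TensorProduct.map_comp, TensorProduct.map_comp]

theorem IsCoder.add_smul {F' F D E : TensorAlgebra k V →ₗ[k] TensorAlgebra k W}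
    (hD : IsCoder F' F D) (s : k) (hE : IsCoder F' F E) : IsCoder F' F (D + s • E) where
  map_one := by simp [hD.map_one, hE.map_one]
  counit_comp t := by simp [hD.counit_comp, hE.counit_comp]
  deconc_comp := by
    rw [LinearMap.comp_add, LinearMap.comp_smul, hD.deconc_comp, hE.deconc_comp,
      TensorProduct.map_add_right, TensorProduct.map_add_left, TensorProduct.map_smul_left,
      TensorProduct.map_smul_right, ← LinearMap.smul_comp, ← LinearMap.add_comp]
    congr 1
    rw [smul_add]
    abel

theorem IsCoder.sub {F' F D E : TensorAlgebra k V →ₗ[k] TensorAlgebra k W}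
    (hD : IsCoder F' F D) (hE : IsCoder F' F E) : IsCoder F' F (D - E) := by
  have := hD.add_smul (-1 : k) hE
  have e : D + (-1 : k) • E = D - E := by module
  rwa [e] at this

theorem IsCoder.add {F' F D E : TensorAlgebra k V →ₗ[k] TensorAlgebra k W}
    (hD : IsCoder F' F D) (hE : IsCoder F' F E) : IsCoder F' F (D + E) := by
  have := hD.add_smul 1 hE
  rwa [one_smul] at this

theorem IsCoder.zero (F' F : TensorAlgebra k V →ₗ[k] TensorAlgebra k W) : IsCoder F' F 0 :=
  ⟨rfl, fun _ => by simp, by ext; simp⟩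

/-- One has `F ⊗ F - G ⊗ G = F ⊗ (F - G) + (F - G) ⊗ G`. Uniqueness statements for coalgebra maps
thereby reduce to those for coderivations. -/
theorem IsCoalgHom.sub {F G : TensorAlgebra k V →ₗ[k] TensorAlgebra k W} (hF : IsCoalgHom F)
    (hG : IsCoalgHom G) : IsCoder F G (F - G) where
  map_one := by simp [hF.map_one, hG.map_one]
  counit_comp t := by simp [hF.counit_comp, hG.counit_comp]
  deconc_comp := by
    rw [LinearMap.comp_sub, hF.deconc_comp, hG.deconc_comp, ← LinearMap.sub_comp]
    congr 1
    have h1 := TensorProduct.map_add_right F (F - G) G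
    have h2 := TensorProduct.map_add_left (F - G) G G
    rw [sub_add_cancel] at h1 h2
    rw [h1, h2]
    abel

/-- A linear combination of composites of coderivations is a coderivation if the mixed terms
cancel. -/
theorem IsCoder.comp_add_comp {D₁ F₁' F₁ : TensorAlgebra k V →ₗ[k] TensorAlgebra k W}
    {E₁ G₁' G₁ : TensorAlgebra k U →ₗ[k] TensorAlgebra k V}
    {D₂ F₂' F₂ : TensorAlgebra k X →ₗ[k] TensorAlgebra k W}
    {E₂ G₂' G₂ : TensorAlgebra k U →ₗ[k] TensorAlgebra k X}
    {P' P : TensorAlgebra k U →ₗ[k] TensorAlgebra k W} (s : k)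
    (hD₁ : IsCoder F₁' F₁ D₁) (hE₁ : IsCoder G₁' G₁ E₁) (hD₂ : IsCoder F₂' F₂ D₂)
    (hE₂ : IsCoder G₂' G₂ E₂) (h1' : F₁' ∘ₗ G₁' = P') (h2' : F₂' ∘ₗ G₂' = P') (h1 : F₁ ∘ₗ G₁ = P)
    (h2 : F₂ ∘ₗ G₂ = P)
    (hc : TensorProduct.map (F₁' ∘ₗ E₁) (D₁ ∘ₗ G₁) + TensorProduct.map (D₁ ∘ₗ G₁') (F₁ ∘ₗ E₁) +
      s • (TensorProduct.map (F₂' ∘ₗ E₂) (D₂ ∘ₗ G₂) +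
        TensorProduct.map (D₂ ∘ₗ G₂') (F₂ ∘ₗ E₂)) = 0) :
    IsCoder P' P (D₁ ∘ₗ E₁ + s • D₂ ∘ₗ E₂) where
  map_one := by simp [hE₁.map_one, hE₂.map_one]
  counit_comp t := by simp [hD₁.counit_comp, hD₂.counit_comp]
  deconc_comp := by
    have e1 : deconc k W ∘ₗ (D₁ ∘ₗ E₁) = (TensorProduct.map P' (D₁ ∘ₗ E₁) +
        TensorProduct.map (D₁ ∘ₗ E₁) P + (TensorProduct.map (F₁' ∘ₗ E₁) (D₁ ∘ₗ G₁) +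
          TensorProduct.map (D₁ ∘ₗ G₁') (F₁ ∘ₗ E₁))) ∘ₗ deconc k U := by
      rw [← LinearMap.comp_assoc, hD₁.deconc_comp, LinearMap.comp_assoc, hE₁.deconc_comp,
        ← LinearMap.comp_assoc, ← h1', ← h1]
      congr 1
      simp only [LinearMap.add_comp, LinearMap.comp_add, TensorProduct.map_comp]
      abel
    have e2 : deconc k W ∘ₗ (D₂ ∘ₗ E₂) = (TensorProduct.map P' (D₂ ∘ₗ E₂) +
        TensorProduct.map (D₂ ∘ₗ E₂) P + (TensorProduct.map (F₂' ∘ₗ E₂) (D₂ ∘ₗ G₂) +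
          TensorProduct.map (D₂ ∘ₗ G₂') (F₂ ∘ₗ E₂))) ∘ₗ deconc k U := by
      rw [← LinearMap.comp_assoc, hD₂.deconc_comp, LinearMap.comp_assoc, hE₂.deconc_comp,
        ← LinearMap.comp_assoc, ← h2', ← h2]
      congr 1
      simp only [LinearMap.add_comp, LinearMap.comp_add, TensorProduct.map_comp]
      abel
    rw [LinearMap.comp_add, LinearMap.comp_smul, e1, e2, ← LinearMap.smul_comp,
      ← LinearMap.add_comp, TensorProduct.map_add_right, TensorProduct.map_add_left,
      TensorProduct.map_smul_left, TensorProduct.map_smul_right]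
    congr 1
    rw [← sub_eq_zero, ← hc]
    simp only [smul_add]
    abel

/-! #### The length filtration -/

variable (k V) in
/-- The span of the words of length less than `n`. -/
def fil (n : ℕ) : Submodule k (TensorAlgebra k V) :=
  Submodule.span k (word k '' {l : List V | l.length < n})

theorem word_mem_fil {l : List V} {n : ℕ} (h : l.length < n) : word k l ∈ fil k V n :=
  Submodule.subset_span ⟨l, h, rfl⟩

theorem fil_mono {m n : ℕ} (h : m ≤ n) : fil k V m ≤ fil k V n :=
  Submodule.span_mono (Set.image_mono fun _ hl => lt_of_lt_of_le hl h)

theorem EqBelow.eq_of_mem {n : ℕ} {f g : TensorAlgebra k V →ₗ[k] X} (h : EqBelow n f g)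
    {t : TensorAlgebra k V} (ht : t ∈ fil k V n) : f t = g t := by
  induction ht using Submodule.span_induction with
  | mem t ht => obtain ⟨l, hl, rfl⟩ := ht; exact h l hl
  | zero => simp
  | add a b _ _ ha hb => simp [ha, hb]
  | smul c a _ ha => simp [ha]

theorem ι_mul_mem_fil (x : V) {t : TensorAlgebra k V} {n : ℕ} (ht : t ∈ fil k V n) :
    ι k x * t ∈ fil k V (n + 1) := by
  induction ht using Submodule.span_induction with
  | mem t ht =>
    obtain ⟨l, hl, rfl⟩ := ht
    rw [← word_cons]
    exact word_mem_fil (by simpa using hl)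
  | zero => simp
  | add a b _ _ ha hb => rw [mul_add]; exact Submodule.add_mem _ ha hb
  | smul c a _ ha => rw [mul_smul_comm]; exact Submodule.smul_mem _ c ha

theorem splitSum_mem {L : Type*} {S : Submodule k X} {l : List L} {G : List L → List L → X}
    (h : ∀ u v, u ++ v = l → G u v ∈ S) : splitSum l G ∈ S := by
  induction l generalizing G with
  | nil => exact h [] [] rfl
  | cons x l ih =>
    exact S.add_mem (h [] _ rfl) (ih fun u v huv => h (x :: u) v (by simp [huv]))

/-- Apply `conv_ι_pr_id` to `F t` and move the coproduct through `F`. The result is a recursion on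
length in terms of the corestriction. -/
theorem IsCoalgHom.eq_conv {F : TensorAlgebra k V →ₗ[k] TensorAlgebra k W} (hF : IsCoalgHom F)
    (t : TensorAlgebra k V) :
    F t = counit k V t • 1 + conv (ι k ∘ₗ pr k W ∘ₗ F) F t := by
  have h := conv_ι_pr_id k W (F t)
  rw [hF.counit_comp, eq_sub_iff_add_eq, add_comm] at h
  rw [← h, conv, LinearMap.comp_apply, LinearMap.comp_apply, ← LinearMap.comp_apply (deconc k W),
    hF.deconc_comp, LinearMap.comp_apply, ← LinearMap.comp_apply (TensorProduct.map _ _),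
    ← TensorProduct.map_comp, LinearMap.comp_assoc, LinearMap.id_comp]
  rfl

theorem IsCoder.eq_conv {F' F D : TensorAlgebra k V →ₗ[k] TensorAlgebra k W} (hD : IsCoder F' F D)
    (t : TensorAlgebra k V) :
    D t = conv (ι k ∘ₗ pr k W ∘ₗ F') D t + conv (ι k ∘ₗ pr k W ∘ₗ D) F t := by
  have h := conv_ι_pr_id k W (D t)
  rw [hD.counit_comp, zero_smul, sub_zero] at h
  rw [← h, conv, LinearMap.comp_apply, LinearMap.comp_apply, ← LinearMap.comp_apply (deconc k W),
    hD.deconc_comp, LinearMap.comp_apply, ← LinearMap.comp_apply (TensorProduct.map _ _),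
    LinearMap.comp_add, ← TensorProduct.map_comp, ← TensorProduct.map_comp, LinearMap.comp_assoc,
    LinearMap.id_comp, LinearMap.comp_assoc, LinearMap.id_comp, LinearMap.add_apply, map_add]
  rfl

/-- In the recursion `eq_conv`, the left factor consumes at least one letter and produces exactly
one. -/
theorem IsCoalgHom.word_mem {F : TensorAlgebra k V →ₗ[k] TensorAlgebra k W} (hF : IsCoalgHom F)
    (l : List V) : F (word k l) ∈ fil k W (l.length + 1) := by
  induction h : l.length using Nat.strong_induction_on generalizing l with
  | _ n ih =>
  match l, h with
  | [], h =>
    subst h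
    simpa [hF.map_one] using word_mem_fil (k := k) (l := ([] : List W)) Nat.one_pos
  | x :: l, h =>
    subst h
    rw [hF.eq_conv, word_cons, counit_ι_mul, zero_smul, zero_add, ← word_cons, conv_word,
      splitSum_cons]
    simp only [word_nil, LinearMap.comp_apply, hF.map_one, pr_one, map_zero, zero_mul, zero_add]
    refine splitSum_mem fun u v huv => ?_
    have hl : v.length ≤ l.length := by simp [← huv]
    exact fil_mono (by simp; omega) (ι_mul_mem_fil _ (ih v.length (by simp; omega) v rfl))

theorem IsCoder.word_mem {F' F D : TensorAlgebra k V →ₗ[k] TensorAlgebra k W} (hD : IsCoder F' F D)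
    (hF' : IsCoalgHom F') (hF : IsCoalgHom F) (l : List V) :
    D (word k l) ∈ fil k W (l.length + 1) := by
  induction h : l.length using Nat.strong_induction_on generalizing l with
  | _ n ih =>
  match l, h with
  | [], h => simp [hD.map_one]
  | x :: l, h =>
    subst h
    rw [hD.eq_conv, conv_word, conv_word, splitSum_cons, splitSum_cons]
    simp only [word_nil, LinearMap.comp_apply, hF'.map_one, hD.map_one, pr_one, map_zero, zero_mul,
      zero_add]
    refine Submodule.add_mem _ (splitSum_mem fun u v huv => ?_) (splitSum_mem fun u v huv => ?_)
    all_goals have hl : v.length ≤ l.length := by simp [← huv]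
    · exact fil_mono (by simp; omega) (ι_mul_mem_fil _ (ih v.length (by simp; omega) v rfl))
    · exact fil_mono (by simp; omega) (ι_mul_mem_fil _ (hF.word_mem v))

/-- A coderivation whose corestriction vanishes on letters lowers the length. -/
theorem IsCoder.word_mem_of_decreasing {F' F D : TensorAlgebra k V →ₗ[k] TensorAlgebra k W}
    (hD : IsCoder F' F D) (hF' : IsCoalgHom F') (hF : IsCoalgHom F)
    (h1 : ∀ x, pr k W (D (ι k x)) = 0) (l : List V) : D (word k l) ∈ fil k W l.length := by
  induction h : l.length using Nat.strong_induction_on generalizing l with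
  | _ n ih =>
  match l, h with
  | [], h => simp [hD.map_one]
  | x :: l, h =>
    subst h
    rw [hD.eq_conv, conv_word, conv_word, splitSum_cons, splitSum_cons]
    simp only [word_nil, LinearMap.comp_apply, hF'.map_one, hD.map_one, pr_one, map_zero, zero_mul,
      zero_add]
    refine Submodule.add_mem _ (splitSum_mem fun u v huv => ?_) (splitSum_mem fun u v huv => ?_)
    all_goals have hl : u.length + v.length = l.length := by simp [← huv]
    · exact fil_mono (by simp; omega) (ι_mul_mem_fil _ (ih v.length (by simp; omega) v rfl))
    · match u, huv, hl with
      -- Here the left factor is the single letter `x`, where the corestriction vanishes; a longer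
      -- left factor shortens the word.
      | [], _, _ => simp [h1]
      | y :: u, huv, hl =>
        refine fil_mono ?_ (ι_mul_mem_fil _ (hF.word_mem v))
        simp at hl ⊢; omega

/-- Linear maps that do not raise the length of words. -/
def PreservesFil (L : TensorAlgebra k V →ₗ[k] TensorAlgebra k W) : Prop :=
  ∀ l : List V, L (word k l) ∈ fil k W (l.length + 1)

/-- Linear maps that lower the length of words. -/
def LowersFil (L : TensorAlgebra k V →ₗ[k] TensorAlgebra k W) : Prop :=
  ∀ l : List V, L (word k l) ∈ fil k W l.length

theorem EqBelow.comp {n : ℕ} {f g : TensorAlgebra k W →ₗ[k] X}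
    {L : TensorAlgebra k V →ₗ[k] TensorAlgebra k W} (h : EqBelow n f g) (hL : PreservesFil L) :
    EqBelow n (f ∘ₗ L) (g ∘ₗ L) :=
  fun l hl => h.eq_of_mem (fil_mono hl (hL l))

theorem EqBelow.comp_lowers {n : ℕ} {f g : TensorAlgebra k W →ₗ[k] X}
    {L : TensorAlgebra k V →ₗ[k] TensorAlgebra k W} (h : EqBelow n f g) (hL : LowersFil L) :
    EqBelow (n + 1) (f ∘ₗ L) (g ∘ₗ L) :=
  fun l hl => h.eq_of_mem (fil_mono (Nat.le_of_lt_succ hl) (hL l))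

theorem EqBelow.comp_left {n : ℕ} {f g : TensorAlgebra k V →ₗ[k] W} (h : EqBelow n f g)
    (L : W →ₗ[k] X) : EqBelow n (L ∘ₗ f) (L ∘ₗ g) :=
  fun l hl => congrArg L (h l hl)

theorem EqBelow.add {n : ℕ} {f g f' g' : TensorAlgebra k V →ₗ[k] X} (h : EqBelow n f g)
    (h' : EqBelow n f' g') : EqBelow n (f + f') (g + g') :=
  fun l hl => by simp [h l hl, h' l hl]

theorem EqBelow.sub {n : ℕ} {f g f' g' : TensorAlgebra k V →ₗ[k] X} (h : EqBelow n f g)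
    (h' : EqBelow n f' g') : EqBelow n (f - f') (g - g') :=
  fun l hl => by simp [h l hl, h' l hl]

/-! #### Coderivations are determined by their corestrictions -/

theorem counit_rTensor_deconc (t : TensorAlgebra k V) :
    TensorProduct.map (counit k V) LinearMap.id (deconc k V t) = 1 ⊗ₜ t := by
  suffices h : TensorProduct.map (counit k V) LinearMap.id ∘ₗ deconc k V =
    TensorProduct.mk k k _ 1 from LinearMap.congr_fun h t
  refine word_hom_ext fun l => ?_
  rw [LinearMap.comp_apply, map_deconc_word]
  cases l <;> simp [splitSum_zero]

/-- Primitive elements are letters. The counit axiom forces the counit of `t` to vanish, and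
`conv_ι_pr_id` then returns only the projection of `t`. -/
theorem eq_ι_pr_of_primitive {t : TensorAlgebra k V} (h : deconc k V t = 1 ⊗ₜ t + t ⊗ₜ 1) :
    t = ι k (pr k V t) := by
  have h1 := counit_rTensor_deconc t
  rw [h, map_add, TensorProduct.map_tmul, TensorProduct.map_tmul, counit_one, LinearMap.id_apply,
    LinearMap.id_apply, add_eq_left, ] at h1
  have h2 : counit k V t • (1 : TensorAlgebra k V) = 0 := by
    simpa using congrArg (TensorProduct.lid k _) h1
  have h3 := conv_ι_pr_id k V t
  rw [h2, sub_zero, conv, LinearMap.comp_apply, LinearMap.comp_apply, h] at h3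
  simpa using h3.symm

theorem splitSum_ends {L M : Type*} [AddCommMonoid M] {l : List L} (hl : l ≠ [])
    {G : List L → List L → M} (h : ∀ u v, u ++ v = l → u ≠ [] → v ≠ [] → G u v = 0) :
    splitSum l G = G [] l + G l [] := by
  match l, hl with
  | x :: l, hl =>
    rw [splitSum_cons]
    congr 1
    have h' : ∀ u v, u ++ v = l → v ≠ [] → G (x :: u) v = 0 := fun u v huv hv =>
      h (x :: u) v (by simp [huv]) (by simp) hv
    clear h
    suffices H : ∀ G : List L → List L → M, (∀ u v, u ++ v = l → v ≠ [] → G u v = 0) →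
      splitSum l G = G l [] from H (fun u v => G (x :: u) v) h'
    clear h' hl
    induction l with
    | nil => intro G _; rfl
    | cons y l ih =>
      intro G hG
      rw [splitSum_cons, hG [] _ rfl (by simp), zero_add]
      exact ih (fun u v => G (y :: u) v) fun u v huv hv => hG (y :: u) v (by simp [huv]) hv

/-- The leading terms of a coderivation are letters. -/
theorem IsCoder.leading {F' F D : TensorAlgebra k V →ₗ[k] TensorAlgebra k W} (hD : IsCoder F' F D)
    (hF' : IsCoalgHom F') (hF : IsCoalgHom F) {n : ℕ} (h : EqBelow n D 0) :
    EqBelow (n + 1) D (ι k ∘ₗ pr k W ∘ₗ D) := by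
  intro l hl
  -- As `D` vanishes on shorter words, only the two trivial factorisations contribute to the
  -- coproduct of `D (word k l)`, which is therefore primitive.
  refine eq_ι_pr_of_primitive ?_
  rw [← LinearMap.comp_apply, hD.deconc_comp, LinearMap.comp_apply, LinearMap.add_apply,
    map_deconc_word, map_deconc_word, ← splitSum_add]
  rcases eq_or_ne l [] with rfl | hne
  · simp [hD.map_one]
  rw [splitSum_ends hne]
  · simp [hD.map_one, hF'.map_one, hF.map_one]
  · intro u v huv hu hv
    have hlen : u.length + v.length = l.length := by simp [← huv]
    have hu' := List.length_pos_iff.2 hu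
    have hv' := List.length_pos_iff.2 hv
    rw [h u (by omega), h v (by omega)]
    simp

/-- Induction on the length: once `D` vanishes on shorter words, its value is the letter given by
the corestriction, which is zero. -/
theorem IsCoder.eqBelow_zero {F' F D : TensorAlgebra k V →ₗ[k] TensorAlgebra k W}
    (hD : IsCoder F' F D) (hF' : IsCoalgHom F') (hF : IsCoalgHom F) {n : ℕ}
    (h : EqBelow n (pr k W ∘ₗ D) 0) : EqBelow n D 0 := by
  suffices H : ∀ m, m ≤ n → EqBelow m D 0 from H n le_rfl
  intro m
  induction m with
  | zero => intro _ l hl; exact absurd hl (Nat.not_lt_zero _)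
  | succ m ih =>
    intro hm l hl
    rw [hD.leading hF' hF (ih (Nat.le_of_succ_le hm)) l hl]
    have := h l (hl.trans_le hm)
    rw [LinearMap.comp_apply, this]
    simp

theorem IsCoder.eqBelow {F' F D E : TensorAlgebra k V →ₗ[k] TensorAlgebra k W}
    (hD : IsCoder F' F D) (hE : IsCoder F' F E) (hF' : IsCoalgHom F') (hF : IsCoalgHom F) {n : ℕ}
    (h : EqBelow n (pr k W ∘ₗ D) (pr k W ∘ₗ E)) : EqBelow n D E := by
  have := (hD.sub hE).eqBelow_zero hF' hF (n := n) fun l hl => by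
    have := h l hl
    simp only [LinearMap.comp_apply] at this
    simp [this]
  intro l hl
  simpa [sub_eq_zero] using this l hl

theorem IsCoder.ext {F' F D E : TensorAlgebra k V →ₗ[k] TensorAlgebra k W}
    (hD : IsCoder F' F D) (hE : IsCoder F' F E) (hF' : IsCoalgHom F') (hF : IsCoalgHom F)
    (h : pr k W ∘ₗ D = pr k W ∘ₗ E) : D = E :=
  eq_of_eqBelow fun _ => hD.eqBelow hE hF' hF (h ▸ EqBelow.rfl')

theorem IsCoalgHom.eqBelow {F G : TensorAlgebra k V →ₗ[k] TensorAlgebra k W}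
    (hF : IsCoalgHom F) (hG : IsCoalgHom G) {n : ℕ}
    (h : EqBelow n (pr k W ∘ₗ F) (pr k W ∘ₗ G)) : EqBelow n F G := by
  have := (hF.sub hG).eqBelow_zero hF hG (n := n) fun l hl => by
    have := h l hl
    simp only [LinearMap.comp_apply] at this
    simp [this]
  intro l hl
  simpa [sub_eq_zero] using this l hl

theorem IsCoalgHom.ext {F G : TensorAlgebra k V →ₗ[k] TensorAlgebra k W}
    (hF : IsCoalgHom F) (hG : IsCoalgHom G) (h : pr k W ∘ₗ F = pr k W ∘ₗ G) : F = G :=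
  eq_of_eqBelow fun _ => hF.eqBelow hG (h ▸ EqBelow.rfl')

/-! #### Truncation of corestrictions -/

/-- The part of a linear map that vanishes on letters. -/
noncomputable def trunc (f : TensorAlgebra k V →ₗ[k] X) : TensorAlgebra k V →ₗ[k] X :=
  f - f ∘ₗ ι k ∘ₗ pr k V

@[simp] theorem trunc_ι (f : TensorAlgebra k V →ₗ[k] X) (x : V) : trunc f (ι k x) = 0 := by
  simp [trunc]

@[simp] theorem trunc_one (f : TensorAlgebra k V →ₗ[k] X) : trunc f 1 = f 1 := by
  simp [trunc]

theorem trunc_add (f : TensorAlgebra k V →ₗ[k] X) : f ∘ₗ ι k ∘ₗ pr k V + trunc f = f := by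
  simp [trunc]

theorem EqBelow.trunc {n : ℕ} {f g : TensorAlgebra k V →ₗ[k] X} (h : EqBelow n f g) :
    EqBelow n (trunc f) (trunc g) := by
  intro l hl
  simp only [AInf.trunc, LinearMap.sub_apply, LinearMap.comp_apply, h l hl]
  congr 1
  by_cases h1 : l.length = 1
  · obtain ⟨x, rfl⟩ := List.length_eq_one_iff.1 h1
    have := h [x] hl
    simpa using this
  · simp [pr_word_of_length h1]

/-- On the words of length `n` the values of `D` are letters, which `trunc f` does not see. This
gain of one unit of length makes the fixed-point maps of the later constructions contractive. -/
theorem IsCoder.trunc_comp {F' F D : TensorAlgebra k V →ₗ[k] TensorAlgebra k W}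
    (hD : IsCoder F' F D) (hF' : IsCoalgHom F') (hF : IsCoalgHom F) {n : ℕ}
    (h : EqBelow n (pr k W ∘ₗ D) 0) (f : TensorAlgebra k W →ₗ[k] X) :
    EqBelow (n + 1) (trunc f ∘ₗ D) 0 := by
  intro l hl
  rw [LinearMap.comp_apply, hD.leading hF' hF (hD.eqBelow_zero hF' hF h) l hl]
  simp

theorem IsCoder.trunc_comp_eqBelow {F' F D E : TensorAlgebra k V →ₗ[k] TensorAlgebra k W}
    (hD : IsCoder F' F D) (hE : IsCoder F' F E) (hF' : IsCoalgHom F') (hF : IsCoalgHom F) {n : ℕ}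
    (h : EqBelow n (pr k W ∘ₗ D) (pr k W ∘ₗ E)) (f : TensorAlgebra k W →ₗ[k] X) :
    EqBelow (n + 1) (trunc f ∘ₗ D) (trunc f ∘ₗ E) := by
  have := (hD.sub hE).trunc_comp hF' hF (n := n) (fun l hl => by
    have := h l hl
    simp only [LinearMap.comp_apply] at this
    simp [this]) f
  intro l hl
  simpa [sub_eq_zero] using this l hl

theorem IsCoalgHom.trunc_comp_eqBelow {F G : TensorAlgebra k V →ₗ[k] TensorAlgebra k W}
    (hF : IsCoalgHom F) (hG : IsCoalgHom G) {n : ℕ}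
    (h : EqBelow n (pr k W ∘ₗ F) (pr k W ∘ₗ G)) (f : TensorAlgebra k W →ₗ[k] X) :
    EqBelow (n + 1) (trunc f ∘ₗ F) (trunc f ∘ₗ G) := by
  have := (hF.sub hG).trunc_comp hF hG (n := n) (fun l hl => by
    have := h l hl
    simp only [LinearMap.comp_apply] at this
    simp [this]) f
  intro l hl
  simpa [sub_eq_zero] using this l hl

/-! #### Existence -/

theorem splitSum_comm {L L' M : Type*} [AddCommMonoid M] (l : List L) (l' : List L')
    (G : List L → List L → List L' → List L' → M) :
    splitSum l (fun u v => splitSum l' fun u' v' => G u v u' v') =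
      splitSum l' (fun u' v' => splitSum l fun u v => G u v u' v') := by
  induction l generalizing G with
  | nil => rfl
  | cons x l ih => simp [ih, splitSum_add]

theorem splitSum_counit_right (l : List V) (G : List V → W) :
    (splitSum l fun u v => counit k V (word k v) • G u) = G l := by
  induction l generalizing G with
  | nil => simp
  | cons y l ih =>
    rw [splitSum_cons, ih fun u => G (y :: u), word_cons, counit_ι_mul, zero_smul, zero_add]

theorem splitSum_counit_left (l : List V) (G : List V → W) :
    (splitSum l fun u v => counit k V (word k u) • G v) = G l := by
  cases l <;> simp [splitSum_zero]

/-- Every linear map that vanishes on the empty word is the corestriction of a map of tensor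
coalgebras. -/
theorem exists_isCoalgHom {f : TensorAlgebra k V →ₗ[k] W} (hf : f 1 = 0) :
    ∃ F : TensorAlgebra k V →ₗ[k] TensorAlgebra k W, IsCoalgHom F ∧ pr k W ∘ₗ F = f := by
  let Θ (F : TensorAlgebra k V →ₗ[k] TensorAlgebra k W) :=
    (counit k V).smulRight (1 : TensorAlgebra k W) + conv (ι k ∘ₗ f) F
  -- As `f` kills the empty word, the left factor always contains `x`. So `F` is evaluated only on
  -- words shorter than `x :: l`, and `Θ` is contractive.
  have hcons : ∀ F x l, Θ F (word k (x :: l)) =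
      splitSum l fun u v => ι k (f (word k (x :: u))) * F (word k v) := by
    intro F x l
    simp only [Θ, LinearMap.add_apply, conv_word]
    simp [hf]
  obtain ⟨F, -, hF⟩ := exists_fixedPoint Θ (fun _ => True) trivial (fun _ _ => trivial)
    (fun _ _ => trivial) (by
      intro n F G _ _ h l hl
      match l, hl with
      | [], _ => simp only [Θ, LinearMap.add_apply, conv_word]; simp [hf]
      | x :: l, hl =>
        rw [hcons, hcons]
        refine splitSum_congr fun u v huv => ?_
        rw [h v]
        have : u.length + v.length = l.length := by simp [← huv]
        simp at hl
        omega)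
  have h1 : F 1 = 1 := by
    rw [← hF, ← word_nil]
    simp only [Θ, LinearMap.add_apply, conv_word]
    simp [hf]
  have hc : ∀ t, counit k W (F t) = counit k V t := by
    intro t
    suffices h : counit k W ∘ₗ F = counit k V from LinearMap.congr_fun h t
    refine word_hom_ext fun l => ?_
    match l with
    | [] => simp [h1]
    | x :: l =>
      rw [LinearMap.comp_apply, ← hF, hcons, map_splitSum, word_cons]
      simp [splitSum_zero]
  refine ⟨F, ⟨h1, hc, word_hom_ext fun l => ?_⟩, word_hom_ext fun l => ?_⟩
  · rw [LinearMap.comp_apply, LinearMap.comp_apply, map_deconc_word]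
    induction h : l.length using Nat.strong_induction_on generalizing l with
    | _ n ih =>
    subst h
    match l, ih with
    | [], _ => simp [h1]
    | x :: l, ih =>
      have e0 : ∀ w, F (word k w) - counit k V (word k w) • 1 =
          splitSum w fun u v => ι k (f (word k u)) * F (word k v) := by
        intro w
        conv_lhs => rw [← hF]
        simp [Θ, conv_word]
      have e1 : F (word k (x :: l)) =
          splitSum (x :: l) fun u v => ι k (f (word k u)) * F (word k v) := by
        rw [← e0]; simp
      rw [e1, map_splitSum]
      -- Where `f (word k u)` does not vanish, `u` is nonempty, so the induction hypothesis applies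
      -- to the shorter word `v`.
      have e2 : splitSum (x :: l) (fun u v => deconc k W (ι k (f (word k u)) * F (word k v))) =
          splitSum (x :: l) (fun u v => 1 ⊗ₜ (ι k (f (word k u)) * F (word k v)) +
            splitSum v fun v1 v2 => (ι k (f (word k u)) * F (word k v1)) ⊗ₜ F (word k v2)) := by
        refine splitSum_congr fun u v huv => ?_
        match u, huv with
        | [], _ => simp [hf, splitSum_zero]
        | y :: u, huv =>
          rw [deconc_ι_mul, ih v.length _ v rfl, map_splitSum]
          · simp
          · have := congrArg List.length huv
            simp at this ⊢
            omega
      rw [e2, splitSum_add, splitSum_assoc _ (fun u v1 v2 =>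
        (ι k (f (word k u)) * F (word k v1)) ⊗ₜ[k] F (word k v2))]
      have e3 : splitSum (x :: l) (fun u v => (1 : TensorAlgebra k W) ⊗ₜ[k]
          (ι k (f (word k u)) * F (word k v))) = 1 ⊗ₜ F (word k (x :: l)) := by
        rw [e1, ← TensorProduct.mk_apply, map_splitSum]; rfl
      have e4 : ∀ u v, (splitSum u fun u1 u2 =>
          (ι k (f (word k u1)) * F (word k u2)) ⊗ₜ[k] F (word k v)) =
          (F (word k u) - counit k V (word k u) • 1) ⊗ₜ F (word k v) := by
        intro u v
        rw [e0, ← TensorProduct.mk_apply, ← LinearMap.flip_apply, map_splitSum]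
        rfl
      simp only [e3, e4, splitSum_cons, word_nil, counit_one, one_smul, h1, sub_self,
        TensorProduct.zero_tmul, zero_add]
      congr 1
      refine splitSum_congr fun u v huv => ?_
      simp
  · match l with
    | [] => simp [h1, hf]
    | x :: l =>
      rw [LinearMap.comp_apply, ← hF, hcons, map_splitSum]
      simp only [pr_ι_mul, hc]
      exact splitSum_counit_right l fun u => f (word k (x :: u))

open Classical in
/-- The map of tensor coalgebras with corestriction `f`, where `f 1 = 0`. -/
noncomputable def cohom (f : TensorAlgebra k V →ₗ[k] W) :
    TensorAlgebra k V →ₗ[k] TensorAlgebra k W :=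
  if hf : f 1 = 0 then (exists_isCoalgHom hf).choose else 0

theorem isCoalgHom_cohom {f : TensorAlgebra k V →ₗ[k] W} (hf : f 1 = 0) : IsCoalgHom (cohom f) := by
  rw [cohom, dif_pos hf]; exact (exists_isCoalgHom hf).choose_spec.1

theorem pr_cohom {f : TensorAlgebra k V →ₗ[k] W} (hf : f 1 = 0) : pr k W ∘ₗ cohom f = f := by
  rw [cohom, dif_pos hf]; exact (exists_isCoalgHom hf).choose_spec.2

/-- The coderivation along `F'` and `F` with corestriction `δ`. -/
noncomputable def coder (F' F : TensorAlgebra k V →ₗ[k] TensorAlgebra k W)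
    (δ : TensorAlgebra k V →ₗ[k] W) : TensorAlgebra k V →ₗ[k] TensorAlgebra k W :=
  conv F' (conv (ι k ∘ₗ δ) F)

theorem coder_word (F' F : TensorAlgebra k V →ₗ[k] TensorAlgebra k W)
    (δ : TensorAlgebra k V →ₗ[k] W) (l : List V) : coder F' F δ (word k l) =
      splitSum l fun u v => splitSum v fun v1 v2 =>
        F' (word k u) * (ι k (δ (word k v1)) * F (word k v2)) := by
  rw [coder, conv_word]
  refine splitSum_congr fun u v _ => ?_
  rw [conv_word, ← LinearMap.mulLeft_apply (R := k), map_splitSum]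
  rfl

/-- A cut of `s x t` falls either within `s`, before `x`, or within `t`, after `x`. -/
theorem deconc_mul_ι_mul (s : TensorAlgebra k V) (x : V) (t : TensorAlgebra k V) :
    deconc k V (s * (ι k x * t)) =
      (LinearMap.mulRight k (ι k x * t)).lTensor _ (deconc k V s) +
        (LinearMap.mulLeft k (s * ι k x)).rTensor _ (deconc k V t) := by
  have hs : s ∈ Submodule.span k (Set.range (word k : List V → TensorAlgebra k V)) := by
    rw [span_words]; trivial
  induction hs using Submodule.span_induction with
  | mem s hs =>
    obtain ⟨l, rfl⟩ := hs
    induction l with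
    | nil => simp
    | cons y l ih =>
      rw [word_cons, mul_assoc, deconc_ι_mul, ih, deconc_ι_mul, map_add, map_add,
        LinearMap.lTensor_tmul, LinearMap.mulRight_apply, mul_assoc, add_assoc]
      congr 2
      · rw [← LinearMap.comp_apply, ← LinearMap.comp_apply (LinearMap.lTensor _ _),
          LinearMap.rTensor_comp_lTensor, LinearMap.lTensor_comp_rTensor]
      · rw [← LinearMap.comp_apply, ← LinearMap.rTensor_comp, ← LinearMap.mulLeft_mul, mul_assoc]
  | zero => simp
  | add a b _ _ ha hb =>
    rw [add_mul, map_add, ha, hb, add_mul, map_add, map_add,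
      show LinearMap.mulLeft k (a * ι k x + b * ι k x) = LinearMap.mulLeft k (a * ι k x) +
        LinearMap.mulLeft k (b * ι k x) by ext; simp [add_mul, mul_assoc], LinearMap.rTensor_add,
      LinearMap.add_apply]
    abel
  | smul c a _ ha =>
    rw [smul_mul_assoc, map_smul, ha, smul_mul_assoc, map_smul, map_smul,
      show LinearMap.mulLeft k (c • (a * ι k x)) = c • LinearMap.mulLeft k (a * ι k x) by
        ext; simp [mul_assoc], LinearMap.rTensor_smul, LinearMap.smul_apply, smul_add]

/-- By `deconc_mul_ι_mul`, the cuts to the left of the letter produced by `δ` give `F' ⊗ D`, and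
those to its right give `D ⊗ F`. What remains is to reorder sums over factorisations into four
words. -/
theorem isCoder_coder {F' F : TensorAlgebra k V →ₗ[k] TensorAlgebra k W} (hF' : IsCoalgHom F')
    (hF : IsCoalgHom F) {δ : TensorAlgebra k V →ₗ[k] W} (hδ : δ 1 = 0) :
    IsCoder F' F (coder F' F δ) where
  map_one := by
    rw [← word_nil, coder_word]; simp [hδ]
  counit_comp t := by
    suffices h : counit k W ∘ₗ coder F' F δ = 0 from LinearMap.congr_fun h t
    refine word_hom_ext fun l => ?_
    rw [LinearMap.comp_apply, coder_word]
    simp [map_splitSum, counit, algebraMapInv, splitSum_zero]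
  deconc_comp := by
    refine word_hom_ext fun l => ?_
    rw [LinearMap.comp_apply, LinearMap.comp_apply, LinearMap.add_apply, map_deconc_word,
      map_deconc_word, coder_word]
    simp only [map_splitSum, deconc_mul_ι_mul, splitSum_add]
    congr 1
    · have hd : ∀ u, deconc k W (F' (word k u)) =
          splitSum u fun u1 u2 => F' (word k u1) ⊗ₜ F' (word k u2) := fun u => by
        rw [← LinearMap.comp_apply, hF'.deconc_comp, LinearMap.comp_apply, map_deconc_word]
      have hm : ∀ u v, F' (word k u) ⊗ₜ[k] coder F' F δ (word k v) =
          splitSum v fun v1 v2 => splitSum v2 fun v3 v4 =>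
            F' (word k u) ⊗ₜ (F' (word k v1) * (ι k (δ (word k v3)) * F (word k v4))) := by
        intro u v
        rw [coder_word, ← TensorProduct.mk_apply]
        simp only [map_splitSum]
        rfl
      simp only [hd, hm, map_splitSum]
      rw [splitSum_assoc _ fun u v1 v2 => splitSum v2 fun v3 v4 =>
        F' (word k u) ⊗ₜ[k] (F' (word k v1) * (ι k (δ (word k v3)) * F (word k v4)))]
      refine splitSum_congr fun u v _ => ?_
      rw [splitSum_comm]
      rfl
    · have hd : ∀ u, deconc k W (F (word k u)) =
          splitSum u fun u1 u2 => F (word k u1) ⊗ₜ F (word k u2) := fun u => by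
        rw [← LinearMap.comp_apply, hF.deconc_comp, LinearMap.comp_apply, map_deconc_word]
      have hm : ∀ u v, coder F' F δ (word k u) ⊗ₜ[k] F (word k v) =
          splitSum u fun u1 u2 => splitSum u2 fun u3 u4 =>
            (F' (word k u1) * (ι k (δ (word k u3)) * F (word k u4))) ⊗ₜ F (word k v) := by
        intro u v
        rw [coder_word, ← TensorProduct.mk_apply, ← LinearMap.flip_apply]
        simp only [map_splitSum]
        rfl
      simp only [hd, hm, map_splitSum]
      rw [← splitSum_assoc _ fun u1 u2 v => splitSum u2 fun u3 u4 =>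
        (F' (word k u1) * (ι k (δ (word k u3)) * F (word k u4))) ⊗ₜ[k] F (word k v)]
      refine splitSum_congr fun u v _ => ?_
      rw [← splitSum_assoc _ fun u3 u4 w =>
        (F' (word k u) * (ι k (δ (word k u3)) * F (word k u4))) ⊗ₜ[k] F (word k w)]
      refine splitSum_congr fun v1 v2 _ => splitSum_congr fun a b _ => ?_
      simp

/-- The projection puts counits on the two outer factors, so only the factorisation with both of
them empty survives. -/
theorem pr_coder {F' F : TensorAlgebra k V →ₗ[k] TensorAlgebra k W} (hF' : IsCoalgHom F')
    (hF : IsCoalgHom F) (δ : TensorAlgebra k V →ₗ[k] W) :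
    pr k W ∘ₗ coder F' F δ = δ := by
  refine word_hom_ext fun l => ?_
  have e : ∀ s t : TensorAlgebra k W, ∀ a, pr k W (s * (ι k a * t)) =
      counit k W s • counit k W t • a := by
    intro s t a
    have hs : s ∈ Submodule.span k (Set.range (word k : List W → TensorAlgebra k W)) := by
      rw [span_words]; trivial
    induction hs using Submodule.span_induction with
    | mem s hs =>
      obtain ⟨l, rfl⟩ := hs
      cases l with
      | nil => simp
      | cons x l =>
        rw [word_cons, mul_assoc, pr_ι_mul]
        simp [counit, algebraMapInv]
    | zero => simp
    | add a b _ _ ha hb => simp [add_mul, ha, hb, add_smul]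
    | smul c a _ ha => simp [ha, smul_smul, mul_assoc]
  rw [LinearMap.comp_apply, coder_word]
  simp only [map_splitSum, e, hF'.counit_comp, hF.counit_comp]
  rw [← splitSum_counit_left (k := k) l fun v => δ (word k v)]
  refine splitSum_congr fun u v _ => ?_
  rw [← splitSum_counit_right (k := k) v fun v => counit k V (word k u) • δ (word k v)]
  exact splitSum_congr fun _ _ _ => smul_comm _ _ _

end Coderivations


/-! ### Strict maps, inverses -/

section Strict

open TensorAlgebra TensorProduct

variable {k : Type u} [Field k]
variable {U V W X : Type*} [AddCommGroup U] [Module k U] [AddCommGroup V] [Module k V]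
  [AddCommGroup W] [Module k W] [AddCommGroup X] [Module k X]

/-- The map of tensor coalgebras induced by a linear map. -/
noncomputable def tmap (g : V →ₗ[k] W) : TensorAlgebra k V →ₗ[k] TensorAlgebra k W :=
  (TensorAlgebra.lift k (ι k ∘ₗ g)).toLinearMap

@[simp] theorem tmap_word (g : V →ₗ[k] W) (l : List V) : tmap g (word k l) = word k (l.map g) := by
  induction l with
  | nil => simp [tmap]
  | cons x l ih =>
    rw [word_cons, List.map_cons, word_cons, ← ih]
    simp [tmap]

@[simp] theorem tmap_one (g : V →ₗ[k] W) : tmap g 1 = 1 := by simp [tmap]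

@[simp] theorem tmap_ι (g : V →ₗ[k] W) (x : V) : tmap g (ι k x) = ι k (g x) := by simp [tmap]

theorem isCoalgHom_tmap (g : V →ₗ[k] W) : IsCoalgHom (tmap g) where
  map_one := by simp
  counit_comp t := by
    suffices h : counit k W ∘ₗ tmap g = counit k V from LinearMap.congr_fun h t
    refine word_hom_ext fun l => ?_
    cases l <;> simp [-tmap_word, tmap, counit, algebraMapInv]
  deconc_comp := by
    refine word_hom_ext fun l => ?_
    rw [LinearMap.comp_apply, LinearMap.comp_apply, map_deconc_word, tmap_word, deconc_word,
      splitSum_map]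
    simp

theorem pr_tmap (g : V →ₗ[k] W) : pr k W ∘ₗ tmap g = g ∘ₗ pr k V := by
  refine word_hom_ext fun l => ?_
  rw [LinearMap.comp_apply, LinearMap.comp_apply, tmap_word]
  by_cases h : l.length = 1
  · obtain ⟨x, rfl⟩ := List.length_eq_one_iff.1 h
    simp
  · rw [pr_word_of_length h, pr_word_of_length (by simpa using h), map_zero]

theorem tmap_comp (g : V →ₗ[k] W) (h : U →ₗ[k] V) : tmap (g ∘ₗ h) = tmap g ∘ₗ tmap h := by
  refine word_hom_ext fun l => ?_
  simp

theorem tmap_id : tmap (LinearMap.id : V →ₗ[k] V) = LinearMap.id := by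
  refine word_hom_ext fun l => ?_
  simp

theorem IsCoalgHom.preservesFil {F : TensorAlgebra k V →ₗ[k] TensorAlgebra k W}
    (hF : IsCoalgHom F) : PreservesFil F := hF.word_mem

theorem IsCoder.preservesFil {F' F D : TensorAlgebra k V →ₗ[k] TensorAlgebra k W}
    (hD : IsCoder F' F D) (hF' : IsCoalgHom F') (hF : IsCoalgHom F) : PreservesFil D :=
  hD.word_mem hF' hF

theorem IsCoder.apply_ι {F' F D : TensorAlgebra k V →ₗ[k] TensorAlgebra k W}
    (hD : IsCoder F' F D) (hF' : IsCoalgHom F') (hF : IsCoalgHom F) (x : V) :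
    D (ι k x) = ι k (pr k W (D (ι k x))) := by
  have := hD.leading hF' hF (n := 1) (fun l hl => by
    obtain rfl : l = [] := List.length_eq_zero_iff.1 (by omega)
    simp [hD.map_one]) [x] (by simp)
  simpa using this

theorem IsCoalgHom.apply_ι {F : TensorAlgebra k V →ₗ[k] TensorAlgebra k W}
    (hF : IsCoalgHom F) (x : V) : F (ι k x) = ι k (pr k W (F (ι k x))) := by
  -- The comparison map `tmap 0` kills every letter, so the statement for coderivations applies to
  -- the difference.
  have h := (hF.sub (isCoalgHom_tmap (0 : V →ₗ[k] W))).apply_ι hF (isCoalgHom_tmap _) x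
  simpa using h

/-- A linear map, composed with a coderivation, in terms of the linear part and the truncation. -/
theorem comp_eq_add_trunc_comp (f : TensorAlgebra k W →ₗ[k] X)
    (L : TensorAlgebra k V →ₗ[k] TensorAlgebra k W) :
    f ∘ₗ L = (f ∘ₗ ι k) ∘ₗ (pr k W ∘ₗ L) + trunc f ∘ₗ L := by
  conv_lhs => rw [← trunc_add f]
  rfl

/-- The corestriction `γ` of the inverse has to solve `γ = g (pr - trunc (pr F) ∘ cohom γ)`. The
truncation makes the right-hand side contractive. -/
theorem exists_right_inverse {F : TensorAlgebra k V →ₗ[k] TensorAlgebra k W} (hF : IsCoalgHom F)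
    {g : W →ₗ[k] V} (hg : ∀ y, pr k W (F (ι k (g y))) = y) :
    ∃ G : TensorAlgebra k W →ₗ[k] TensorAlgebra k V, IsCoalgHom G ∧ F ∘ₗ G = LinearMap.id ∧
      ∀ y, pr k V (G (ι k y)) = g y := by
  have htr : trunc (pr k W ∘ₗ F) 1 = 0 := by simp [hF.map_one]
  obtain ⟨γ, hγ, hfix⟩ := exists_fixedPoint
    (fun γ : TensorAlgebra k W →ₗ[k] V => g ∘ₗ (pr k W - trunc (pr k W ∘ₗ F) ∘ₗ cohom γ))
    (fun γ => γ 1 = 0) rfl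
    (fun f h => by
      obtain ⟨g, hg, hfg⟩ := h 1
      have := hfg [] (by simp)
      simpa [hg] using this)
    (fun γ hγ => by simp [(isCoalgHom_cohom hγ).map_one, hF.map_one])
    (fun n γ γ' hγ hγ' h => by
      refine EqBelow.comp_left (EqBelow.sub EqBelow.rfl' ?_) g
      refine (isCoalgHom_cohom hγ).trunc_comp_eqBelow (isCoalgHom_cohom hγ') ?_ _
      rwa [pr_cohom hγ, pr_cohom hγ'])
  have hG := isCoalgHom_cohom hγ
  refine ⟨cohom γ, hG, (hF.comp hG).ext IsCoalgHom.id ?_, fun y => ?_⟩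
  · have e := comp_eq_add_trunc_comp (pr k W ∘ₗ F) (cohom γ)
    rw [pr_cohom hγ] at e
    have e' : ((pr k W ∘ₗ F) ∘ₗ ι k) ∘ₗ γ = pr k W - trunc (pr k W ∘ₗ F) ∘ₗ cohom γ := by
      conv_lhs => rw [← hfix]
      refine LinearMap.ext fun t => ?_
      simp only [LinearMap.comp_apply, hg]
    rw [← LinearMap.comp_assoc, e, e', sub_add_cancel, LinearMap.comp_id]
  · have h1 := hG.apply_ι y
    have h2 : pr k V (cohom γ (ι k y)) = γ (ι k y) := LinearMap.congr_fun (pr_cohom hγ) _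
    rw [h2] at h1 ⊢
    conv_lhs => rw [← hfix]
    simp [h1]

/-- The right inverse `G` of `F` has a right inverse `F'` of its own, and `F = F (G F') = F'`. -/
theorem exists_inverse {F : TensorAlgebra k V →ₗ[k] TensorAlgebra k W} (hF : IsCoalgHom F)
    {g : W →ₗ[k] V} (hg : ∀ y, pr k W (F (ι k (g y))) = y) (hg' : ∀ x, g (pr k W (F (ι k x))) = x) :
    ∃ G : TensorAlgebra k W →ₗ[k] TensorAlgebra k V, IsCoalgHom G ∧ F ∘ₗ G = LinearMap.id ∧
      G ∘ₗ F = LinearMap.id ∧ ∀ y, pr k V (G (ι k y)) = g y := by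
  obtain ⟨G, hG, hFG, hGg⟩ := exists_right_inverse hF hg
  obtain ⟨F', -, hGF', -⟩ := exists_right_inverse hG (g := pr k W ∘ₗ F ∘ₗ ι k)
    (fun x => by rw [hGg]; exact hg' x)
  have : F = F' := by
    rw [← LinearMap.id_comp F', ← hFG, LinearMap.comp_assoc, hGF', LinearMap.comp_id]
  subst this
  exact ⟨G, hG, hFG, hGF', hGg⟩

/-! ### Coderivations that extend linear endomorphisms -/

/-- The coderivation that extends a linear endomorphism. -/
noncomputable def lder (e : V →ₗ[k] V) : TensorAlgebra k V →ₗ[k] TensorAlgebra k V :=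
  coder LinearMap.id LinearMap.id (e ∘ₗ pr k V)

theorem isCoder_lder (e : V →ₗ[k] V) : IsCoder LinearMap.id LinearMap.id (lder e) :=
  isCoder_coder IsCoalgHom.id IsCoalgHom.id (by simp)

theorem pr_lder (e : V →ₗ[k] V) : pr k V ∘ₗ lder e = e ∘ₗ pr k V :=
  pr_coder IsCoalgHom.id IsCoalgHom.id _

theorem lder_word_cons (e : V →ₗ[k] V) (x : V) (l : List V) : lder e (word k (x :: l)) =
    ι k x * lder e (word k l) + ι k (e x) * word k l := by
  have h : ∀ t, pr k V (lder e t) = e (pr k V t) := LinearMap.congr_fun (pr_lder e)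
  rw [(isCoder_lder e).eq_conv, conv_word, conv_word, splitSum_cons, splitSum_cons]
  simp only [LinearMap.comp_apply, LinearMap.id_apply, word_nil, pr_one, map_zero, zero_mul,
    zero_add, word_cons, pr_ι_mul, h, map_smul, smul_mul_assoc]
  rw [splitSum_counit_left l fun v => ι k x * lder e (word k v),
    splitSum_counit_left l fun v => ι k (e x) * word k v]

/-- The operator that multiplies words by their length. -/
theorem lder_id_word (l : List V) :
    lder (LinearMap.id : V →ₗ[k] V) (word k l) = (l.length : k) • word k l := by
  induction l with
  | nil => simp [(isCoder_lder _).map_one]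
  | cons x l ih =>
    rw [lder_word_cons, ih, LinearMap.id_apply, ← word_cons, mul_smul_comm, ← word_cons,
      List.length_cons, Nat.cast_succ, add_smul, one_smul]

/-- The commutator of even coderivations with a coderivation. -/
theorem IsCoder.comm {δ : TensorAlgebra k V →ₗ[k] TensorAlgebra k V}
    {δ' : TensorAlgebra k W →ₗ[k] TensorAlgebra k W}
    {F' F D : TensorAlgebra k V →ₗ[k] TensorAlgebra k W}
    (hδ' : IsCoder LinearMap.id LinearMap.id δ') (hδ : IsCoder LinearMap.id LinearMap.id δ)
    (hD : IsCoder F' F D) (h' : δ' ∘ₗ F' = F' ∘ₗ δ) (h : δ' ∘ₗ F = F ∘ₗ δ) :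
    IsCoder F' F (δ' ∘ₗ D - D ∘ₗ δ) := by
  have := IsCoder.comp_add_comp (-1 : k) hδ' hD hD hδ (LinearMap.id_comp F') (LinearMap.comp_id F')
    (LinearMap.id_comp F) (LinearMap.comp_id F) (by
      rw [h', h, LinearMap.id_comp, LinearMap.comp_id]
      module)
  have e : δ' ∘ₗ D + (-1 : k) • D ∘ₗ δ = δ' ∘ₗ D - D ∘ₗ δ := by module
  rwa [e] at this

end Strict

/-! ### Degrees -/

section Degrees

open TensorAlgebra TensorProduct

variable {k : Type u} [Field k]

namespace GradedSpace

/-- The linear endomorphism that multiplies the elements of `(sV)ⁱ` by `i`. -/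
noncomputable def degOp (V : GradedSpace.{u, v} k) : V →ₗ[k] V :=
  (DirectSum.toModule k ℤ V fun i => ((i - 1 : ℤ) : k) • (V.deg i).subtype) ∘ₗ
    (DirectSum.decomposeLinearEquiv V.deg).toLinearMap

theorem degOp_of_mem (V : GradedSpace.{u, v} k) {i : ℤ} {x : V} (hx : x ∈ V.sdeg i) :
    V.degOp x = (i : k) • x := by
  have hx : x ∈ V.deg (i + 1) := hx
  lift x to V.deg (i + 1) using hx
  simp only [degOp, LinearMap.comp_apply, LinearEquiv.coe_coe,
    DirectSum.decomposeLinearEquiv_apply_coe, DirectSum.toModule_lof, LinearMap.smul_apply,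
    Submodule.subtype_apply, add_sub_cancel_right]

theorem hom_ext_sdeg {V : GradedSpace.{u, v} k} {W : Type w} [AddCommGroup W] [Module k W]
    {g h : V →ₗ[k] W} (H : ∀ i, ∀ x ∈ V.sdeg i, g x = h x) : g = h :=
  hom_ext fun i x hx => H (i - 1) x (by simpa [sdeg] using hx)

theorem proj_degOp (V : GradedSpace.{u, v} k) (i : ℤ) (x : V) :
    V.proj (i + 1) (V.degOp x) = (i : k) • V.proj (i + 1) x := by
  suffices h : V.proj (i + 1) ∘ₗ V.degOp = (i : k) • V.proj (i + 1) from LinearMap.congr_fun h x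
  refine hom_ext_sdeg fun j x hx => ?_
  rw [LinearMap.comp_apply, LinearMap.smul_apply, V.degOp_of_mem hx, map_smul]
  by_cases hij : j + 1 = i + 1
  · obtain rfl : j = i := by omega
    rfl
  · rw [V.proj_ne hx hij, smul_zero, smul_zero]

/-- In characteristic `0` distinct integers stay distinct in `k`, so the graded pieces are exactly
the eigenspaces of `degOp`. -/
theorem mem_sdeg_of_degOp [CharZero k] (V : GradedSpace.{u, v} k) {i : ℤ} {x : V}
    (h : V.degOp x = (i : k) • x) : x ∈ V.sdeg i := by
  have h0 : ∀ j, j ≠ i + 1 → V.proj j x = 0 := by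
    intro j hj
    have h1 := V.proj_degOp (j - 1) x
    rw [h, map_smul, sub_add_cancel, ← sub_eq_zero, ← sub_smul, smul_eq_zero] at h1
    refine h1.resolve_left fun h2 => hj ?_
    have h3 : (i : k) = ((j - 1 : ℤ) : k) := sub_eq_zero.1 h2
    have := Int.cast_injective h3
    omega
  classical
  have hp : ∀ j, ((DirectSum.decompose V.deg x) j : V) = V.proj j x := fun _ => rfl
  have h2 : x = V.proj (i + 1) x := by
    conv_lhs => rw [← DirectSum.sum_support_decompose V.deg x]
    by_cases hi : i + 1 ∈ (DirectSum.decompose V.deg x).support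
    · rw [Finset.sum_eq_single_of_mem _ hi fun j _ hj => (hp j).trans (h0 j hj), hp]
    · rw [Finset.sum_eq_zero fun j hj => (hp j).trans (h0 j (by rintro rfl; exact hi hj))]
      rw [DFinsupp.notMem_support_iff] at hi
      exact (congrArg Subtype.val hi).symm
  rw [h2]
  exact V.proj_mem _ _

theorem koszul_comp_koszul (V : GradedSpace.{u, v} k) : V.koszul ∘ₗ V.koszul = LinearMap.id := by
  refine hom_ext fun i x hx => ?_
  simp only [LinearMap.comp_apply, V.koszul_of_mem_deg hx, map_zsmul, smul_smul,
    LinearMap.id_apply]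
  rcases Int.units_eq_one_or (i - 1).negOnePow with h | h <;> simp [h]

end GradedSpace

/-- Words of homogeneous elements of the suspension, of a given total degree. -/
inductive IsHomog (V : GradedSpace.{u, v} k) : List V → ℤ → Prop
  | nil : IsHomog V [] 0
  | cons {i e : ℤ} {x : V} {l : List V} : x ∈ V.sdeg i → IsHomog V l e → IsHomog V (x :: l) (i + e)

theorem isHomog_hom_ext {V : GradedSpace.{u, v} k} {X : Type*} [AddCommGroup X] [Module k X]
    {f g : TensorAlgebra k V →ₗ[k] X}
    (h : ∀ l e, IsHomog V l e → f (word k l) = g (word k l)) : f = g := by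
  have hS : Submodule.span k {t | ∃ l e, IsHomog V l e ∧ word k l = t} = ⊤ := by
    set S := Submodule.span k {t | ∃ l e, IsHomog V l e ∧ word k l = t}
    rw [eq_top_iff, ← span_words, Submodule.span_le]
    rintro _ ⟨l, rfl⟩
    induction l with
    | nil => exact Submodule.subset_span ⟨[], 0, .nil, rfl⟩
    | cons x l ih =>
      rw [word_cons]
      generalize word k l = t at ih
      replace ih : t ∈ S := ih
      show ι k x * t ∈ S
      induction ih using Submodule.span_induction with
      | mem t ht =>
        obtain ⟨l, e, hl, rfl⟩ := ht
        induction x using DirectSum.Decomposition.inductionOn V.deg with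
        | zero => simp
        | @homogeneous i x =>
          exact Submodule.subset_span ⟨(x : V) :: l, _, .cons (i := i - 1)
            (by simp [GradedSpace.sdeg]) hl, by simp⟩
        | add a b ha hb => rw [map_add, add_mul]; exact S.add_mem ha hb
      | zero => simp
      | add a b _ _ ha hb => rw [mul_add]; exact S.add_mem ha hb
      | smul c a _ ha => rw [mul_smul_comm]; exact S.smul_mem c ha
  refine LinearMap.ext_on hS ?_
  rintro _ ⟨l, e, hl, rfl⟩
  exact h l e hl

namespace GradedSpace

/-- The Koszul sign on the tensor coalgebra. -/
noncomputable def tkoszul (V : GradedSpace.{u, v} k) : TensorAlgebra k V →ₗ[k] TensorAlgebra k V :=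
  tmap V.koszul

/-- The coderivation that multiplies words by their degree. -/
noncomputable def tdeg (V : GradedSpace.{u, v} k) : TensorAlgebra k V →ₗ[k] TensorAlgebra k V :=
  lder V.degOp

theorem tkoszul_word (V : GradedSpace.{u, v} k) (l : List V) :
    V.tkoszul (word k l) = word k (l.map V.koszul) := tmap_word _ _

theorem isCoalgHom_tkoszul (V : GradedSpace.{u, v} k) : IsCoalgHom V.tkoszul := isCoalgHom_tmap _

theorem isCoder_tdeg (V : GradedSpace.{u, v} k) : IsCoder LinearMap.id LinearMap.id V.tdeg :=
  isCoder_lder _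

theorem tkoszul_comp_tkoszul (V : GradedSpace.{u, v} k) :
    V.tkoszul ∘ₗ V.tkoszul = LinearMap.id := by
  rw [tkoszul, ← tmap_comp, koszul_comp_koszul, tmap_id]

theorem tdeg_word (V : GradedSpace.{u, v} k) {l : List V} {e : ℤ} (h : IsHomog V l e) :
    V.tdeg (word k l) = (e : k) • word k l := by
  induction h with
  | nil => simp [tdeg, (isCoder_lder _).map_one]
  | @cons i e x l hx hl ih =>
    rw [tdeg, lder_word_cons, ← tdeg, ih, V.degOp_of_mem hx, mul_smul_comm, map_smul,
      smul_mul_assoc, ← word_cons, ← add_smul]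
    push_cast
    rw [add_comm]

theorem tkoszul_isHomog (V : GradedSpace.{u, v} k) {l : List V} {e : ℤ} (h : IsHomog V l e) :
    V.tkoszul (word k l) = ((e.negOnePow : ℤˣ) : ℤ) • word k l := by
  induction h with
  | nil => simp [tkoszul]
  | @cons i e x l hx hl ih =>
    rw [tkoszul_word] at ih ⊢
    rw [List.map_cons, word_cons, ih, V.koszul_of_mem hx, map_zsmul, smul_mul_smul_comm,
      Int.negOnePow_add, ← word_cons]
    simp

end GradedSpace

/-! ### Maps of a given degree and their commutation with degree and sign -/

/-- Linear maps on the tensor coalgebra of degree `m`. -/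
def HasDeg {V : GradedSpace.{u, v} k} {W : GradedSpace.{u, w} k} (m : ℤ)
    (f : TensorAlgebra k V →ₗ[k] W) : Prop :=
  ∀ l e, IsHomog V l e → f (word k l) ∈ W.sdeg (e + m)

variable {V : GradedSpace.{u, v} k} {W : GradedSpace.{u, w} k} {X : GradedSpace.{u, x} k}

theorem hasDeg_zero (m : ℤ) : HasDeg m (0 : TensorAlgebra k V →ₗ[k] W) :=
  fun _ _ _ => Submodule.zero_mem _

theorem hasDeg_of_eqBelow {m : ℤ} {f : TensorAlgebra k V →ₗ[k] W}
    (h : ∀ n, ∃ g, HasDeg m g ∧ EqBelow n f g) : HasDeg m f := by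
  intro l e hl
  obtain ⟨g, hg, hfg⟩ := h (l.length + 1)
  rw [hfg l (Nat.lt_succ_self _)]
  exact hg l e hl

theorem HasDeg.add {m : ℤ} {f g : TensorAlgebra k V →ₗ[k] W} (hf : HasDeg m f) (hg : HasDeg m g) :
    HasDeg m (f + g) := fun l e h => Submodule.add_mem _ (hf l e h) (hg l e h)

theorem HasDeg.sub {m : ℤ} {f g : TensorAlgebra k V →ₗ[k] W} (hf : HasDeg m f) (hg : HasDeg m g) :
    HasDeg m (f - g) := fun l e h => Submodule.sub_mem _ (hf l e h) (hg l e h)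

theorem HasDeg.degOp_comp {m : ℤ} {f : TensorAlgebra k V →ₗ[k] W} (hf : HasDeg m f) :
    W.degOp ∘ₗ f = f ∘ₗ V.tdeg + (m : k) • f := by
  refine isHomog_hom_ext fun l e hl => ?_
  rw [LinearMap.comp_apply, W.degOp_of_mem (hf l e hl), LinearMap.add_apply, LinearMap.comp_apply,
    V.tdeg_word hl, map_smul, LinearMap.smul_apply, ← add_smul]
  push_cast
  rfl

/-- Together with `HasDeg.degOp_comp` this turns the degree of a map into a commutation relation.
Degrees of composites can then be computed without decomposing elements. -/
theorem hasDeg_of_degOp_comp [CharZero k] {m : ℤ} {f : TensorAlgebra k V →ₗ[k] W}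
    (h : W.degOp ∘ₗ f = f ∘ₗ V.tdeg + (m : k) • f) : HasDeg m f := by
  intro l e hl
  refine W.mem_sdeg_of_degOp ?_
  have := LinearMap.congr_fun h (word k l)
  rw [LinearMap.comp_apply, LinearMap.add_apply, LinearMap.comp_apply, V.tdeg_word hl, map_smul,
    LinearMap.smul_apply, ← add_smul] at this
  rw [this]
  push_cast
  rfl

theorem HasDeg.koszul_comp {m : ℤ} {f : TensorAlgebra k V →ₗ[k] W} (hf : HasDeg m f) :
    W.koszul ∘ₗ f = ((m.negOnePow : ℤˣ) : ℤ) • f ∘ₗ V.tkoszul := by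
  refine isHomog_hom_ext fun l e hl => ?_
  rw [LinearMap.comp_apply, W.koszul_of_mem (hf l e hl), LinearMap.smul_apply,
    LinearMap.comp_apply, V.tkoszul_isHomog hl, map_zsmul, smul_smul, Int.negOnePow_add, mul_comm]
  simp

theorem HasDeg.koszul_comp_even {f : TensorAlgebra k V →ₗ[k] W} (hf : HasDeg 0 f) :
    W.koszul ∘ₗ f = f ∘ₗ V.tkoszul := by simpa using hf.koszul_comp

theorem HasDeg.koszul_comp_odd {m : ℤ} (hm : Odd m) {f : TensorAlgebra k V →ₗ[k] W}
    (hf : HasDeg m f) : W.koszul ∘ₗ f = - f ∘ₗ V.tkoszul := by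
  simpa [Int.negOnePow_odd m hm] using hf.koszul_comp

/-- Linear maps of graded spaces of degree `m`. -/
def LinDeg (m : ℤ) (g : V →ₗ[k] W) : Prop := ∀ i, ∀ x ∈ V.sdeg i, g x ∈ W.sdeg (i + m)

theorem LinDeg.hasDeg {m : ℤ} {g : V →ₗ[k] W} (hg : LinDeg m g) : HasDeg m (g ∘ₗ pr k V) := by
  intro l e hl
  rw [LinearMap.comp_apply]
  by_cases h : l.length = 1
  · obtain ⟨x, rfl⟩ := List.length_eq_one_iff.1 h
    obtain _ | ⟨hx, _ | _⟩ := hl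
    simpa using hg _ x hx
  · rw [pr_word_of_length h, map_zero]
    exact Submodule.zero_mem _

theorem LinDeg.comp_hasDeg {m n : ℤ} {g : W →ₗ[k] X} (hg : LinDeg m g)
    {f : TensorAlgebra k V →ₗ[k] W} (hf : HasDeg n f) : HasDeg (n + m) (g ∘ₗ f) := by
  intro l e hl
  rw [← add_assoc]
  exact hg _ _ (hf l e hl)

theorem HasDeg.linDeg {m : ℤ} {f : TensorAlgebra k V →ₗ[k] W} (hf : HasDeg m f) :
    LinDeg m (f ∘ₗ ι k) := by
  intro i x hx
  have := hf [x] _ (.cons hx .nil)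
  simpa using this

theorem HasDeg.trunc {m : ℤ} {f : TensorAlgebra k V →ₗ[k] W} (hf : HasDeg m f) :
    HasDeg m (trunc f) :=
  hf.sub (by rw [← LinearMap.comp_assoc]; exact hf.linDeg.hasDeg)

/-- Both sides are coderivations along `F`, so it suffices to compare corestrictions, where the
claim is that the corestriction has degree `0`. -/
theorem IsCoalgHom.tdeg_comp {F : TensorAlgebra k V →ₗ[k] TensorAlgebra k W} (hF : IsCoalgHom F)
    (hd : HasDeg 0 (pr k W ∘ₗ F)) : W.tdeg ∘ₗ F = F ∘ₗ V.tdeg := by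
  refine ((W.isCoder_tdeg).comp_hom hF).ext (V.isCoder_tdeg.hom_comp hF) hF hF ?_
  rw [← LinearMap.comp_assoc, ← LinearMap.comp_assoc, GradedSpace.tdeg, pr_lder,
    LinearMap.comp_assoc, hd.degOp_comp]
  simp

theorem IsCoalgHom.tkoszul_comp {F : TensorAlgebra k V →ₗ[k] TensorAlgebra k W} (hF : IsCoalgHom F)
    (hd : HasDeg 0 (pr k W ∘ₗ F)) : W.tkoszul ∘ₗ F = F ∘ₗ V.tkoszul := by
  refine (W.isCoalgHom_tkoszul.comp hF).ext (hF.comp V.isCoalgHom_tkoszul) ?_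
  rw [← LinearMap.comp_assoc, ← LinearMap.comp_assoc, GradedSpace.tkoszul, pr_tmap,
    LinearMap.comp_assoc, hd.koszul_comp_even]

theorem IsCoder.tdeg_comp {F' F D : TensorAlgebra k V →ₗ[k] TensorAlgebra k W} (hD : IsCoder F' F D)
    (hF' : IsCoalgHom F') (hF : IsCoalgHom F) (hd' : HasDeg 0 (pr k W ∘ₗ F'))
    (hd : HasDeg 0 (pr k W ∘ₗ F)) {m : ℤ} (hm : HasDeg m (pr k W ∘ₗ D)) :
    W.tdeg ∘ₗ D = D ∘ₗ V.tdeg + (m : k) • D := by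
  have h := IsCoder.comm W.isCoder_tdeg V.isCoder_tdeg hD (hF'.tdeg_comp hd') (hF.tdeg_comp hd)
  have h2 : W.tdeg ∘ₗ D - D ∘ₗ V.tdeg = (m : k) • D := by
    have h3 := (IsCoder.zero F' F).add_smul (m : k) hD
    rw [zero_add] at h3
    refine h.ext h3 hF' hF ?_
    rw [LinearMap.comp_sub, ← LinearMap.comp_assoc, ← LinearMap.comp_assoc, GradedSpace.tdeg,
      pr_lder, LinearMap.comp_assoc, hm.degOp_comp, LinearMap.comp_smul, LinearMap.comp_assoc,
      GradedSpace.tdeg, add_sub_cancel_left]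
  rw [← h2]; abel

theorem IsCoder.tkoszul_comp_even {F' F D : TensorAlgebra k V →ₗ[k] TensorAlgebra k W}
    (hD : IsCoder F' F D) (hF' : IsCoalgHom F') (hF : IsCoalgHom F)
    (hd' : HasDeg 0 (pr k W ∘ₗ F')) (hd : HasDeg 0 (pr k W ∘ₗ F)) (hm : HasDeg 0 (pr k W ∘ₗ D)) :
    W.tkoszul ∘ₗ D = D ∘ₗ V.tkoszul := by
  have h1 := hD.hom_comp W.isCoalgHom_tkoszul
  have h2 := hD.comp_hom V.isCoalgHom_tkoszul
  rw [hF'.tkoszul_comp hd', hF.tkoszul_comp hd] at h1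
  refine h1.ext h2 (hF'.comp V.isCoalgHom_tkoszul) (hF.comp V.isCoalgHom_tkoszul) ?_
  rw [← LinearMap.comp_assoc, ← LinearMap.comp_assoc, GradedSpace.tkoszul, pr_tmap,
    LinearMap.comp_assoc, hm.koszul_comp_even]

theorem IsCoder.tkoszul_comp_odd {F' F D : TensorAlgebra k V →ₗ[k] TensorAlgebra k W}
    (hD : IsCoder F' F D) (hF' : IsCoalgHom F') (hF : IsCoalgHom F)
    (hd' : HasDeg 0 (pr k W ∘ₗ F')) (hd : HasDeg 0 (pr k W ∘ₗ F)) {m : ℤ} (hodd : Odd m)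
    (hm : HasDeg m (pr k W ∘ₗ D)) : W.tkoszul ∘ₗ D = - D ∘ₗ V.tkoszul := by
  have h1 := hD.hom_comp W.isCoalgHom_tkoszul
  have h2 := (IsCoder.zero _ _).sub (hD.comp_hom V.isCoalgHom_tkoszul)
  rw [hF'.tkoszul_comp hd', hF.tkoszul_comp hd] at h1
  rw [zero_sub] at h2
  refine h1.ext h2 (hF'.comp V.isCoalgHom_tkoszul) (hF.comp V.isCoalgHom_tkoszul) ?_
  rw [LinearMap.comp_neg, ← LinearMap.comp_assoc, ← LinearMap.comp_assoc, GradedSpace.tkoszul,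
    pr_tmap, LinearMap.comp_assoc, hm.koszul_comp_odd hodd]

theorem linDeg_koszul : LinDeg 0 V.koszul := by
  intro i x hx
  rw [V.koszul_of_mem hx, add_zero]
  exact zsmul_mem hx _

theorem hasDeg_pr_tmap {g : V →ₗ[k] W} {m : ℤ} (hg : LinDeg m g) : HasDeg m (pr k W ∘ₗ tmap g) := by
  rw [pr_tmap]; exact hg.hasDeg

theorem linDeg_id : LinDeg 0 (LinearMap.id : V →ₗ[k] V) := by
  intro i x hx; simpa using hx

theorem hasDeg_pr_id : HasDeg 0 (pr k V ∘ₗ (LinearMap.id : _ →ₗ[k] TensorAlgebra k V)) :=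
  linDeg_id.hasDeg

theorem HasDeg.comp [CharZero k] {m n : ℤ} {f : TensorAlgebra k W →ₗ[k] X} (hf : HasDeg m f)
    {L : TensorAlgebra k V →ₗ[k] TensorAlgebra k W}
    (hL : W.tdeg ∘ₗ L = L ∘ₗ V.tdeg + (n : k) • L) : HasDeg (m + n) (f ∘ₗ L) := by
  refine hasDeg_of_degOp_comp ?_
  rw [← LinearMap.comp_assoc, hf.degOp_comp, LinearMap.add_comp, LinearMap.comp_assoc, hL]
  push_cast
  rw [LinearMap.comp_add, LinearMap.smul_comp, LinearMap.comp_smul, LinearMap.comp_assoc]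
  module

theorem HasDeg.comp_even [CharZero k] {m : ℤ} {f : TensorAlgebra k W →ₗ[k] X} (hf : HasDeg m f)
    {L : TensorAlgebra k V →ₗ[k] TensorAlgebra k W}
    (hL : W.tdeg ∘ₗ L = L ∘ₗ V.tdeg) : HasDeg m (f ∘ₗ L) := by
  have := hf.comp (L := L) (n := 0) (by simp [hL])
  rwa [add_zero] at this

end Degrees


/-! ### `A∞`-algebras and their morphisms in terms of tensor coalgebras -/

section Bar

open TensorAlgebra TensorProduct

variable {k : Type u} [Field k]

/-- Split off the first block. It is written `p.1 + 1` so that `p` indexes the cuts of the tail of a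
nonempty word. -/
theorem sum_composition_succ {M : Type*} [AddCommMonoid M] (n : ℕ) (G : List ℕ → M) :
    ∑ c : Composition (n + 1), G c.blocks =
      ∑ p ∈ Finset.HasAntidiagonal.antidiagonal n, ∑ c : Composition p.2,
        G ((p.1 + 1) :: c.blocks) := by
  rw [Finset.sum_sigma']
  symm
  refine Finset.sum_bij (fun q hq => ⟨(q.1.1 + 1) :: q.2.blocks, ?_, ?_⟩) ?_ ?_ ?_ ?_
  · intro i hi
    rcases List.mem_cons.1 hi with rfl | hi
    · exact Nat.succ_pos _
    · exact q.2.blocks_pos hi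
  · have := (Finset.mem_sigma.1 hq).1
    rw [Finset.HasAntidiagonal.mem_antidiagonal] at this
    rw [List.sum_cons, q.2.blocks_sum]
    omega
  · intro _ _; exact Finset.mem_univ _
  · rintro ⟨⟨a, b⟩, c⟩ h ⟨⟨a', b'⟩, c'⟩ h' e
    simp only [Composition.mk.injEq, List.cons.injEq, Nat.add_right_cancel_iff] at e
    obtain ⟨rfl, e⟩ := e
    obtain rfl : b = b' := by
      have h1 : c.blocks.sum = b := c.blocks_sum
      have h2 : c'.blocks.sum = b' := c'.blocks_sum
      rw [← h1, ← h2, e]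
    rw [Composition.ext e]
  · intro c _
    match hc : c.blocks with
    | [] =>
      have := c.blocks_sum
      simp [hc] at this
    | b :: bs =>
      have hpos : 0 < b := c.blocks_pos (by rw [hc]; exact List.mem_cons_self)
      have hsum := c.blocks_sum
      rw [hc, List.sum_cons] at hsum
      refine ⟨⟨(b - 1, bs.sum), ⟨bs, fun {i} hi =>
        c.blocks_pos (by rw [hc]; exact List.mem_cons_of_mem _ hi), rfl⟩⟩,
        ?_, ?_⟩
      · simp only [Finset.mem_sigma, Finset.HasAntidiagonal.mem_antidiagonal, Finset.mem_univ,
          and_true]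
        omega
      · refine Composition.ext (Eq.trans ?_ hc.symm)
        simp only [List.cons.injEq, and_true]
        omega
  · intro _ _; rfl

/-- Splitting off the first block of a composition matches the recursion `eq_conv`. This identifies
the sum over compositions in the definition of a morphism with a coalgebra map. -/
theorem cohom_word {V W : Type*} [AddCommGroup V] [Module k V] [AddCommGroup W] [Module k W]
    {f : TensorAlgebra k V →ₗ[k] W} (hf : f 1 = 0) (l : List V) :
    cohom f (word k l) = ∑ c : Composition l.length,
      word k ((l.splitWrtComposition c).map fun u => f (word k u)) := by
  have hF := isCoalgHom_cohom hf
  have hp : ∀ t, pr k W (cohom f t) = f t := LinearMap.congr_fun (pr_cohom hf)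
  induction h : l.length using Nat.strong_induction_on generalizing l with
  | _ n ih =>
  match l, h with
  | [], h =>
    subst h
    rw [word_nil, hF.map_one, List.length_nil, sum_composition_zero]
    rfl
  | x :: l, h =>
    subst h
    rw [hF.eq_conv, word_cons, counit_ι_mul, zero_smul, zero_add, ← word_cons, conv_word,
      splitSum_cons]
    simp only [word_nil, LinearMap.comp_apply, hF.map_one, pr_one, map_zero, zero_mul, zero_add, hp]
    unfold List.splitWrtComposition
    rw [List.length_cons, sum_composition_succ l.length fun bs =>
      word k (((x :: l).splitWrtCompositionAux bs).map fun u => f (word k u)),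
      splitSum_eq_antidiagonal]
    refine Finset.sum_congr rfl fun p hp => ?_
    rw [Finset.HasAntidiagonal.mem_antidiagonal] at hp
    have hl : (l.drop p.1).length = p.2 := by rw [List.length_drop]; omega
    rw [ih p.2 (by simp; omega) (l.drop p.1) hl, Finset.mul_sum]
    refine Finset.sum_congr rfl fun c _ => ?_
    rw [List.splitWrtCompositionAux_cons, List.map_cons, word_cons]
    rfl

theorem IsHomog.exists_degrees {V : GradedSpace.{u, v} k} {l : List V} {e : ℤ}
    (h : IsHomog V l e) : ∃ i : Fin l.length → ℤ, (∀ j, l.get j ∈ V.sdeg (i j)) ∧ ∑ j, i j = e := by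
  induction h with
  | nil => exact ⟨Fin.elim0, fun j => j.elim0, rfl⟩
  | @cons i e x l hx hl ih =>
    obtain ⟨d, hd, rfl⟩ := ih
    refine ⟨Fin.cons i d, fun j => ?_, Fin.sum_cons _ _⟩
    refine Fin.cases ?_ (fun j => ?_) j
    · simpa using hx
    · simpa using hd j

theorem isHomog_ofFn {V : GradedSpace.{u, v} k} {n : ℕ} {i : Fin n → ℤ} {x : Fin n → V}
    (h : ∀ j, x j ∈ V.sdeg (i j)) : IsHomog V (List.ofFn x) (∑ j, i j) := by
  induction n with
  | zero => simpa using IsHomog.nil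
  | succ n ih =>
    rw [List.ofFn_succ, Fin.sum_univ_succ]
    exact .cons (h 0) (ih fun j => h j.succ)

theorem hasDeg_ofMultilinear {V : GradedSpace.{u, v} k} {W : GradedSpace.{u, w} k} {m : ℤ}
    {φ : (n : ℕ) → MultilinearMap k (fun _ : Fin n => V) W}
    (h : ∀ (n : ℕ) (i : Fin n → ℤ) (x : Fin n → V), (∀ j, x j ∈ V.sdeg (i j)) →
      φ n x ∈ W.sdeg (∑ j, i j + m)) : HasDeg m (ofMultilinear φ) := by
  intro l e hl
  obtain ⟨i, hi, rfl⟩ := hl.exists_degrees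
  rw [ofMultilinear_word]
  exact h _ i _ hi

section Components

variable {V W : Type*} [AddCommGroup V] [Module k V] [AddCommGroup W] [Module k W]

/-- The components of a linear map on the tensor algebra. -/
noncomputable def components (f : TensorAlgebra k V →ₗ[k] W) (n : ℕ) :
    MultilinearMap k (fun _ : Fin n => V) W :=
  f.compMultilinearMap (tprod k V n)

theorem components_apply (f : TensorAlgebra k V →ₗ[k] W) {n : ℕ} (x : Fin n → V) :
    components f n x = f (word k (List.ofFn x)) := by
  rw [components, LinearMap.compMultilinearMap_apply, tprod_eq_word]

theorem evalWord_components (f : TensorAlgebra k V →ₗ[k] W) (l : List V) :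
    evalWord (components f) l = f (word k l) := by
  rw [evalWord, components_apply, List.ofFn_get]

theorem ofMultilinear_components (f : TensorAlgebra k V →ₗ[k] W) :
    ofMultilinear (components f) = f :=
  word_hom_ext fun l => by rw [ofMultilinear_word, evalWord_components]

end Components

/-- The sign that `insertSum` puts on the letters before the inserted operation is the left map
`tkoszul` of the coderivation. -/
theorem coder_tkoszul_word {V : GradedSpace.{u, v} k} {X : Type*} [AddCommGroup X] [Module k X]
    (δ : TensorAlgebra k V →ₗ[k] V) (G : TensorAlgebra k V →ₗ[k] X) (l : List V) :
    G (coder V.tkoszul LinearMap.id δ (word k l)) =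
      insertSum V.koszul (fun l => δ (word k l)) (fun l => G (word k l)) l := by
  rw [coder_word, map_splitSum, splitSum_eq_antidiagonal, insertSum]
  refine Finset.sum_congr rfl fun p hp => ?_
  rw [Finset.HasAntidiagonal.mem_antidiagonal] at hp
  have hl : (l.drop p.1).length = p.2 := by rw [List.length_drop]; omega
  rw [map_splitSum, splitSum_eq_antidiagonal, hl]
  refine Finset.sum_congr rfl fun q hq => ?_
  rw [LinearMap.id_apply, GradedSpace.tkoszul_word, ← word_cons, ← word_append, List.drop_drop]

/-! ### The bar construction of an algebra -/

namespace AInfAlgebra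

variable (A : AInfAlgebra.{u, v} k)

/-- The operations of an `A∞`-algebra, as a linear map on the tensor coalgebra. -/
noncomputable def corestr : TensorAlgebra k A →ₗ[k] A := ofMultilinear A.d

/-- The codifferential of the bar construction. -/
noncomputable def codiff : TensorAlgebra k A →ₗ[k] TensorAlgebra k A :=
  coder A.tkoszul LinearMap.id A.corestr

theorem corestr_word (l : List A) : A.corestr (word k l) = A.op l := ofMultilinear_word _ _

theorem corestr_one : A.corestr 1 = 0 := by rw [← word_nil, corestr_word, op_nil]

theorem corestr_ι (x : A) : A.corestr (ι k x) = A.d₁ x := by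
  rw [← op_one, ← corestr_word]; simp

theorem hasDeg_corestr : HasDeg 1 A.corestr := hasDeg_ofMultilinear A.d_mem

theorem isCoder_codiff : IsCoder A.tkoszul LinearMap.id A.codiff :=
  isCoder_coder A.isCoalgHom_tkoszul IsCoalgHom.id A.corestr_one

theorem pr_codiff : pr k A ∘ₗ A.codiff = A.corestr :=
  pr_coder A.isCoalgHom_tkoszul IsCoalgHom.id _

theorem codiff_word {X : Type*} [AddCommGroup X] [Module k X] (G : TensorAlgebra k A →ₗ[k] X)
    (l : List A) : G (A.codiff (word k l)) =
      insertSum A.koszul A.op (fun l => G (word k l)) l := by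
  rw [codiff, coder_tkoszul_word]
  simp only [corestr_word]

/-- The defining relation of an `A∞`-algebra is the corestriction of the equation that the
codifferential squares to zero. -/
theorem corestr_comp_codiff : A.corestr ∘ₗ A.codiff = 0 := by
  refine word_hom_ext fun l => ?_
  rw [LinearMap.comp_apply, codiff_word]
  simp only [corestr_word]
  exact A.relation l

end AInfAlgebra

/-- The square of an odd coderivation. -/
theorem IsCoder.sq {V : GradedSpace.{u, v} k} {D : TensorAlgebra k V →ₗ[k] TensorAlgebra k V}
    (hD : IsCoder V.tkoszul LinearMap.id D) (hodd : V.tkoszul ∘ₗ D = - D ∘ₗ V.tkoszul) :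
    IsCoder LinearMap.id LinearMap.id (D ∘ₗ D) := by
  -- The coefficient `0` discards the second composite. The mixed terms of `D ∘ D` cancel because
  -- `D` anticommutes with the Koszul sign.
  have := IsCoder.comp_add_comp (0 : k) hD hD hD hD V.tkoszul_comp_tkoszul V.tkoszul_comp_tkoszul
    (LinearMap.id_comp _) (LinearMap.id_comp _) (by
      rw [hodd, LinearMap.id_comp, LinearMap.comp_id, zero_smul, add_zero,
        ← TensorProduct.map_add_left, neg_add_cancel, TensorProduct.map_zero_left])
  simpa using this

theorem odd_coder {V : GradedSpace.{u, v} k} {D : TensorAlgebra k V →ₗ[k] TensorAlgebra k V}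
    (hD : IsCoder V.tkoszul LinearMap.id D) {m : ℤ} (hm : Odd m) (hd : HasDeg m (pr k V ∘ₗ D)) :
    V.tkoszul ∘ₗ D = - D ∘ₗ V.tkoszul :=
  hD.tkoszul_comp_odd V.isCoalgHom_tkoszul IsCoalgHom.id (hasDeg_pr_tmap linDeg_koszul)
    hasDeg_pr_id hm hd

theorem coder_tdeg_comp {V : GradedSpace.{u, v} k} {D : TensorAlgebra k V →ₗ[k] TensorAlgebra k V}
    (hD : IsCoder V.tkoszul LinearMap.id D) {m : ℤ} (hd : HasDeg m (pr k V ∘ₗ D)) :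
    V.tdeg ∘ₗ D = D ∘ₗ V.tdeg + (m : k) • D :=
  hD.tdeg_comp V.isCoalgHom_tkoszul IsCoalgHom.id (hasDeg_pr_tmap linDeg_koszul) hasDeg_pr_id hd

namespace AInfAlgebra

theorem codiff_odd (A : AInfAlgebra.{u, v} k) : A.tkoszul ∘ₗ A.codiff = - A.codiff ∘ₗ A.tkoszul :=
  odd_coder A.isCoder_codiff odd_one (A.pr_codiff ▸ A.hasDeg_corestr)

theorem codiff_comp_codiff (A : AInfAlgebra.{u, v} k) : A.codiff ∘ₗ A.codiff = 0 := by
  refine (A.isCoder_codiff.sq A.codiff_odd).ext (IsCoder.zero _ _) IsCoalgHom.id IsCoalgHom.id ?_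
  rw [← LinearMap.comp_assoc, pr_codiff, corestr_comp_codiff, LinearMap.comp_zero]

/-- The `A∞`-algebra given by a codifferential. -/
noncomputable def ofCorestr (V : GradedSpace.{u, v} k) (δ : TensorAlgebra k V →ₗ[k] V)
    (h1 : δ 1 = 0) (hd : HasDeg 1 δ) (hδ : δ ∘ₗ coder V.tkoszul LinearMap.id δ = 0) :
    AInfAlgebra.{u, v} k where
  toGradedSpace := V
  d := components δ
  d_zero := by
    ext x
    rw [components_apply]
    simpa using h1
  d_mem n i x hx := by
    rw [components_apply]
    exact hd _ _ (isHomog_ofFn hx)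
  relation l := by
    have := LinearMap.congr_fun hδ (word k l)
    rw [LinearMap.comp_apply, coder_tkoszul_word] at this
    simpa only [funext (evalWord_components δ)] using this.trans (LinearMap.zero_apply _)

theorem corestr_ofCorestr (V : GradedSpace.{u, v} k) (δ : TensorAlgebra k V →ₗ[k] V) (h1 : δ 1 = 0)
    (hd : HasDeg 1 δ) (hδ : δ ∘ₗ coder V.tkoszul LinearMap.id δ = 0) :
    (ofCorestr V δ h1 hd hδ).corestr = δ := ofMultilinear_components δ

variable {A : AInfAlgebra.{u, v} k} {B : AInfAlgebra.{u, w} k}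

/-- The components of a morphism, as a linear map on the tensor coalgebra. -/
noncomputable def Hom.corestr (f : Hom A B) : TensorAlgebra k A →ₗ[k] B := ofMultilinear f.f

/-- The map of bar constructions given by a morphism. -/
noncomputable def Hom.bar (f : Hom A B) : TensorAlgebra k A →ₗ[k] TensorAlgebra k B :=
  cohom f.corestr

theorem Hom.corestr_word (f : Hom A B) (l : List A) : f.corestr (word k l) = f.op l :=
  ofMultilinear_word _ _

theorem Hom.corestr_one (f : Hom A B) : f.corestr 1 = 0 := by
  rw [← word_nil, corestr_word, op, evalWord]
  show f.f 0 _ = 0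
  rw [f.f_zero]
  rfl

theorem Hom.corestr_ι (f : Hom A B) (x : A) : f.corestr (ι k x) = f.f₁ x := by
  have : f.f₁ x = f.op [x] := rfl
  rw [this, ← corestr_word]; simp

theorem Hom.hasDeg_corestr (f : Hom A B) : HasDeg 0 f.corestr :=
  hasDeg_ofMultilinear fun n i x hx => by rw [add_zero]; exact f.f_mem n i x hx

theorem Hom.isCoalgHom_bar (f : Hom A B) : IsCoalgHom f.bar := isCoalgHom_cohom f.corestr_one

theorem Hom.pr_bar (f : Hom A B) : pr k B ∘ₗ f.bar = f.corestr := pr_cohom f.corestr_one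

theorem Hom.hasDeg_pr_bar (f : Hom A B) : HasDeg 0 (pr k B ∘ₗ f.bar) :=
  f.pr_bar ▸ f.hasDeg_corestr

theorem Hom.bar_word (f : Hom A B) (l : List A) : f.bar (word k l) =
    ∑ c : Composition l.length, word k ((l.splitWrtComposition c).map f.op) := by
  rw [bar, cohom_word f.corestr_one]
  simp only [corestr_word]

/-- Both composites are coderivations along the same pair, as `F` commutes with the Koszul signs.
Only corestrictions need checking, and there the equation is the defining relation of a morphism. -/
theorem comm_of_corestr {F : TensorAlgebra k A →ₗ[k] TensorAlgebra k B} (hF : IsCoalgHom F)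
    (hd : HasDeg 0 (pr k B ∘ₗ F)) (h : (pr k B ∘ₗ F) ∘ₗ A.codiff = B.corestr ∘ₗ F) :
    F ∘ₗ A.codiff = B.codiff ∘ₗ F := by
  have h1 := A.isCoder_codiff.hom_comp hF
  have h2 := B.isCoder_codiff.comp_hom hF
  rw [hF.tkoszul_comp hd] at h2
  refine h1.ext h2 (hF.comp A.isCoalgHom_tkoszul) hF ?_
  rw [← LinearMap.comp_assoc, ← LinearMap.comp_assoc, pr_codiff, h]

theorem Hom.bar_comp_codiff (f : Hom A B) : f.bar ∘ₗ A.codiff = B.codiff ∘ₗ f.bar := by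
  refine comm_of_corestr f.isCoalgHom_bar f.hasDeg_pr_bar ?_
  rw [pr_bar]
  refine word_hom_ext fun l => ?_
  rw [LinearMap.comp_apply, LinearMap.comp_apply, codiff_word, bar_word, map_sum]
  simp only [corestr_word, AInfAlgebra.corestr_word]
  exact f.relation l

/-- The morphism of `A∞`-algebras given by a map of bar constructions. -/
noncomputable def Hom.ofBar (F : TensorAlgebra k A →ₗ[k] TensorAlgebra k B) (hF : IsCoalgHom F)
    (hd : HasDeg 0 (pr k B ∘ₗ F)) (h : F ∘ₗ A.codiff = B.codiff ∘ₗ F) : Hom A B where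
  f := components (pr k B ∘ₗ F)
  f_zero := by
    ext x
    rw [components_apply]
    simp [hF.map_one]
  f_mem n i x hx := by
    rw [components_apply, ← add_zero (∑ j, i j)]
    exact hd _ _ (isHomog_ofFn hx)
  relation l := by
    have h1 : (pr k B ∘ₗ F) 1 = 0 := by simp [hF.map_one]
    have hc : cohom (pr k B ∘ₗ F) = F := (isCoalgHom_cohom h1).ext hF (pr_cohom h1)
    have := LinearMap.congr_fun (congrArg (fun L => pr k B ∘ₗ L) h) (word k l)
    simp only [← LinearMap.comp_assoc, pr_codiff] at this
    rw [LinearMap.comp_apply, codiff_word, LinearMap.comp_apply] at this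
    conv_rhs at this => rw [← hc, cohom_word h1, map_sum]
    simp only [AInfAlgebra.corestr_word] at this
    simpa only [funext (evalWord_components (pr k B ∘ₗ F))] using this

theorem Hom.f₁_ofBar (F : TensorAlgebra k A →ₗ[k] TensorAlgebra k B) (hF : IsCoalgHom F)
    (hd : HasDeg 0 (pr k B ∘ₗ F)) (h : F ∘ₗ A.codiff = B.codiff ∘ₗ F) (x : A) :
    (Hom.ofBar F hF hd h).f₁ x = pr k B (F (ι k x)) := by
  have : (Hom.ofBar F hF hd h).f₁ x = evalWord (components (pr k B ∘ₗ F)) [x] := rfl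
  rw [this, evalWord_components]
  simp

end AInfAlgebra

end Bar


/-! ### Pushing coderivations forward along morphisms of bimodules -/

section Bimodule

open TensorAlgebra TensorProduct

variable {k : Type u} [Field k]

/-- Both sides run over factorisations into five words `u a c e z`. The first groups them as `u (a c
e) z`, the second as `(u a) c (e z)`; these are the two groupings in the bimodule relation. -/
theorem splitSum_five {L M : Type*} [AddCommMonoid M] (l : List L)
    (G : List L → List L → List L → List L → List L → M) :
    (splitSum l fun u v => splitSum v fun v1 z => splitSum v1 fun a b => splitSum b fun c e =>
      G u a c e z) =
    splitSum l fun l1 s => splitSum s fun c l2 => splitSum l1 fun u a => splitSum l2 fun e z =>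
      G u a c e z := by
  have h1 : ∀ u v, (splitSum v fun v1 z => splitSum v1 fun a b => splitSum b fun c e =>
      G u a c e z) = splitSum v fun a s => splitSum s fun c t => splitSum t fun e z =>
        G u a c e z := by
    intro u v
    rw [← splitSum_assoc v fun a b z => splitSum b fun c e => G u a c e z]
    exact splitSum_congr fun a s _ => (splitSum_assoc s fun c e z => G u a c e z).symm
  simp only [h1]
  rw [splitSum_assoc l fun u a s => splitSum s fun c t => splitSum t fun e z => G u a c e z]
  exact splitSum_congr fun l1 s _ => splitSum_comm l1 s fun u a c t => splitSum t fun e z =>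
    G u a c e z

section

variable {V B X : Type*} [AddCommGroup V] [Module k V] [AddCommGroup B] [Module k B]
  [AddCommGroup X] [Module k X]

theorem ofMultilinear_add (φ ψ : (n : ℕ) → MultilinearMap k (fun _ : Fin n => V) X) :
    ofMultilinear (φ + ψ) = ofMultilinear φ + ofMultilinear ψ := by
  refine word_hom_ext fun l => ?_
  simp [ofMultilinear_word, evalWord]

theorem ofMultilinear_smul (c : k) (φ : (n : ℕ) → MultilinearMap k (fun _ : Fin n => V) X) :
    ofMultilinear (c • φ) = c • ofMultilinear φ := by
  refine word_hom_ext fun l => ?_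
  simp [ofMultilinear_word, evalWord]

/-- The trilinear map given by the components of a morphism of bimodules. -/
noncomputable def ofBimultilinear (r : (p q : ℕ) → MultilinearMap k (fun _ : Fin p => V)
      (B →ₗ[k] MultilinearMap k (fun _ : Fin q => V) X)) :
    TensorAlgebra k V →ₗ[k] B →ₗ[k] TensorAlgebra k V →ₗ[k] X :=
  -- `Λ` assembles the components in the right-hand letters. Being linear, it can be composed with
  -- the multilinear map in the left-hand letters.
  let Λ : ((q : ℕ) → B →ₗ[k] MultilinearMap k (fun _ : Fin q => V) X) →ₗ[k]
      B →ₗ[k] TensorAlgebra k V →ₗ[k] X :=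
    { toFun := fun φ =>
        { toFun := fun m => ofMultilinear fun q => φ q m
          map_add' := fun m m' => by rw [← ofMultilinear_add]; congr 1; ext; simp
          map_smul' := fun c m => by
            rw [RingHom.id_apply, ← ofMultilinear_smul]; congr 1; ext; simp }
      map_add' := fun φ ψ => by
        ext1 m; exact ofMultilinear_add (fun q => φ q m) fun q => ψ q m
      map_smul' := fun c φ => by
        ext1 m; exact ofMultilinear_smul c fun q => φ q m }
  ofMultilinear fun p => Λ.compMultilinearMap (MultilinearMap.pi fun q => r p q)

theorem ofBimultilinear_word (r : (p q : ℕ) → MultilinearMap k (fun _ : Fin p => V)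
      (B →ₗ[k] MultilinearMap k (fun _ : Fin q => V) X)) (l : List V) (m : B) (l' : List V) :
    ofBimultilinear r (word k l) m (word k l') = evalBiWord r l m l' := by
  rw [ofBimultilinear, ofMultilinear_word]
  exact ofMultilinear_word (fun q => r l.length q l.get m) l'

/-- The linear map `w ↦ ∑ R (u, g v, z)`, where the sum is over the factorisations `w = u v z`. -/
noncomputable def conv₃ (R : TensorAlgebra k V →ₗ[k] B →ₗ[k] TensorAlgebra k V →ₗ[k] X)
    (g : TensorAlgebra k V →ₗ[k] B) : TensorAlgebra k V →ₗ[k] X :=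
  TensorProduct.lift ((TensorProduct.uncurry (RingHom.id k) _ _ _) ∘ₗ
    (LinearMap.lcomp k _ g) ∘ₗ R) ∘ₗ (deconc k V).lTensor _ ∘ₗ deconc k V

theorem conv₃_word (R : TensorAlgebra k V →ₗ[k] B →ₗ[k] TensorAlgebra k V →ₗ[k] X)
    (g : TensorAlgebra k V →ₗ[k] B) (l : List V) : conv₃ R g (word k l) =
      splitSum l fun u v => splitSum v fun v1 v2 => R (word k u) (g (word k v1)) (word k v2) := by
  have h : ∀ (t : TensorAlgebra k V)
      (u : List V → List V → TensorAlgebra k V ⊗[k] TensorAlgebra k V)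
    (l : List V), t ⊗ₜ[k] splitSum l u = splitSum l fun a b => t ⊗ₜ[k] u a b := by
    intro t u l
    rw [← TensorProduct.mk_apply, map_splitSum]; rfl
  simp only [conv₃, LinearMap.comp_apply, deconc_word, map_splitSum, LinearMap.lTensor_tmul, h]
  rfl

/-- The iterated coproduct of `D` lets it act on the left, middle or right factor, with `κ` on the
factors before it. For the codifferential these are the three kinds of terms on the source side of
the bimodule relation. -/
theorem conv₃_coder {D κ : TensorAlgebra k V →ₗ[k] TensorAlgebra k V}
    (hD : IsCoder κ LinearMap.id D)
    (R : TensorAlgebra k V →ₗ[k] B →ₗ[k] TensorAlgebra k V →ₗ[k] X)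
    (g : TensorAlgebra k V →ₗ[k] B) (l : List V) : conv₃ R g (D (word k l)) =
      splitSum l fun u v => splitSum v fun v1 v2 =>
        R (D (word k u)) (g (word k v1)) (word k v2) +
        R (κ (word k u)) (g (D (word k v1))) (word k v2) +
        R (κ (word k u)) (g (κ (word k v1))) (D (word k v2)) := by
  have h : ∀ (t : TensorAlgebra k V)
      (u : List V → List V → TensorAlgebra k V ⊗[k] TensorAlgebra k V)
    (l : List V), t ⊗ₜ[k] splitSum l u = splitSum l fun a b => t ⊗ₜ[k] u a b := by
    intro t u l
    rw [← TensorProduct.mk_apply, map_splitSum]; rfl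
  have e : ∀ t, deconc k V (D t) = TensorProduct.map κ D (deconc k V t) +
    TensorProduct.map D LinearMap.id (deconc k V t) := LinearMap.congr_fun hD.deconc_comp
  simp only [conv₃, LinearMap.comp_apply, e, deconc_word, map_splitSum, LinearMap.lTensor_tmul, h,
    TensorProduct.map_tmul, map_add, splitSum_add, TensorProduct.tmul_add,
    LinearMap.id_apply]
  simp only [TensorProduct.lift.tmul]
  rw [add_comm, ← add_assoc, add_right_comm]
  rfl

end

theorem IsHomog.append_inv {V : GradedSpace.{u, v} k} {l l' : List V} {e : ℤ}
    (h : IsHomog V (l ++ l') e) : ∃ a b, IsHomog V l a ∧ IsHomog V l' b ∧ a + b = e := by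
  induction l generalizing e with
  | nil => exact ⟨0, e, .nil, h, zero_add e⟩
  | cons x l ih =>
    obtain _ | ⟨hx, hl⟩ := h
    obtain ⟨a, b, ha, hb, rfl⟩ := ih hl
    exact ⟨_, b, .cons hx ha, hb, add_assoc _ _ _⟩

namespace AInfAlgebra

variable {A : AInfAlgebra.{u, v} k} {B : AInfAlgebra.{u, w} k} {f : Hom A B}

/-- The two sums over compositions are the values of the bar map on the words to either side of `m`.
-/
theorem restrictOp_selfOp (f : Hom A B) (l : List A) (m : B) (l' : List A) :
    restrictOp f (selfOp B) l m l' =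
      B.corestr (f.bar (word k l) * (ι k m * f.bar (word k l'))) := by
  rw [f.bar_word, f.bar_word, Finset.mul_sum, Finset.sum_mul_sum, map_sum]
  unfold restrictOp
  refine Finset.sum_congr rfl fun c _ => ?_
  rw [map_sum]
  refine Finset.sum_congr rfl fun c' _ => ?_
  rw [← word_cons, ← word_append, corestr_word]
  rfl

/-- The corestriction of the coderivation of `A` that a retraction `r : B → A` associates with a
coderivation along `f` with corestriction `g`. -/
noncomputable def Hom.Retraction.push (r : f.Retraction) (g : TensorAlgebra k A →ₗ[k] B) :
    TensorAlgebra k A →ₗ[k] A :=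
  conv₃ (ofBimultilinear r.r) g

theorem Hom.Retraction.push_word (r : f.Retraction) (g : TensorAlgebra k A →ₗ[k] B) (l : List A) :
    Hom.Retraction.push r g (word k l) = splitSum l fun u v => splitSum v fun v1 v2 =>
      evalBiWord r.r u (g (word k v1)) v2 := by
  rw [push, conv₃_word]
  simp only [ofBimultilinear_word]

theorem Hom.Retraction.push_one (r : f.Retraction) {g : TensorAlgebra k A →ₗ[k] B} (hg : g 1 = 0) :
    Hom.Retraction.push r g 1 = 0 := by
  rw [← word_nil, push, conv₃_word]
  simp [hg]

theorem Hom.Retraction.push_ι (r : f.Retraction) {g : TensorAlgebra k A →ₗ[k] B} (hg : g 1 = 0)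
    (x : A) : Hom.Retraction.push r g (ι k x) = r.linearPart (g (ι k x)) := by
  have : ι k x = word k [x] := by simp
  rw [this, push, conv₃_word]
  simp only [splitSum_cons, splitSum_nil, word_nil, hg, map_zero, LinearMap.zero_apply, zero_add,
    add_zero]
  exact ofBimultilinear_word _ [] _ []

theorem Hom.Retraction.hasDeg_push (r : f.Retraction) {g : TensorAlgebra k A →ₗ[k] B}
    (hg : HasDeg 0 g) : HasDeg 0 (Hom.Retraction.push r g) := by
  intro l e hl
  rw [push_word]
  refine splitSum_mem fun u v huv => splitSum_mem fun v1 v2 hv => ?_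
  rw [← huv, ← hv] at hl
  obtain ⟨a, b, ha, hb, rfl⟩ := hl.append_inv
  obtain ⟨c, d, hc, hd, rfl⟩ := hb.append_inv
  obtain ⟨i, hi, rfl⟩ := ha.exists_degrees
  obtain ⟨j, hj, rfl⟩ := hd.exists_degrees
  have := r.r_mem _ _ i _ j _ _ _ hi (hg _ _ hc) hj
  have e : ∑ t, i t + (c + ∑ t, j t) + 0 = ∑ t, i t + (c + 0) + ∑ t, j t := by ring
  rw [e]
  exact this

/-- Summed over all factorisations, the bimodule relation gives the claim. Its two outer sums are
the outer terms of `conv₃_coder`. Its middle sum assembles to `r` applied to the corestriction of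
`B` evaluated on `γ`, which the hypothesis replaces by `g` of a codifferential. Only subwords of `l`
occur, so agreement below `n` is inherited. -/
theorem Hom.Retraction.push_comm (r : f.Retraction) {γ : TensorAlgebra k A →ₗ[k] TensorAlgebra k B}
    (hγ : IsCoder f.bar f.bar γ) (hd : HasDeg 0 (pr k B ∘ₗ γ)) {n : ℕ}
    (h : EqBelow n (B.codiff ∘ₗ γ) (γ ∘ₗ A.codiff)) :
    EqBelow n
      (A.corestr ∘ₗ coder LinearMap.id LinearMap.id (Hom.Retraction.push r (pr k B ∘ₗ γ)))
      (Hom.Retraction.push r (pr k B ∘ₗ γ) ∘ₗ A.codiff) := by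
  set g := pr k B ∘ₗ γ with hgdef
  have hg1 : g 1 = 0 := by simp [hgdef, hγ.map_one]
  have hγ' : γ = coder f.bar f.bar g :=
    hγ.ext (isCoder_coder f.isCoalgHom_bar f.isCoalgHom_bar hg1) f.isCoalgHom_bar f.isCoalgHom_bar
      (by rw [pr_coder f.isCoalgHom_bar f.isCoalgHom_bar])
  intro l hl
  rw [LinearMap.comp_apply, LinearMap.comp_apply, coder_word]
  -- The target side of the bimodule relation: an operation of `A` with one value of `r` among its
  -- arguments.
  have hleft : A.corestr (splitSum l fun u v => splitSum v fun v1 v2 =>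
      (LinearMap.id : TensorAlgebra k A →ₗ[k] _) (word k u) * (ι k (push r g (word k v1)) *
        (LinearMap.id : TensorAlgebra k A →ₗ[k] _) (word k v2))) =
      splitSum l fun u v => splitSum v fun v1 z => splitSum v1 fun a b => splitSum b fun c e =>
        selfOp A u (evalBiWord r.r a (g (word k c)) e) z := by
    simp only [map_splitSum]
    refine splitSum_congr fun u v _ => splitSum_congr fun v1 z _ => ?_
    have : A.corestr (word k u * (ι k (push r g (word k v1)) * word k z)) =
        (A.corestr ∘ₗ LinearMap.mulLeft k (word k u) ∘ₗ LinearMap.mulRight k (word k z) ∘ₗ ι k)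
          (push r g (word k v1)) := rfl
    rw [LinearMap.id_apply, LinearMap.id_apply, this, push_word]
    simp only [map_splitSum]
    refine splitSum_congr fun a b _ => splitSum_congr fun c e _ => ?_
    simp only [LinearMap.comp_apply, LinearMap.mulRight_apply, LinearMap.mulLeft_apply]
    rw [← word_cons, ← word_append, AInfAlgebra.corestr_word]
    rfl
  rw [hleft, splitSum_five, push, conv₃_coder A.isCoder_codiff]
  have hrel : ∀ l1 c l2, (splitSum l1 fun u a => splitSum l2 fun e z =>
      selfOp A u (evalBiWord r.r a (g (word k c)) e) z) =
      ofBimultilinear r.r (A.codiff (word k l1)) (g (word k c)) (word k l2) +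
      (splitSum l1 fun p a => splitSum l2 fun e q => ofBimultilinear r.r (A.tkoszul (word k p))
        (B.corestr (f.bar (word k a) * (ι k (g (word k c)) * f.bar (word k e)))) (word k q)) +
      ofBimultilinear r.r (A.tkoszul (word k l1)) (g (A.tkoszul (word k c)))
        (A.codiff (word k l2)) := by
    intro l1 c l2
    have h1 := r.relation l1 (g (word k c)) l2
    rw [splitSum_eq_antidiagonal]
    simp only [splitSum_eq_antidiagonal]
    rw [← h1]
    congr 1
    · congr 1
      · have := A.codiff_word (((ofBimultilinear r.r).flip (g (word k c))).flip (word k l2)) l1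
        simp only [LinearMap.flip_apply, ofBimultilinear_word] at this
        exact this.symm
      · refine Finset.sum_congr rfl fun s _ => Finset.sum_congr rfl fun t _ => ?_
        rw [restrictOp_selfOp, GradedSpace.tkoszul_word, ofBimultilinear_word]
    · have hk : g (A.tkoszul (word k c)) = B.koszul (g (word k c)) :=
        (LinearMap.congr_fun hd.koszul_comp_even _).symm
      have := A.codiff_word
        (ofBimultilinear r.r (A.tkoszul (word k l1)) (B.koszul (g (word k c)))) l2
      rw [hk, this, GradedSpace.tkoszul_word]
      simp only [ofBimultilinear_word]
  simp only [hrel, splitSum_add]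
  congr 2
  -- Regrouping `a c e` into one word exposes the coderivation `γ` on that word, by `coder_word`.
  rw [← splitSum_five l fun p a c e q => ofBimultilinear r.r (A.tkoszul (word k p))
        (B.corestr (f.bar (word k a) * (ι k (g (word k c)) * f.bar (word k e)))) (word k q)]
  refine splitSum_congr fun p v huv => splitSum_congr fun c q hcq => ?_
  have hlen : c.length < n := by
    refine lt_of_le_of_lt ?_ hl
    simp [← huv, ← hcq]
    omega
  have h2 : g (A.codiff (word k c)) = B.corestr (γ (word k c)) := by
    have := congrArg (pr k B) (h c hlen)
    rw [LinearMap.comp_apply, LinearMap.comp_apply] at this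
    rw [← B.pr_codiff]
    exact this.symm
  have : ∀ y, ofBimultilinear r.r (A.tkoszul (word k p)) (B.corestr y) (word k q) =
    (((ofBimultilinear r.r (A.tkoszul (word k p))).flip (word k q)) ∘ₗ B.corestr) y := fun _ => rfl
  rw [h2, this, hγ', coder_word]
  simp only [map_splitSum]
  rfl

end AInfAlgebra

end Bimodule


/-! ### Homotopy transfer -/

section Transfer

open TensorAlgebra TensorProduct

variable {k : Type u} [Field k]

namespace AInfAlgebra

/-- A contraction of the complex `(sA, d₁)` onto its cohomology. -/
structure Contraction (A : AInfAlgebra.{u, v} k) where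
  i : A.HSpace.carrier →ₗ[k] A.carrier
  π : A.carrier →ₗ[k] A.HSpace.carrier
  h : A.carrier →ₗ[k] A.carrier
  linDeg_i : LinDeg (V := A.HSpace) (W := A.toGradedSpace) 0 i
  linDeg_π : LinDeg (V := A.toGradedSpace) (W := A.HSpace) 0 π
  linDeg_h : LinDeg (V := A.toGradedSpace) (W := A.toGradedSpace) (-1) h
  d_i : ∀ z, A.d₁ (i z) = 0
  π_d : ∀ x, π (A.d₁ x) = 0
  π_i : ∀ z, π (i z) = z
  π_cls : ∀ x hx, π x = A.cls x hx
  homotopy : ∀ x, i (π x) + A.d₁ (h x) + h (A.d₁ x) = x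

/-- Over a field, `d₁` has a linear section over its image, which extends to the whole space.
Keeping only the part of degree `-1` preserves the identity `d₁ h d₁ = d₁`, since `d₁` is
homogeneous. -/
theorem exists_graded_pseudoinverse (A : AInfAlgebra.{u, v} k) :
    ∃ h : A.carrier →ₗ[k] A.carrier, (∀ i, ∀ x ∈ A.deg i, h x ∈ A.deg (i - 1)) ∧
      ∀ x, A.d₁ (h (A.d₁ x)) = A.d₁ x := by
  obtain ⟨s, hs⟩ := A.d₁.rangeRestrict.exists_rightInverse_of_surjective A.d₁.range_rangeRestrict
  obtain ⟨h0, hh0⟩ := LinearMap.exists_extend s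
  have hd : ∀ x, A.d₁ (h0 (A.d₁ x)) = A.d₁ x := by
    intro x
    have h1 : h0 (A.d₁ x) = s (A.d₁.rangeRestrict x) :=
      LinearMap.congr_fun hh0 (A.d₁.rangeRestrict x)
    have h2 := congrArg Subtype.val (LinearMap.congr_fun hs (A.d₁.rangeRestrict x))
    rw [h1]
    exact h2
  let h : A.carrier →ₗ[k] A.carrier :=
    (DirectSum.toModule k ℤ A.carrier fun i => A.proj (i - 1) ∘ₗ h0 ∘ₗ (A.deg i).subtype) ∘ₗ
      (DirectSum.decomposeLinearEquiv A.deg).toLinearMap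
  have hh : ∀ i, ∀ x ∈ A.deg i, h x = A.proj (i - 1) (h0 x) := by
    intro i x hx
    lift x to A.deg i using hx
    simp only [h, LinearMap.comp_apply, LinearEquiv.coe_coe,
      DirectSum.decomposeLinearEquiv_apply_coe, DirectSum.toModule_lof, Submodule.subtype_apply]
  refine ⟨h, fun i x hx => by rw [hh i x hx]; exact A.proj_mem _ _, fun x => ?_⟩
  suffices H : A.d₁ ∘ₗ h ∘ₗ A.d₁ = A.d₁ from LinearMap.congr_fun H x
  refine GradedSpace.hom_ext fun i x hx => ?_
  rw [LinearMap.comp_apply, LinearMap.comp_apply, hh _ _ (A.d₁_mem hx), add_sub_cancel_right,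
    ← A.proj_d₁, hd, A.proj_same (A.d₁_mem hx)]

/-- With the pseudoinverse `h`, the map `P = 1 - d h - h d` satisfies `d P = P d = 0`. It thus takes
values in cocycles and factors through cohomology, which gives both `i` and `π`. -/
theorem exists_contraction (A : AInfAlgebra.{u, v} k) : Nonempty A.Contraction := by
  obtain ⟨h, hdeg, hd⟩ := A.exists_graded_pseudoinverse
  let P : A.carrier →ₗ[k] A.carrier := LinearMap.id - A.d₁ ∘ₗ h - h ∘ₗ A.d₁
  have hP : ∀ x, P x = x - A.d₁ (h x) - h (A.d₁ x) := fun _ => rfl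
  have hdP : ∀ x, A.d₁ (P x) = 0 := by
    intro x
    rw [hP, map_sub, map_sub, d₁_d₁, hd]
    abel
  have hPd : ∀ x, P (A.d₁ x) = 0 := by
    intro x
    rw [hP, hd, d₁_d₁, map_zero]
    abel
  have hPdeg : ∀ i, ∀ x ∈ A.deg i, P x ∈ A.deg i := by
    intro i x hx
    refine Submodule.sub_mem _ (Submodule.sub_mem _ hx ?_) ?_
    · simpa using A.d₁_mem (hdeg i x hx)
    · simpa using hdeg _ _ (A.d₁_mem hx)
  let i : A.HSpace.carrier →ₗ[k] A.carrier :=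
    Submodule.liftQ _ (P ∘ₗ (LinearMap.ker A.d₁).subtype) (by
    rintro ⟨x, hx⟩ ⟨y, hy⟩
    replace hy : A.d₁ y = x := hy
    subst hy
    exact hPd y)
  let π : A.carrier →ₗ[k] A.HSpace.carrier :=
    Submodule.mkQ _ ∘ₗ LinearMap.codRestrict (LinearMap.ker A.d₁) P hdP
  have hi : ∀ x hx, i (A.cls x hx) = P x := fun _ _ => rfl
  have hπ : ∀ x, π x = A.cls (P x) (hdP x) := fun _ => rfl
  have hπc : ∀ x hx, π x = A.cls x hx := by
    intro x hx
    refine A.cls_eq _ _ ⟨-h x, ?_⟩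
    rw [hP, hx, map_zero, map_neg]
    abel
  -- `P` need not be idempotent: `i π = P² = P - P h d`. The correction `P h` of the homotopy
  -- absorbs the difference.
  refine ⟨⟨i, π, h + P ∘ₗ h, ?_, ?_, ?_, ?_, ?_, ?_, hπc, ?_⟩⟩
  · intro j z hz
    obtain ⟨x, hx, hm, rfl⟩ := A.mem_HDeg.1 hz
    rw [hi, add_zero]
    exact hPdeg _ _ hm
  · intro j x hx
    rw [hπ, add_zero]
    exact A.mem_HDeg.2 ⟨_, _, hPdeg _ _ hx, rfl⟩
  · intro j x hx
    have h1 : h x ∈ A.sdeg (j + -1) := by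
      have := hdeg _ _ hx
      rwa [add_sub_right_comm] at this
    exact Submodule.add_mem _ h1 (hPdeg _ _ h1)
  · intro z
    obtain ⟨x, hx, rfl⟩ := A.cls_surj z
    exact hdP x
  · intro x
    rw [hπ]
    refine (Submodule.Quotient.mk_eq_zero _).2 ⟨0, ?_⟩
    simp [hPd]
  · intro z
    obtain ⟨x, hx, rfl⟩ := A.cls_surj z
    rw [hi, hπc _ (hdP x), ← hπ, hπc]
  · intro x
    rw [hπ, hi]
    have e : P (P x) = P x - P (h (A.d₁ x)) := by
      conv_lhs => rw [hP x]
      rw [map_sub, map_sub, hPd]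
      rw [sub_zero]
    simp only [LinearMap.add_apply, LinearMap.comp_apply, map_add, hdP, add_zero]
    rw [e, hP x]
    abel

/-- Transferred operations on the cohomology of `A`, with an isomorphism that splits the bar
construction of `A` into the transferred structure and a linear part. -/
structure Transfer (A : AInfAlgebra.{u, v} k) extends Contraction A where
  m : TensorAlgebra k A.HSpace →ₗ[k] A.HSpace.carrier
  Ψ : TensorAlgebra k A →ₗ[k] TensorAlgebra k A
  m_one : m 1 = 0
  m_ι : ∀ z, m (ι k z) = 0
  hasDeg_m : HasDeg (V := A.HSpace) (W := A.HSpace) 1 m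
  m_comp : m ∘ₗ coder A.HSpace.tkoszul LinearMap.id m = 0
  isCoalgHom_Ψ : IsCoalgHom Ψ
  hasDeg_Ψ : HasDeg (V := A.toGradedSpace) (W := A.toGradedSpace) 0 (pr k A ∘ₗ Ψ)
  Ψ_ι : ∀ x, Ψ (ι k x) = ι k x
  comm : A.codiff ∘ₗ Ψ =
    Ψ ∘ₗ coder A.tkoszul LinearMap.id (A.d₁ ∘ₗ pr k A + i ∘ₗ m ∘ₗ tmap π)

end AInfAlgebra

/-- The homotopy on the tensor coalgebra that a contraction induces. -/
theorem tensor_homotopy {A : AInfAlgebra.{u, v} k} (C : A.Contraction)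
    {D H : TensorAlgebra k A →ₗ[k] TensorAlgebra k A}
    (hD : IsCoder A.tkoszul LinearMap.id D) (hDp : pr k A ∘ₗ D = A.d₁ ∘ₗ pr k A)
    (hH : IsCoder (A.tkoszul ∘ₗ tmap (C.i ∘ₗ C.π)) LinearMap.id H)
    (hHp : pr k A ∘ₗ H = C.h ∘ₗ pr k A)
    (hd : LinDeg (V := A.toGradedSpace) (W := A.toGradedSpace) 1 A.d₁)
    (hDP : D ∘ₗ tmap (C.i ∘ₗ C.π) = 0) (hPD : tmap (C.i ∘ₗ C.π) ∘ₗ D = 0) :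
    D ∘ₗ H + H ∘ₗ D = LinearMap.id - tmap (C.i ∘ₗ C.π) := by
  set P := tmap (C.i ∘ₗ C.π) with hPdef
  have hP : IsCoalgHom P := isCoalgHom_tmap _
  have hPdeg : HasDeg (V := A.toGradedSpace) (W := A.toGradedSpace) 0 (pr k A ∘ₗ P) :=
    hasDeg_pr_tmap fun i x hx => by
      have h1 := C.linDeg_π i x hx
      have h2 := C.linDeg_i _ _ h1
      simpa using h2
  have hκP : A.tkoszul ∘ₗ P = P ∘ₗ A.tkoszul := hP.tkoszul_comp hPdeg
  have hκP' := A.isCoalgHom_tkoszul.comp hP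
  have hDodd : A.tkoszul ∘ₗ D = - D ∘ₗ A.tkoszul :=
    odd_coder hD odd_one (by rw [hDp]; exact hd.hasDeg)
  have hHodd : A.tkoszul ∘ₗ H = - H ∘ₗ A.tkoszul := by
    refine hH.tkoszul_comp_odd hκP' IsCoalgHom.id ?_ hasDeg_pr_id (m := -1) (by decide)
      (by rw [hHp]; exact C.linDeg_h.hasDeg)
    have e : pr k A ∘ₗ A.tkoszul ∘ₗ P = A.koszul ∘ₗ pr k A ∘ₗ P := by
      rw [← LinearMap.comp_assoc, GradedSpace.tkoszul, pr_tmap, LinearMap.comp_assoc]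
    rw [e]
    exact linDeg_koszul.comp_hasDeg hPdeg
  -- The mixed terms vanish because `D P = P D = 0` and `H` anticommutes with the sign. So both
  -- sides of the homotopy identity are coderivations along `(P, id)`, and it reduces to
  -- `C.homotopy` on letters.
  have h1 : IsCoder P LinearMap.id (D ∘ₗ H + (1 : k) • H ∘ₗ D) := by
    refine IsCoder.comp_add_comp (1 : k) hD hH hH hD ?_ ?_ (LinearMap.id_comp _)
      (LinearMap.id_comp _) ?_
    · rw [← LinearMap.comp_assoc, GradedSpace.tkoszul_comp_tkoszul, LinearMap.id_comp]
    · rw [hκP, LinearMap.comp_assoc, GradedSpace.tkoszul_comp_tkoszul, LinearMap.comp_id]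
    · have e1 : D ∘ₗ (A.tkoszul ∘ₗ P) = 0 := by
        rw [hκP, ← LinearMap.comp_assoc, hDP, LinearMap.zero_comp]
      have e2 : (A.tkoszul ∘ₗ P) ∘ₗ D = 0 := by
        rw [LinearMap.comp_assoc, hPD, LinearMap.comp_zero]
      rw [e1, e2, hHodd, one_smul, TensorProduct.map_zero_left, TensorProduct.map_zero_left,
        LinearMap.comp_id, LinearMap.id_comp, add_zero, zero_add, ← TensorProduct.map_add_left,
        neg_add_cancel, TensorProduct.map_zero_left]
  rw [one_smul] at h1
  have h2 : IsCoder P LinearMap.id (LinearMap.id - P) := by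
    have := (IsCoder.zero _ _).sub (hP.sub IsCoalgHom.id)
    have e : 0 - (P - LinearMap.id) = LinearMap.id - P := by abel
    rwa [e] at this
  refine h1.ext h2 hP IsCoalgHom.id ?_
  rw [LinearMap.comp_add, ← LinearMap.comp_assoc, ← LinearMap.comp_assoc, hDp, hHp,
    LinearMap.comp_assoc, LinearMap.comp_assoc, hDp, hHp, LinearMap.comp_sub, hPdef, pr_tmap]
  refine LinearMap.ext fun t => ?_
  simp only [LinearMap.add_apply, LinearMap.comp_apply, LinearMap.sub_apply, LinearMap.id_apply]
  have := C.homotopy (pr k A t)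
  rw [eq_sub_iff_add_eq, add_comm, ← add_assoc]
  exact this

end Transfer


/-! ### The obstruction equation of homotopy transfer -/

section TransferExistence

open TensorAlgebra TensorProduct

variable {k : Type u} [Field k]

namespace AInfAlgebra

/-- The differential of the tensor coalgebra that extends `d₁`. -/
noncomputable def linDiff (A : AInfAlgebra.{u, v} k) : TensorAlgebra k A →ₗ[k] TensorAlgebra k A :=
  coder A.tkoszul LinearMap.id (A.d₁ ∘ₗ pr k A)

theorem isCoder_linDiff (A : AInfAlgebra.{u, v} k) : IsCoder A.tkoszul LinearMap.id A.linDiff :=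
  isCoder_coder A.isCoalgHom_tkoszul IsCoalgHom.id (by simp)

theorem pr_linDiff (A : AInfAlgebra.{u, v} k) : pr k A ∘ₗ A.linDiff = A.d₁ ∘ₗ pr k A :=
  pr_coder A.isCoalgHom_tkoszul IsCoalgHom.id _

theorem linDeg_d₁ (A : AInfAlgebra.{u, v} k) :
    LinDeg (V := A.toGradedSpace) (W := A.toGradedSpace) 1 A.d₁ := by
  intro i x hx
  have h : A.d₁ x ∈ A.deg (i + 1 + 1) := A.d₁_mem hx
  exact h

theorem linDiff_comp_linDiff (A : AInfAlgebra.{u, v} k) : A.linDiff ∘ₗ A.linDiff = 0 := by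
  have hodd := odd_coder A.isCoder_linDiff odd_one
    (by rw [pr_linDiff]; exact A.linDeg_d₁.hasDeg)
  refine (A.isCoder_linDiff.sq hodd).ext (IsCoder.zero _ _) IsCoalgHom.id IsCoalgHom.id ?_
  rw [← LinearMap.comp_assoc, pr_linDiff, LinearMap.comp_assoc, pr_linDiff]
  refine LinearMap.ext fun t => ?_
  simp [d₁_d₁]

namespace Contraction

variable {A : AInfAlgebra.{u, v} k} (C : A.Contraction)

theorem linDiff_comp_tmap_i : A.linDiff ∘ₗ tmap C.i = 0 := by
  have hJ := isCoalgHom_tmap (k := k) C.i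
  refine (A.isCoder_linDiff.comp_hom hJ).ext (IsCoder.zero _ _)
    (A.isCoalgHom_tkoszul.comp hJ) (IsCoalgHom.id.comp hJ) ?_
  rw [← LinearMap.comp_assoc, pr_linDiff, LinearMap.comp_assoc, pr_tmap]
  refine LinearMap.ext fun t => ?_
  simp [C.d_i]

theorem tmap_π_comp_linDiff : tmap C.π ∘ₗ A.linDiff = 0 := by
  have hJ := isCoalgHom_tmap (k := k) C.π
  refine (A.isCoder_linDiff.hom_comp hJ).ext (IsCoder.zero _ _)
    (hJ.comp A.isCoalgHom_tkoszul) (hJ.comp IsCoalgHom.id) ?_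
  rw [← LinearMap.comp_assoc, pr_tmap, LinearMap.comp_assoc, pr_linDiff]
  refine LinearMap.ext fun t => ?_
  simp [C.π_d]

theorem tmap_π_comp_tmap_i : tmap (k := k) C.π ∘ₗ tmap C.i = LinearMap.id := by
  rw [← tmap_comp, ← tmap_id]
  congr 1
  exact LinearMap.ext C.π_i

theorem linDeg_iπ : LinDeg (V := A.toGradedSpace) (W := A.toGradedSpace) 0 (C.i ∘ₗ C.π) := by
  intro i x hx
  have h1 := C.linDeg_π i x hx
  have h2 := C.linDeg_i _ _ h1
  simpa using h2

/-- The extension to the tensor coalgebra of the homotopy of a contraction. -/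
noncomputable def hExt : TensorAlgebra k A →ₗ[k] TensorAlgebra k A :=
  coder (A.tkoszul ∘ₗ tmap (C.i ∘ₗ C.π)) LinearMap.id (C.h ∘ₗ pr k A)

theorem isCoder_hExt : IsCoder (A.tkoszul ∘ₗ tmap (C.i ∘ₗ C.π)) LinearMap.id C.hExt :=
  isCoder_coder (A.isCoalgHom_tkoszul.comp (isCoalgHom_tmap _)) IsCoalgHom.id (by simp)

theorem pr_hExt : pr k A ∘ₗ C.hExt = C.h ∘ₗ pr k A :=
  pr_coder (A.isCoalgHom_tkoszul.comp (isCoalgHom_tmap _)) IsCoalgHom.id _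

theorem preservesFil_hExt : PreservesFil C.hExt :=
  C.isCoder_hExt.preservesFil (A.isCoalgHom_tkoszul.comp (isCoalgHom_tmap _)) IsCoalgHom.id

theorem hExt_ι (x : A) : C.hExt (ι k x) = ι k (C.h x) := by
  rw [C.isCoder_hExt.apply_ι (A.isCoalgHom_tkoszul.comp (isCoalgHom_tmap _)) IsCoalgHom.id,
    ← LinearMap.comp_apply (pr k A), pr_hExt]
  simp

theorem tdeg_hExt : A.tdeg ∘ₗ C.hExt = C.hExt ∘ₗ A.tdeg + ((-1 : ℤ) : k) • C.hExt := by
  refine C.isCoder_hExt.tdeg_comp (A.isCoalgHom_tkoszul.comp (isCoalgHom_tmap _)) IsCoalgHom.id ?_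
    hasDeg_pr_id (by rw [pr_hExt]; exact C.linDeg_h.hasDeg)
  have e : pr k A ∘ₗ A.tkoszul ∘ₗ tmap (C.i ∘ₗ C.π) =
      A.koszul ∘ₗ pr k A ∘ₗ tmap (C.i ∘ₗ C.π) := by
    rw [← LinearMap.comp_assoc, GradedSpace.tkoszul, pr_tmap, LinearMap.comp_assoc]
  rw [e]
  exact linDeg_koszul.comp_hasDeg (hasDeg_pr_tmap C.linDeg_iπ)

/-- The corestriction of the transferred map of bar constructions, for a given obstruction `o`. -/
noncomputable def homOf (o : TensorAlgebra k A →ₗ[k] A) : TensorAlgebra k A →ₗ[k] A :=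
  pr k A + trunc (o ∘ₗ C.hExt - C.h ∘ₗ o ∘ₗ tmap (C.i ∘ₗ C.π))

/-- The transferred operations on cohomology, for a given obstruction `o`. -/
noncomputable def opsOf (o : TensorAlgebra k A →ₗ[k] A) :
    TensorAlgebra k A.HSpace →ₗ[k] A.HSpace.carrier :=
  trunc (C.π ∘ₗ o ∘ₗ tmap C.i)

/-- The coderivation given by the transferred operations. -/
noncomputable def pertOf (o : TensorAlgebra k A →ₗ[k] A) :
    TensorAlgebra k A →ₗ[k] TensorAlgebra k A :=
  coder A.tkoszul LinearMap.id (C.i ∘ₗ C.opsOf o ∘ₗ tmap C.π)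

variable {C} {o : TensorAlgebra k A →ₗ[k] A}

theorem homOf_one (h1 : o 1 = 0) : C.homOf o 1 = 0 := by
  simp [homOf, C.isCoder_hExt.map_one, (isCoalgHom_tmap (k := k) (C.i ∘ₗ C.π)).map_one, h1]

theorem homOf_ι (x : A) : C.homOf o (ι k x) = x := by simp [homOf]

theorem opsOf_one (h1 : o 1 = 0) : C.opsOf o 1 = 0 := by
  simp [opsOf, (isCoalgHom_tmap (k := k) C.i).map_one, h1]

theorem opsOf_ι (z : A.HSpace.carrier) : C.opsOf o (ι k z) = 0 := by simp [opsOf]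

theorem isCoder_pertOf (h1 : o 1 = 0) : IsCoder A.tkoszul LinearMap.id (C.pertOf o) :=
  isCoder_coder A.isCoalgHom_tkoszul IsCoalgHom.id
    (by simp [(isCoalgHom_tmap (k := k) C.π).map_one, opsOf_one h1])

theorem pr_pertOf : pr k A ∘ₗ C.pertOf o = C.i ∘ₗ C.opsOf o ∘ₗ tmap C.π :=
  pr_coder A.isCoalgHom_tkoszul IsCoalgHom.id _

theorem pr_pertOf_ι (x : A) : pr k A (C.pertOf o (ι k x)) = 0 := by
  have h : pr k A (C.pertOf o (ι k x)) = C.i (C.opsOf o (tmap C.π (ι k x))) :=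
    LinearMap.congr_fun pr_pertOf _
  rw [h, tmap_ι]
  exact (congrArg C.i (opsOf_ι (C.π x))).trans (map_zero _)

theorem lowersFil_pertOf (h1 : o 1 = 0) : LowersFil (C.pertOf o) :=
  (isCoder_pertOf h1).word_mem_of_decreasing A.isCoalgHom_tkoszul IsCoalgHom.id pr_pertOf_ι

theorem hasDeg_homOf [CharZero k] (h1 : HasDeg (V := A.toGradedSpace) (W := A.toGradedSpace) 1 o) :
    HasDeg (V := A.toGradedSpace) (W := A.toGradedSpace) 0 (C.homOf o) :=
  HasDeg.add hasDeg_pr_id (HasDeg.trunc (HasDeg.sub (h1.comp C.tdeg_hExt)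
    (C.linDeg_h.comp_hasDeg (h1.comp_even
      ((isCoalgHom_tmap _).tdeg_comp (hasDeg_pr_tmap C.linDeg_iπ))))))

theorem hasDeg_opsOf [CharZero k] (h1 : HasDeg (V := A.toGradedSpace) (W := A.toGradedSpace) 1 o) :
    HasDeg (V := A.HSpace) (W := A.HSpace) 1 (C.opsOf o) := by
  have h2 : A.tdeg ∘ₗ tmap C.i = tmap C.i ∘ₗ A.HSpace.tdeg :=
    (isCoalgHom_tmap C.i).tdeg_comp (V := A.HSpace) (hasDeg_pr_tmap C.linDeg_i)
  have h3 := h1.comp_even h2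
  have h4 := C.linDeg_π.comp_hasDeg (V := A.HSpace) h3
  exact HasDeg.trunc (V := A.HSpace) (W := A.HSpace) h4

theorem hasDeg_pr_pertOf [CharZero k]
    (h1 : HasDeg (V := A.toGradedSpace) (W := A.toGradedSpace) 1 o) :
    HasDeg (V := A.toGradedSpace) (W := A.toGradedSpace) 1 (pr k A ∘ₗ C.pertOf o) := by
  rw [pr_pertOf]
  exact C.linDeg_i.comp_hasDeg ((hasDeg_opsOf h1).comp_even ((isCoalgHom_tmap _).tdeg_comp
    (hasDeg_pr_tmap C.linDeg_π)))

theorem eqBelow_homOf {o' : TensorAlgebra k A →ₗ[k] A} {n : ℕ} (h : EqBelow n o o') :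
    EqBelow n (C.homOf o) (C.homOf o') :=
  EqBelow.rfl'.add (((h.comp C.preservesFil_hExt).sub
    ((h.comp (isCoalgHom_tmap _).preservesFil).comp_left _)).trunc)

theorem eqBelow_pr_pertOf {o' : TensorAlgebra k A →ₗ[k] A} {n : ℕ} (h : EqBelow n o o') :
    EqBelow n (pr k A ∘ₗ C.pertOf o) (pr k A ∘ₗ C.pertOf o') := by
  rw [pr_pertOf, pr_pertOf]
  exact EqBelow.comp_left (EqBelow.comp (EqBelow.trunc ((h.comp
    (isCoalgHom_tmap _).preservesFil).comp_left _)) (isCoalgHom_tmap _).preservesFil) _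

/-- The unknown `o` collects the nonlinear part of the defect of the transferred map, while `homOf
o` and `opsOf o` are in turn obtained from `o` by the contraction. The equation is contractive:
truncations gain one unit of length, and `pertOf` lowers length. -/
theorem exists_obstruction [CharZero k] (C : A.Contraction) : ∃ o : TensorAlgebra k A →ₗ[k] A,
    HasDeg (V := A.toGradedSpace) (W := A.toGradedSpace) 1 o ∧ o 1 = 0 ∧ (∀ x, o (ι k x) = 0) ∧
      trunc A.corestr ∘ₗ cohom (C.homOf o) - trunc (C.homOf o) ∘ₗ C.pertOf o = o := by
  obtain ⟨o, ⟨hd, h1⟩, ho⟩ := exists_fixedPoint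
    (fun o => trunc A.corestr ∘ₗ cohom (C.homOf o) - trunc (C.homOf o) ∘ₗ C.pertOf o)
    (fun o => HasDeg (V := A.toGradedSpace) (W := A.toGradedSpace) 1 o ∧ o 1 = 0)
    ⟨hasDeg_zero 1, rfl⟩
    (fun f h => ⟨hasDeg_of_eqBelow fun n => let ⟨g, hg, hfg⟩ := h n; ⟨g, hg.1, hfg⟩, by
      obtain ⟨g, hg, hfg⟩ := h 1
      have := hfg [] (by simp)
      simpa [hg.2] using this⟩)
    (fun o ⟨hd, h1⟩ => ⟨HasDeg.sub
      ((A.hasDeg_corestr.trunc).comp_even ((isCoalgHom_cohom (homOf_one h1)).tdeg_comp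
        (by rw [pr_cohom (homOf_one h1)]; exact hasDeg_homOf hd)))
      ((hasDeg_homOf hd).trunc.comp
        (coder_tdeg_comp (isCoder_pertOf h1) (hasDeg_pr_pertOf hd))), by
      simp [(isCoalgHom_cohom (homOf_one (C := C) h1)).map_one,
        (isCoder_pertOf (C := C) h1).map_one, corestr_one]⟩)
    (fun n o o' ⟨_, h1⟩ ⟨_, h1'⟩ h => by
      refine EqBelow.sub ?_ ?_
      · refine (isCoalgHom_cohom (homOf_one h1)).trunc_comp_eqBelow
          (isCoalgHom_cohom (homOf_one h1')) ?_ _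
        rw [pr_cohom (homOf_one h1), pr_cohom (homOf_one h1')]
        exact eqBelow_homOf h
      -- Change one factor at a time: varying `pertOf` gains a unit through the truncation, and
      -- varying `homOf` gains one because `pertOf` lowers length.
      · exact ((isCoder_pertOf h1).trunc_comp_eqBelow (isCoder_pertOf h1') A.isCoalgHom_tkoszul
          IsCoalgHom.id (eqBelow_pr_pertOf h) _).trans
          ((eqBelow_homOf h).trunc.comp_lowers (lowersFil_pertOf h1')))
  refine ⟨o, hd, h1, fun x => ?_, ho⟩
  rw [← ho]
  have e : C.pertOf o (ι k x) = 0 := by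
    rw [(isCoder_pertOf h1).apply_ι A.isCoalgHom_tkoszul IsCoalgHom.id, pr_pertOf_ι, map_zero]
  rw [LinearMap.sub_apply, LinearMap.comp_apply, LinearMap.comp_apply, e, map_zero,
    (isCoalgHom_cohom (homOf_one h1)).apply_ι, trunc_ι, sub_zero]

end Contraction

end AInfAlgebra

end TransferExistence


/-! ### The transfer theorem -/

section TransferTheorem

open TensorAlgebra TensorProduct

variable {k : Type u} [Field k]

namespace AInfAlgebra

set_option maxHeartbeats 1000000 in
/-- The homotopy transfer theorem for the cohomology of an `A∞`-algebra. -/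
theorem exists_transfer [CharZero k] (A : AInfAlgebra.{u, v} k) : Nonempty A.Transfer := by
  obtain ⟨C⟩ := A.exists_contraction
  obtain ⟨o, hd, ho1, hoι, hfix⟩ := Contraction.exists_obstruction C
  set J := tmap (k := k) C.i with hJdef
  set Q := tmap (k := k) C.π with hQdef
  set P := tmap (k := k) (C.i ∘ₗ C.π) with hPdef
  have hP : ∀ t, P t = J (Q t) := LinearMap.congr_fun (tmap_comp C.i C.π)
  have hQJ : ∀ t, Q (J t) = t := LinearMap.congr_fun C.tmap_π_comp_tmap_i
  set D₁ := A.linDiff with hD₁def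
  have hDJ : ∀ t, D₁ (J t) = 0 := LinearMap.congr_fun C.linDiff_comp_tmap_i
  have hQD : ∀ t, Q (D₁ t) = 0 := LinearMap.congr_fun C.tmap_π_comp_linDiff
  have hDD₁ : ∀ t, D₁ (D₁ t) = 0 := LinearMap.congr_fun A.linDiff_comp_linDiff
  have hDP : ∀ t, D₁ (P t) = 0 := fun t => by rw [hP, hDJ]
  have hPD : ∀ t, P (D₁ t) = 0 := fun t => by rw [hP, hQD, map_zero]
  set H := C.hExt with hHdef
  have hH : ∀ t, D₁ (H t) + H (D₁ t) = t - P t := LinearMap.congr_fun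
    (tensor_homotopy C A.isCoder_linDiff A.pr_linDiff C.isCoder_hExt C.pr_hExt A.linDeg_d₁
      (LinearMap.ext hDP) (LinearMap.ext hPD))
  set ψ := C.homOf o with hψdef
  have hψ1 : ψ 1 = 0 := Contraction.homOf_one ho1
  have hψd : HasDeg (V := A.toGradedSpace) (W := A.toGradedSpace) 0 ψ := Contraction.hasDeg_homOf hd
  have hψι : ∀ x, ψ (ι k x) = x := Contraction.homOf_ι
  have hψ : ∀ t, ψ t = pr k A t + (o (H t) - C.h (o (P t))) := by
    intro t
    have : trunc (o ∘ₗ H - C.h ∘ₗ o ∘ₗ P) = o ∘ₗ H - C.h ∘ₗ o ∘ₗ P := by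
      refine sub_eq_self.2 (LinearMap.ext fun t => ?_)
      simp only [LinearMap.comp_apply, LinearMap.sub_apply, hHdef, Contraction.hExt_ι, hPdef,
        tmap_ι, hoι]
      simp
    rw [hψdef, Contraction.homOf, ← hHdef, ← hPdef, this]
    rfl
  set m := C.opsOf o with hmdef
  have hm1 : m 1 = 0 := Contraction.opsOf_one ho1
  have hm : ∀ t, m t = C.π (o (J t)) := by
    intro t
    have : trunc (C.π ∘ₗ o ∘ₗ J) = C.π ∘ₗ o ∘ₗ J := by
      refine sub_eq_self.2 (LinearMap.ext fun t => ?_)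
      simp only [LinearMap.comp_apply, hJdef, tmap_ι, hoι]
      exact map_zero _
    rw [hmdef, Contraction.opsOf, ← hJdef, this]
    rfl
  set E := C.pertOf o with hEdef
  have hE : IsCoder A.tkoszul LinearMap.id E := Contraction.isCoder_pertOf ho1
  have hEp : ∀ t, pr k A (E t) = C.i (m (Q t)) := LinearMap.congr_fun Contraction.pr_pertOf
  set Ψ := cohom ψ with hΨdef
  have hΨ : IsCoalgHom Ψ := isCoalgHom_cohom hψ1
  have hΨp : pr k A ∘ₗ Ψ = ψ := pr_cohom hψ1
  have hΨι : ∀ x, Ψ (ι k x) = ι k x := fun x => by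
    rw [hΨ.apply_ι]
    exact congrArg _ ((LinearMap.congr_fun hΨp _).trans (Contraction.homOf_ι x))
  have hΨκ : A.tkoszul ∘ₗ Ψ = Ψ ∘ₗ A.tkoszul := hΨ.tkoszul_comp (by rw [hΨp]; exact hψd)
  set D' := D₁ + E with hD'def
  have hD' : IsCoder A.tkoszul LinearMap.id D' := A.isCoder_linDiff.add hE
  have hD'p : ∀ t, pr k A (D' t) = A.d₁ (pr k A t) + C.i (m (Q t)) := fun t => by
    have := LinearMap.congr_fun A.pr_linDiff t
    rw [hD'def, LinearMap.add_apply, map_add, hEp]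
    exact congrArg₂ _ this rfl
  have hD'd : HasDeg (V := A.toGradedSpace) (W := A.toGradedSpace) 1 (pr k A ∘ₗ D') := by
    rw [hD'def, LinearMap.comp_add]
    exact HasDeg.add (by rw [hD₁def, pr_linDiff]; exact A.linDeg_d₁.hasDeg)
      (Contraction.hasDeg_pr_pertOf hd)
  set M := coder A.HSpace.tkoszul LinearMap.id m with hMdef
  have hM : IsCoder A.HSpace.tkoszul LinearMap.id M :=
    isCoder_coder A.HSpace.isCoalgHom_tkoszul IsCoalgHom.id hm1
  have hMp : ∀ t, pr k A.HSpace (M t) = m t :=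
    LinearMap.congr_fun (pr_coder A.HSpace.isCoalgHom_tkoszul IsCoalgHom.id _)
  have hQ : IsCoalgHom Q := isCoalgHom_tmap _
  have hQM : ∀ t, Q (D' t) = M (Q t) := by
    have h1 := hD'.hom_comp hQ
    have h2 := hM.comp_hom hQ
    have hκ : A.HSpace.tkoszul ∘ₗ Q = Q ∘ₗ A.tkoszul :=
      hQ.tkoszul_comp (W := A.HSpace) (hasDeg_pr_tmap C.linDeg_π)
    rw [hκ] at h2
    refine LinearMap.congr_fun (h1.ext h2 (hQ.comp A.isCoalgHom_tkoszul) hQ ?_)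
    refine LinearMap.ext fun t => ?_
    have h3 : ∀ s, pr k A.HSpace (Q s) = C.π (pr k A s) := LinearMap.congr_fun (pr_tmap C.π)
    simp only [LinearMap.comp_apply]
    rw [h3, hD'p, map_add, C.π_d, C.π_i, zero_add, hMp]
  have hY : IsCoder LinearMap.id LinearMap.id (D' ∘ₗ D') := hD'.sq (odd_coder hD' odd_one hD'd)
  have hYp : ∀ t, pr k A (D' (D' t)) = C.i (m (M (Q t))) := fun t => by
    rw [hD'p, hD'p, map_add, d₁_d₁, C.d_i, hQM, zero_add, zero_add]
  -- `X` measures the failure of `Ψ` to intertwine the codifferentials. It is a coderivation, so its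
  -- vanishing can be tested on corestrictions, length by length.
  set X := A.codiff ∘ₗ Ψ - Ψ ∘ₗ D' with hXdef
  have hX : IsCoder (A.tkoszul ∘ₗ Ψ) Ψ X := by
    have h1 := A.isCoder_codiff.comp_hom hΨ
    have h2 := hD'.hom_comp hΨ
    rw [← hΨκ] at h2
    exact h1.sub h2
  have hXp : ∀ t, pr k A (X t) = A.d₁ (ψ t) - ψ (D₁ t) - C.i (m (Q t)) + o t := by
    intro t
    have e1 : pr k A (A.codiff (Ψ t)) = A.d₁ (ψ t) + trunc A.corestr (Ψ t) := by
      have h1 := LinearMap.congr_fun A.pr_codiff (Ψ t)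
      have h2 := LinearMap.congr_fun (comp_eq_add_trunc_comp A.corestr Ψ) t
      rw [hΨp] at h2
      rw [LinearMap.comp_apply] at h1
      rw [h1]
      simpa only [LinearMap.comp_apply, LinearMap.add_apply, corestr_ι] using h2
    have e2 : ∀ s, pr k A (Ψ s) = ψ s := LinearMap.congr_fun hΨp
    have e3 : ψ (E t) = C.i (m (Q t)) + trunc ψ (E t) := by
      have h2 := LinearMap.congr_fun (comp_eq_add_trunc_comp ψ E) t
      simp only [LinearMap.comp_apply, LinearMap.add_apply, hEp] at h2
      rw [h2]
      congr 1
      exact hψι _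
    have e4 : trunc A.corestr (Ψ t) - trunc ψ (E t) = o t := LinearMap.congr_fun hfix t
    rw [hXdef, LinearMap.sub_apply, map_sub, LinearMap.comp_apply, LinearMap.comp_apply, e1, e2,
      hD'def, LinearMap.add_apply, map_add, e3, ← e4]
    abel
  -- A Bianchi identity, from the vanishing of the square of `A.codiff`. At this point `D'` is not
  -- yet known to square to zero.
  have hDX : ∀ t, A.codiff (X t) + X (D' t) + Ψ (D' (D' t)) = 0 := by
    intro t
    have h : ∀ s, A.codiff (A.codiff s) = 0 := LinearMap.congr_fun A.codiff_comp_codiff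
    simp only [hXdef, LinearMap.sub_apply, LinearMap.comp_apply, map_sub, h]
    abel
  have hmι : ∀ z, m (ι k z) = 0 := Contraction.opsOf_ι
  have hmd : HasDeg (V := A.HSpace) (W := A.HSpace) 1 m := Contraction.hasDeg_opsOf hd
  have hEl : LowersFil E := Contraction.lowersFil_pertOf ho1
  have hHf : PreservesFil H := C.preservesFil_hExt
  have hDp : ∀ t, pr k A (D₁ t) = A.d₁ (pr k A t) := LinearMap.congr_fun A.pr_linDiff
  clear_value X M D' Ψ E m ψ H D₁
  -- The defect `X` and the square of `D'` are shown to vanish together, by induction on the length.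
  have key : ∀ n, EqBelow n X 0 ∧ EqBelow n (D' ∘ₗ D') 0 := by
    intro n
    induction n with
    | zero =>
      exact ⟨fun l hl => absurd hl (Nat.not_lt_zero _), fun l hl => absurd hl (Nat.not_lt_zero _)⟩
    | succ n ih =>
      obtain ⟨ihX, ihY⟩ := ih
      -- By the induction hypotheses the values of `X` and `D' ∘ D'` on such words are letters, and
      -- `X` kills the values of the length-lowering `E`. Projecting the Bianchi identity leaves a
      -- closedness equation for `o`, up to the square of the transferred structure.
      have h1 : ∀ l : List A, l.length < n + 1 →
          A.d₁ (o (word k l)) + o (D₁ (word k l)) + C.i (m (M (Q (word k l)))) = 0 := by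
        intro l hl
        have a1 := hX.leading (A.isCoalgHom_tkoszul.comp hΨ) hΨ ihX l hl
        have a2 : X (E (word k l)) = 0 :=
          ihX.comp_lowers hEl l hl
        have a3 := hY.leading IsCoalgHom.id IsCoalgHom.id ihY l hl
        have a4 := congrArg (pr k A) (hDX (word k l))
        simp only [LinearMap.comp_apply] at a1 a3
        have a6 : X (D' (word k l)) = X (D₁ (word k l)) := by
          rw [hD'def, LinearMap.add_apply, map_add, a2, add_zero]
        rw [a6, a3, hΨι, a1, map_add, map_add, pr_ι, hYp, map_zero] at a4
        have a5 := LinearMap.congr_fun A.pr_codiff (ι k (pr k A (X (word k l))))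
        rw [LinearMap.comp_apply, corestr_ι] at a5
        rw [a5, hXp, hXp, hQD, hDD₁, map_add, map_sub, map_sub, d₁_d₁, C.d_i, map_zero, map_zero,
          map_zero] at a4
        rw [← a4]
        abel
      -- Restricted along `i` and projected by `π`, the terms with `d₁` or `D₁` disappear, which
      -- isolates the square of the transferred structure.
      have h2 : ∀ l : List A.HSpace.carrier, l.length < n + 1 → m (M (word k l)) = 0 := by
        intro l hl
        have := congrArg C.π (h1 (l.map C.i) (by simpa using hl))
        rw [← tmap_word, ← hJdef, hDJ, map_zero, add_zero, map_add, C.π_d, hQJ, zero_add, C.π_i,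
          map_zero] at this
        exact this
      have h3 : ∀ l : List A, l.length < n + 1 → C.i (m (M (Q (word k l)))) = 0 := by
        intro l hl
        rw [hQdef, tmap_word, h2 _ (by simpa using hl), map_zero]
      have h4 : EqBelow (n + 1) (A.d₁ ∘ₗ o) (-(o ∘ₗ D₁)) := by
        intro l hl
        have := h1 l hl
        rw [h3 l hl, add_zero] at this
        exact eq_neg_of_add_eq_zero_left this
      have h4P := h4.comp (isCoalgHom_tmap (k := k) (C.i ∘ₗ C.π)).preservesFil
      have h4H := h4.comp hHf
      refine ⟨hX.eqBelow_zero (A.isCoalgHom_tkoszul.comp hΨ) hΨ ?_,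
        hY.eqBelow_zero IsCoalgHom.id IsCoalgHom.id ?_⟩
      · intro l hl
        have b1 : A.d₁ (o (P (word k l))) = 0 := by
          refine (h4P l hl).trans ?_
          simp only [LinearMap.comp_apply, LinearMap.neg_apply]
          rw [← hPdef, hDP, map_zero, neg_zero]
        have b2 : A.d₁ (o (H (word k l))) = - o (D₁ (H (word k l))) := h4H l hl
        -- The tensor homotopy turns the `o H` part of `ψ` into `-o + o P`, and the homotopy on `A`
        -- turns the remaining terms into `-o P`. Together they cancel the term `o` of the defect.
        have b3 := congrArg o (hH (word k l))
        rw [map_add, map_sub] at b3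
        have b4 := C.homotopy (o (P (word k l)))
        rw [b1, map_zero, add_zero] at b4
        rw [LinearMap.comp_apply, hXp, hψ, hψ, hPD, map_zero, map_zero, sub_zero, hm, ← hP, map_add,
          map_sub, b2, hDp, LinearMap.zero_apply]
        rw [← sub_eq_zero] at b3 b4
        have b6 := congrArg₂ (fun x y => - x - y) b3 b4
        simp only [sub_zero, neg_zero] at b6
        rw [← b6]
        abel
      · intro l hl
        rw [LinearMap.comp_apply, LinearMap.comp_apply, hYp, h3 l hl]
        rfl
  have hX0 : X = 0 := eq_of_eqBelow fun n => (key n).1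
  have hY0 : D' ∘ₗ D' = 0 := eq_of_eqBelow fun n => (key n).2
  refine ⟨⟨C, m, Ψ, hm1, hmι, hmd, ?_, hΨ,
    by rw [hΨp]; exact hψd, hΨι, ?_⟩⟩
  · refine LinearMap.ext fun t => ?_
    have := hYp (J t)
    rw [hQJ, ← LinearMap.comp_apply D', hY0, LinearMap.zero_apply, map_zero] at this
    have := congrArg C.π this.symm
    rw [C.π_i, map_zero] at this
    rw [← hMdef]
    exact this
  · rw [← sub_eq_zero]
    have e : D' = coder A.tkoszul LinearMap.id (A.d₁ ∘ₗ pr k A + C.i ∘ₗ m ∘ₗ Q) := by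
      refine hD'.ext (isCoder_coder A.isCoalgHom_tkoszul IsCoalgHom.id ?_) A.isCoalgHom_tkoszul
        IsCoalgHom.id ?_
      · simp [hQ.map_one, hm1]
      · rw [pr_coder A.isCoalgHom_tkoszul IsCoalgHom.id]
        exact LinearMap.ext hD'p
    rw [← e, ← hXdef]
    exact hX0

end AInfAlgebra

end TransferTheorem


/-! ### Euler derivations -/

section Euler

open TensorAlgebra TensorProduct

variable {k : Type u} [Field k]

/-- Maps of tensor algebras that preserve the total degree. -/
def PreservesDeg (V : GradedSpace.{u, v} k) (W : GradedSpace.{u, w} k)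
    (L : TensorAlgebra k V →ₗ[k] TensorAlgebra k W) : Prop :=
  W.tdeg ∘ₗ L = L ∘ₗ V.tdeg

variable {V : GradedSpace.{u, v} k} {W : GradedSpace.{u, w} k} {X : GradedSpace.{u, x} k}

theorem PreservesDeg.comp {L : TensorAlgebra k W →ₗ[k] TensorAlgebra k X}
    {L' : TensorAlgebra k V →ₗ[k] TensorAlgebra k W} (h : PreservesDeg W X L)
    (h' : PreservesDeg V W L') : PreservesDeg V X (L ∘ₗ L') := by
  unfold PreservesDeg at *
  rw [← LinearMap.comp_assoc, h, LinearMap.comp_assoc, h', LinearMap.comp_assoc]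

theorem PreservesDeg.inverse {F : TensorAlgebra k V →ₗ[k] TensorAlgebra k W}
    {G : TensorAlgebra k W →ₗ[k] TensorAlgebra k V} (h : PreservesDeg V W F)
    (hFG : F ∘ₗ G = LinearMap.id) (hGF : G ∘ₗ F = LinearMap.id) : PreservesDeg W V G := by
  unfold PreservesDeg at *
  have h1 : (G ∘ₗ F) ∘ₗ V.tdeg ∘ₗ G = G ∘ₗ (F ∘ₗ V.tdeg) ∘ₗ G := rfl
  rw [hGF, ← h, LinearMap.id_comp, LinearMap.comp_assoc, hFG, LinearMap.comp_id] at h1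
  exact h1

theorem PreservesDeg.hasDeg_pr [CharZero k] {L : TensorAlgebra k V →ₗ[k] TensorAlgebra k W}
    (h : PreservesDeg V W L) : HasDeg 0 (pr k W ∘ₗ L) :=
  HasDeg.comp_even (linDeg_id.hasDeg (V := W)) h

theorem IsCoder.preservesDeg {D : TensorAlgebra k V →ₗ[k] TensorAlgebra k V}
    (hD : IsCoder LinearMap.id LinearMap.id D) (hd : HasDeg 0 (pr k V ∘ₗ D)) :
    PreservesDeg V V D := by
  have := hD.tdeg_comp IsCoalgHom.id IsCoalgHom.id hasDeg_pr_id hasDeg_pr_id hd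
  unfold PreservesDeg
  simpa using this

theorem PreservesDeg.tkoszul_comp [CharZero k] {D : TensorAlgebra k V →ₗ[k] TensorAlgebra k V}
    (h : PreservesDeg V V D) (hD : IsCoder LinearMap.id LinearMap.id D) :
    V.tkoszul ∘ₗ D = D ∘ₗ V.tkoszul :=
  hD.tkoszul_comp_even IsCoalgHom.id IsCoalgHom.id hasDeg_pr_id hasDeg_pr_id h.hasDeg_pr

/-- Commutation of an even coderivation with an odd one can be checked on corestrictions. -/
theorem eqBelow_comm [CharZero k] {D δ : TensorAlgebra k V →ₗ[k] TensorAlgebra k V}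
    (hD : IsCoder V.tkoszul LinearMap.id D) (hδ : IsCoder LinearMap.id LinearMap.id δ)
    (hδd : PreservesDeg V V δ) {n : ℕ}
    (h : EqBelow n ((pr k V ∘ₗ D) ∘ₗ δ) ((pr k V ∘ₗ δ) ∘ₗ D)) : EqBelow n (D ∘ₗ δ) (δ ∘ₗ D) := by
  have h1 := (IsCoder.comm hδ hδ hD (hδd.tkoszul_comp hδ).symm (by rw [LinearMap.comp_id,
    LinearMap.id_comp])).eqBelow_zero V.isCoalgHom_tkoszul IsCoalgHom.id (n := n) fun l hl => by
      have := h l hl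
      simp only [LinearMap.comp_apply] at this
      simp only [LinearMap.comp_apply, LinearMap.sub_apply, map_sub, this, sub_self,
        LinearMap.zero_apply]
  intro l hl
  exact (sub_eq_zero.1 (h1 l hl)).symm

/-- The endomorphism that multiplies the elements of `Vⁱ` by `i`. -/
noncomputable def GradedSpace.euler (V : GradedSpace.{u, v} k) : V →ₗ[k] V :=
  V.degOp + LinearMap.id

/-- The coderivation that extends the Euler endomorphism. -/
noncomputable def GradedSpace.teuler (V : GradedSpace.{u, v} k) :
    TensorAlgebra k V →ₗ[k] TensorAlgebra k V :=
  lder V.euler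

theorem isCoder_teuler (V : GradedSpace.{u, v} k) : IsCoder LinearMap.id LinearMap.id V.teuler :=
  isCoder_lder _

theorem linDeg_euler (V : GradedSpace.{u, v} k) : LinDeg 0 V.euler := by
  intro i x hx
  rw [GradedSpace.euler, LinearMap.add_apply, V.degOp_of_mem hx, add_zero]
  exact Submodule.add_mem _ (Submodule.smul_mem _ _ hx) hx

theorem LinDeg.euler_apply {g : V →ₗ[k] W} (hg : LinDeg 0 g) (x : V) :
    W.euler (g x) = g (V.euler x) := by
  suffices h : W.euler ∘ₗ g = g ∘ₗ V.euler from LinearMap.congr_fun h x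
  refine GradedSpace.hom_ext_sdeg fun i x hx => ?_
  have h1 := hg i x hx
  rw [add_zero] at h1
  simp only [LinearMap.comp_apply, GradedSpace.euler, LinearMap.add_apply, W.degOp_of_mem h1,
    V.degOp_of_mem hx, map_add, map_smul, LinearMap.id_apply]

theorem preservesDeg_teuler (V : GradedSpace.{u, v} k) : PreservesDeg V V V.teuler :=
  (isCoder_teuler V).preservesDeg (by
    rw [GradedSpace.teuler, pr_lder]
    exact (linDeg_euler V).hasDeg)

/-- The Euler endomorphism counts unsuspended degree, which exceeds the suspended degree by one for
each letter. -/
theorem teuler_word (l : List V) :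
    V.teuler (word k l) = V.tdeg (word k l) + (l.length : k) • word k l := by
  have h : V.teuler = V.tdeg + lder LinearMap.id := by
    refine (isCoder_teuler V).ext (V.isCoder_tdeg.add (isCoder_lder _)) IsCoalgHom.id
      IsCoalgHom.id ?_
    rw [LinearMap.comp_add, GradedSpace.teuler, GradedSpace.tdeg, pr_lder, pr_lder, pr_lder,
      GradedSpace.euler, LinearMap.add_comp]
  rw [h, LinearMap.add_apply, lder_id_word]

/-- The commutator with the Euler coderivation is the scalar `m + 1 - n` in arity `n`. It vanishes
only at `n = 2` for operations (`m = 1`) and only at `n = 1` for morphisms (`m = 0`), in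
characteristic `0`. -/
theorem HasDeg.euler_word {m : ℤ} {f : TensorAlgebra k V →ₗ[k] W} (hf : HasDeg m f) (l : List V) :
    W.euler (f (word k l)) = f (V.teuler (word k l)) + ((m : k) + 1 - l.length) • f (word k l) := by
  have h := LinearMap.congr_fun hf.degOp_comp (word k l)
  simp only [LinearMap.comp_apply, LinearMap.add_apply, LinearMap.smul_apply] at h
  rw [teuler_word, GradedSpace.euler, LinearMap.add_apply, h, map_add, map_smul, LinearMap.id_apply]
  module

/-- A coderivation whose linear part is the Euler endomorphism is conjugate to the Euler
coderivation. -/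
theorem exists_conj_teuler [CharZero k] {δ : TensorAlgebra k V →ₗ[k] TensorAlgebra k V}
    (hδ : IsCoder LinearMap.id LinearMap.id δ) (hd : PreservesDeg V V δ)
    (hlin : ∀ z, pr k V (δ (ι k z)) = V.euler z) :
    ∃ Φ : TensorAlgebra k V →ₗ[k] TensorAlgebra k V, IsCoalgHom Φ ∧ PreservesDeg V V Φ ∧
      (∀ z, pr k V (Φ (ι k z)) = z) ∧ δ ∘ₗ Φ = Φ ∘ₗ V.teuler := by
  set t := trunc (pr k V ∘ₗ δ) with htdef
  have ht1 : t 1 = 0 := by simp [htdef, hδ.map_one]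
  have htd : HasDeg 0 t := hd.hasDeg_pr.trunc
  have hcp : ∀ {φ : TensorAlgebra k V →ₗ[k] V}, HasDeg 0 φ → φ 1 = 0 →
      PreservesDeg V V (cohom φ) := fun hφ h1 =>
    (isCoalgHom_cohom h1).tdeg_comp (by rwa [pr_cohom h1])
  obtain ⟨φ, ⟨hφd, hφ1⟩, hφ⟩ := exists_fixedPoint
    -- On corestrictions the conjugation equation reads `(n - 1) • φₙ = t ∘ cohom φ` in arity `n`.
    -- In arity `1` the inverse takes its default value `0`; this is harmless, as both sides vanish
    -- there and `φ` is normalised by `pr`.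
    (fun φ => pr k V + glue fun n : ℕ => ((n : k) - 1)⁻¹ • (t ∘ₗ cohom φ))
    (fun φ => HasDeg 0 φ ∧ φ 1 = 0) ⟨hasDeg_zero 0, rfl⟩
    (fun f h => ⟨hasDeg_of_eqBelow fun n => let ⟨g, hg, hfg⟩ := h n; ⟨g, hg.1, hfg⟩, by
      obtain ⟨g, hg, hfg⟩ := h 1
      have := hfg [] (by simp)
      simpa [hg.2] using this⟩)
    (fun φ ⟨hφd, hφ1⟩ => by
      refine ⟨HasDeg.add hasDeg_pr_id fun l e hl => ?_, ?_⟩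
      · rw [glue_word]
        exact Submodule.smul_mem _ _ (htd.comp_even (hcp hφd hφ1) l e hl)
      · rw [LinearMap.add_apply, ← word_nil, glue_word]
        simp [(isCoalgHom_cohom hφ1).map_one, ht1])
    (fun n φ φ' ⟨_, h1⟩ ⟨_, h1'⟩ h => by
      refine EqBelow.rfl'.add fun l hl => ?_
      have := (isCoalgHom_cohom h1).trunc_comp_eqBelow (isCoalgHom_cohom h1')
        (by rwa [pr_cohom h1, pr_cohom h1']) (pr k V ∘ₗ δ) l hl
      rw [glue_word, glue_word, LinearMap.smul_apply, LinearMap.smul_apply, this])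
  have hΦ := isCoalgHom_cohom hφ1
  have hΦp : ∀ s, pr k V (cohom φ s) = φ s := LinearMap.congr_fun (pr_cohom hφ1)
  have htι : ∀ z, t (cohom φ (ι k z)) = 0 := fun z => by
    rw [hΦ.apply_ι, htdef, trunc_ι]
  have hφw : ∀ l : List V, φ (word k l) =
      pr k V (word k l) + ((l.length : k) - 1)⁻¹ • t (cohom φ (word k l)) := fun l => by
    conv_lhs => rw [← hφ]
    rw [LinearMap.add_apply, glue_word]
    rfl
  refine ⟨cohom φ, hΦ, hcp hφd hφ1, fun z => ?_, ?_⟩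
  · have h := hφw [z]
    have e : word k [z] = ι k z := by simp
    rw [e, htι, smul_zero, add_zero, pr_ι] at h
    rw [hΦp, h]
  · refine (hδ.comp_hom hΦ).ext ((isCoder_teuler V).hom_comp hΦ) hΦ hΦ ?_
    refine word_hom_ext fun l => ?_
    have h1 := LinearMap.congr_fun (comp_eq_add_trunc_comp (pr k V ∘ₗ δ) (cohom φ)) (word k l)
    simp only [LinearMap.comp_apply, LinearMap.add_apply, hlin, hΦp] at h1
    have h2 := hφd.euler_word l
    have h3 : ((l.length : k) - 1) • φ (word k l) = t (cohom φ (word k l)) := by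
      rw [hφw]
      by_cases hl : l.length = 1
      · obtain ⟨x, rfl⟩ := List.length_eq_one_iff.1 hl
        have e : word k [x] = ι k x := by simp
        rw [e, htι]
        simp
      · have : (l.length : k) - 1 ≠ 0 := by
          rw [sub_ne_zero]
          exact_mod_cast hl
        rw [pr_word_of_length hl, zero_add, smul_smul, mul_inv_cancel₀ this, one_smul]
    simp only [LinearMap.comp_apply, hΦp] at h1 h2 ⊢
    rw [h1, h2, ← htdef, ← h3]
    push_cast
    module

end Euler


/-! ### Moving coderivations between algebras and cohomology -/

section Descent

open TensorAlgebra TensorProduct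

variable {k : Type u} [Field k]

/-- Commutation on short words is preserved by conjugation. -/
theorem EqBelow.conj {V W : Type*} [AddCommGroup V] [Module k V] [AddCommGroup W] [Module k W]
    {D δ : TensorAlgebra k V →ₗ[k] TensorAlgebra k V}
    {D' : TensorAlgebra k W →ₗ[k] TensorAlgebra k W}
    {G : TensorAlgebra k V →ₗ[k] TensorAlgebra k W} {F : TensorAlgebra k W →ₗ[k] TensorAlgebra k V}
    {N : ℕ} (h : EqBelow N (D ∘ₗ δ) (δ ∘ₗ D)) (hF : PreservesFil F) (hG : D' ∘ₗ G = G ∘ₗ D)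
    (hDF : D ∘ₗ F = F ∘ₗ D') : EqBelow N (D' ∘ₗ G ∘ₗ δ ∘ₗ F) ((G ∘ₗ δ ∘ₗ F) ∘ₗ D') := by
  intro l hl
  have h1 := congrArg G (h.comp hF l hl)
  have h2 := LinearMap.congr_fun hG (δ (F (word k l)))
  have h3 := LinearMap.congr_fun hDF (word k l)
  simp only [LinearMap.comp_apply] at *
  rw [h2, h1, h3]

namespace AInfAlgebra

theorem linDeg_f₁ {A : AInfAlgebra.{u, v} k} {B : AInfAlgebra.{u, w} k} (f : Hom A B) :
    LinDeg (V := A.toGradedSpace) (W := B.toGradedSpace) 0 f.f₁ := by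
  have h := f.hasDeg_corestr.linDeg
  intro i x hx
  have := h i x hx
  rwa [LinearMap.comp_apply, f.corestr_ι] at this

theorem Contraction.cls_i {A : AInfAlgebra.{u, v} k} (C : A.Contraction) (z : A.HSpace.carrier) :
    A.cls (C.i z) (C.d_i z) = z := by
  rw [← C.π_cls, C.π_i]

theorem IsMinimal.d₁_eq {M : AInfAlgebra.{u, v} k} (hM : M.IsMinimal) (x : M) : M.d₁ x = 0 := by
  show M.d 1 _ = 0
  rw [show M.d 1 = 0 from hM]
  rfl

/-- A minimal algebra is its own cohomology, and `π` computes classes of cocycles. -/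
theorem isQuasiIso_iff {M : AInfAlgebra.{u, v} k} {B : AInfAlgebra.{u, w} k} (hM : M.IsMinimal)
    (C : B.Contraction) (q : Hom M B) :
    q.IsQuasiIso ↔ Function.Bijective fun x => C.π (q.f₁ x) := by
  have hc : Function.Bijective fun x => M.cls x (hM.d₁_eq x) := by
    constructor
    · intro x y hxy
      obtain ⟨z, hz⟩ := (Submodule.Quotient.eq _).1 hxy
      have hz : M.d₁ z = x - y := hz
      rw [hM.d₁_eq] at hz
      exact (sub_eq_zero.1 hz.symm)
    · intro z
      obtain ⟨x, hx, rfl⟩ := M.cls_surj z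
      exact ⟨x, rfl⟩
  have e : (fun x => C.π (q.f₁ x)) = HMap q.f₁ q.f₁_d₁ ∘ fun x => M.cls x (hM.d₁_eq x) := by
    funext x
    exact C.π_cls (q.f₁ x) (by rw [← q.f₁_d₁, hM.d₁_eq, map_zero])
  rw [e]
  exact (Function.Bijective.of_comp_iff _ hc).symm

/-- By `HasDeg.euler_word` the operation of arity `n` fails to commute by the factor `2 - n`. The
factor is zero for `n = 2`, and the operations of every other arity below `N` vanish. -/
theorem codiff_teuler {M : AInfAlgebra.{u, v} k} [CharZero k] (hM : M.IsMinimal) {N : ℕ}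
    (h : ∀ i, 3 ≤ i → i < N → M.d i = 0) :
    EqBelow N (M.codiff ∘ₗ M.teuler) (M.teuler ∘ₗ M.codiff) := by
  refine eqBelow_comm M.isCoder_codiff (isCoder_teuler _) (preservesDeg_teuler _) ?_
  intro l hl
  rw [GradedSpace.teuler, pr_lder, pr_codiff, LinearMap.comp_assoc, pr_codiff]
  have h1 := M.hasDeg_corestr.euler_word l
  rw [LinearMap.comp_apply, LinearMap.comp_apply, h1, GradedSpace.teuler, left_eq_add]
  have hz : M.d l.length = 0 → M.corestr (word k l) = 0 := fun h => by
    rw [corestr_word, op, evalWord, h]; rfl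
  rcases Nat.lt_trichotomy l.length 2 with h2 | h2 | h2
  · have : l.length = 0 ∨ l.length = 1 := by omega
    rw [hz, smul_zero]
    rcases this with h3 | h3
    · rw [h3, M.d_zero]
    · rw [h3]; exact hM
  · rw [h2]
    push_cast
    rw [show (1 : k) + 1 - 2 = 0 by norm_num, zero_smul]
  · rw [hz (h _ h2 hl), smul_zero]

/-! ### The split model of the bar construction -/

namespace Transfer

variable {A : AInfAlgebra.{u, v} k} (T : A.Transfer)

/-- The codifferential of the transferred structure on cohomology. -/
noncomputable def codiff : TensorAlgebra k A.HSpace →ₗ[k] TensorAlgebra k A.HSpace :=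
  coder A.HSpace.tkoszul LinearMap.id T.m

/-- The codifferential of the split model of the bar construction. -/
noncomputable def split : TensorAlgebra k A →ₗ[k] TensorAlgebra k A :=
  coder A.tkoszul LinearMap.id (A.d₁ ∘ₗ pr k A + T.i ∘ₗ T.m ∘ₗ tmap T.π)

theorem isCoder_codiff : IsCoder A.HSpace.tkoszul LinearMap.id T.codiff :=
  isCoder_coder A.HSpace.isCoalgHom_tkoszul IsCoalgHom.id T.m_one

theorem pr_codiff : pr k A.HSpace ∘ₗ T.codiff = T.m :=
  pr_coder A.HSpace.isCoalgHom_tkoszul IsCoalgHom.id _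

theorem isCoder_split : IsCoder A.tkoszul LinearMap.id T.split :=
  isCoder_coder A.isCoalgHom_tkoszul IsCoalgHom.id
    (by simp [(isCoalgHom_tmap (k := k) T.π).map_one, T.m_one])

theorem pr_split (t : TensorAlgebra k A) :
    pr k A (T.split t) = A.d₁ (pr k A t) + T.i (T.m (tmap T.π t)) :=
  LinearMap.congr_fun (pr_coder A.isCoalgHom_tkoszul IsCoalgHom.id _) t

theorem tmap_π_split : tmap T.π ∘ₗ T.split = T.codiff ∘ₗ tmap T.π := by
  have hQ : IsCoalgHom (tmap (k := k) T.π) := isCoalgHom_tmap _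
  have h1 := T.isCoder_split.hom_comp hQ
  have h2 := T.isCoder_codiff.comp_hom hQ
  have hκ : A.HSpace.tkoszul ∘ₗ tmap T.π = tmap T.π ∘ₗ A.tkoszul :=
    hQ.tkoszul_comp (W := A.HSpace) (hasDeg_pr_tmap T.linDeg_π)
  rw [hκ] at h2
  refine h1.ext h2 (hQ.comp A.isCoalgHom_tkoszul) hQ (LinearMap.ext fun t => ?_)
  have h3 : ∀ s, pr k A.HSpace (tmap T.π s) = T.π (pr k A s) := LinearMap.congr_fun (pr_tmap T.π)
  have h4 : ∀ s, pr k A.HSpace (T.codiff s) = T.m s := LinearMap.congr_fun T.pr_codiff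
  simp only [LinearMap.comp_apply]
  rw [h3, T.pr_split, map_add, T.π_d, T.π_i, zero_add, h4]

theorem split_tmap_i : T.split ∘ₗ tmap T.i = tmap T.i ∘ₗ T.codiff := by
  have hJ : IsCoalgHom (tmap (k := k) T.i) := isCoalgHom_tmap _
  have h1 := T.isCoder_split.comp_hom hJ
  have h2 := T.isCoder_codiff.hom_comp hJ
  have hκ : A.tkoszul ∘ₗ tmap T.i = tmap T.i ∘ₗ A.HSpace.tkoszul :=
    hJ.tkoszul_comp (V := A.HSpace) (hasDeg_pr_tmap T.linDeg_i)
  rw [hκ] at h1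
  refine h1.ext h2 (hJ.comp A.HSpace.isCoalgHom_tkoszul) hJ (LinearMap.ext fun t => ?_)
  have h3 : ∀ s, pr k A (tmap T.i s) = T.i (pr k A.HSpace s) := LinearMap.congr_fun (pr_tmap T.i)
  have h4 : ∀ s, pr k A.HSpace (T.codiff s) = T.m s := LinearMap.congr_fun T.pr_codiff
  have h5 : ∀ s, tmap T.π (tmap T.i s) = s := LinearMap.congr_fun T.tmap_π_comp_tmap_i
  simp only [LinearMap.comp_apply]
  rw [h3, h4, T.pr_split, h3, T.d_i, h5, zero_add]

/-- The linear part of `Ψ` is the identity, so `exists_inverse` applies with `g = id`. -/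
theorem exists_Ψ_inverse : ∃ Ψ' : TensorAlgebra k A →ₗ[k] TensorAlgebra k A, IsCoalgHom Ψ' ∧
    T.Ψ ∘ₗ Ψ' = LinearMap.id ∧ Ψ' ∘ₗ T.Ψ = LinearMap.id ∧ (∀ x, Ψ' (ι k x) = ι k x) ∧
    T.split ∘ₗ Ψ' = Ψ' ∘ₗ A.codiff ∧
    PreservesDeg A.toGradedSpace A.toGradedSpace Ψ' := by
  obtain ⟨Ψ', h1, h2, h3, h4⟩ := exists_inverse T.isCoalgHom_Ψ (g := LinearMap.id)
    (fun y => by rw [T.Ψ_ι, pr_ι]; rfl) (fun y => by rw [T.Ψ_ι, pr_ι]; rfl)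
  refine ⟨Ψ', h1, h2, h3, fun x => by rw [h1.apply_ι, h4]; rfl, ?_,
    PreservesDeg.inverse (T.isCoalgHom_Ψ.tdeg_comp T.hasDeg_Ψ) h2 h3⟩
  have e : (Ψ' ∘ₗ T.Ψ) ∘ₗ T.split ∘ₗ Ψ' = Ψ' ∘ₗ (T.Ψ ∘ₗ T.split) ∘ₗ Ψ' := rfl
  rw [h3, split, ← T.comm, LinearMap.comp_assoc, h2, LinearMap.comp_id, LinearMap.id_comp] at e
  exact e

theorem preservesDeg_Ψ : PreservesDeg A.toGradedSpace A.toGradedSpace T.Ψ :=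
  T.isCoalgHom_Ψ.tdeg_comp T.hasDeg_Ψ

theorem preservesDeg_tmap_π : PreservesDeg A.toGradedSpace A.HSpace (tmap T.π) :=
  (isCoalgHom_tmap (k := k) T.π).tdeg_comp (V := A.toGradedSpace) (W := A.HSpace)
    (hasDeg_pr_tmap T.linDeg_π)

theorem preservesDeg_tmap_i : PreservesDeg A.HSpace A.toGradedSpace (tmap T.i) :=
  (isCoalgHom_tmap (k := k) T.i).tdeg_comp (V := A.HSpace) (W := A.toGradedSpace)
    (hasDeg_pr_tmap T.linDeg_i)

end Transfer

/-- A minimal model with vanishing operations gives a coderivation of the transferred structure on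
cohomology which extends the Euler endomorphism. -/
theorem Transfer.exists_coder_of_minimalModel [CharZero k] {B : AInfAlgebra.{u, w} k}
    (T : B.Transfer) {M : AInfAlgebra.{u, v} k} (hM : M.IsMinimal) {q : Hom M B} (hq : q.IsQuasiIso)
    {S : Set ℕ} (hS : ∀ N ∈ S, ∀ i, 3 ≤ i → i < N → M.d i = 0) :
    ∃ δ : TensorAlgebra k B.HSpace →ₗ[k] TensorAlgebra k B.HSpace,
      IsCoder LinearMap.id LinearMap.id δ ∧ PreservesDeg B.HSpace B.HSpace δ ∧
      (∀ z, pr k B.HSpace (δ (ι k z)) = B.HSpace.euler z) ∧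
      ∀ N ∈ S, EqBelow N (T.codiff ∘ₗ δ) (δ ∘ₗ T.codiff) := by
  obtain ⟨Ψ', hΨ', -, -, hΨι, hΨs, hΨd⟩ := T.exists_Ψ_inverse
  -- The passage from `M` through `B` and its split model to cohomology. Its linear part is
  -- bijective because `q` is a quasi-isomorphism, so `U` is invertible and the Euler coderivation
  -- of `M` can be transported along it.
  let U : TensorAlgebra k M →ₗ[k] TensorAlgebra k B.HSpace := tmap T.π ∘ₗ Ψ' ∘ₗ q.bar
  have hU : IsCoalgHom U := (isCoalgHom_tmap _).comp (hΨ'.comp q.isCoalgHom_bar)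
  have hUd : PreservesDeg M.toGradedSpace B.HSpace U :=
    T.preservesDeg_tmap_π.comp (hΨd.comp (q.isCoalgHom_bar.tdeg_comp q.hasDeg_pr_bar))
  let g := LinearEquiv.ofBijective (T.π ∘ₗ q.f₁) ((isQuasiIso_iff hM T.toContraction q).1 hq)
  have hg : LinDeg (V := M.toGradedSpace) (W := B.HSpace) 0 (T.π ∘ₗ q.f₁) := by
    intro i x hx
    have h1 := T.linDeg_π _ _ (linDeg_f₁ q i x hx)
    simpa using h1
  have hUι : ∀ x, U (ι k x) = ι k (g x) := by
    intro x
    have h1 : q.bar (ι k x) = ι k (q.f₁ x) := by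
      rw [q.isCoalgHom_bar.apply_ι, ← q.corestr_ι, ← q.pr_bar]
      rfl
    show tmap T.π (Ψ' (q.bar (ι k x))) = _
    rw [h1, hΨι, tmap_ι]
    rfl
  obtain ⟨V, hV, hUV, hVU, hVι⟩ := exists_inverse hU (g := g.symm.toLinearMap)
    (fun y => by rw [hUι, pr_ι]; exact g.apply_symm_apply y)
    (fun x => by rw [hUι, pr_ι]; exact g.symm_apply_apply x)
  have hUM : U ∘ₗ M.codiff = T.codiff ∘ₗ U := by
    show tmap T.π ∘ₗ Ψ' ∘ₗ (q.bar ∘ₗ M.codiff) = T.codiff ∘ₗ U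
    have e : tmap T.π ∘ₗ Ψ' ∘ₗ (B.codiff ∘ₗ q.bar) = tmap T.π ∘ₗ (Ψ' ∘ₗ B.codiff) ∘ₗ q.bar := rfl
    rw [q.bar_comp_codiff, e, ← hΨs, LinearMap.comp_assoc, ← LinearMap.comp_assoc, T.tmap_π_split]
    rfl
  have hMV : M.codiff ∘ₗ V = V ∘ₗ T.codiff := by
    have e : (V ∘ₗ U) ∘ₗ M.codiff ∘ₗ V = V ∘ₗ (U ∘ₗ M.codiff) ∘ₗ V := rfl
    rw [hVU, hUM, LinearMap.id_comp, LinearMap.comp_assoc, hUV, LinearMap.comp_id] at e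
    exact e
  refine ⟨U ∘ₗ M.teuler ∘ₗ V, ?_, hUd.comp ((preservesDeg_teuler _).comp (hUd.inverse hUV hVU)),
    fun z => ?_, fun N hN => ?_⟩
  · have := ((isCoder_teuler M.toGradedSpace).comp_hom hV).hom_comp hU
    rwa [LinearMap.id_comp, hUV] at this
  · have h1 : M.teuler (V (ι k z)) = ι k (M.euler (g.symm z)) := by
      rw [hV.apply_ι, hVι, (isCoder_teuler _).apply_ι IsCoalgHom.id IsCoalgHom.id]
      have := LinearMap.congr_fun (pr_lder M.euler) (ι k (g.symm z))
      simp only [LinearMap.comp_apply, pr_ι] at this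
      exact congrArg _ this
    show pr k B.HSpace (U (M.teuler (V (ι k z)))) = _
    rw [h1, hUι, pr_ι]
    refine (hg.euler_apply (g.symm z)).symm.trans ?_
    exact congrArg _ (g.apply_symm_apply z)
  · exact (codiff_teuler hM (hS N hN)).conj hV.preservesFil hUM.symm hMV

/-- A coderivation of the transferred structure on cohomology extends to the bar construction. -/
theorem Transfer.exists_lift [CharZero k] {B : AInfAlgebra.{u, w} k} (T : B.Transfer)
    {δ : TensorAlgebra k B.HSpace →ₗ[k] TensorAlgebra k B.HSpace}
    (hδ : IsCoder LinearMap.id LinearMap.id δ) (hd : PreservesDeg B.HSpace B.HSpace δ) :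
    ∃ δ' : TensorAlgebra k B →ₗ[k] TensorAlgebra k B,
      IsCoder LinearMap.id LinearMap.id δ' ∧
      PreservesDeg B.toGradedSpace B.toGradedSpace δ' ∧
      (∀ x, pr k B (δ' (ι k x)) = T.i (pr k B.HSpace (δ (ι k (T.π x))))) ∧
      ∀ N, EqBelow N (T.codiff ∘ₗ δ) (δ ∘ₗ T.codiff) →
        EqBelow N (B.codiff ∘ₗ δ') (δ' ∘ₗ B.codiff) := by
  obtain ⟨Ψ', hΨ', hΨΨ', hΨ'Ψ, hΨι, hΨs, hΨd⟩ := T.exists_Ψ_inverse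
  have hQ := isCoalgHom_tmap (k := k) T.π
  set η := coder LinearMap.id LinearMap.id (T.i ∘ₗ pr k B.HSpace ∘ₗ δ ∘ₗ tmap T.π) with hηdef
  have hη : IsCoder LinearMap.id LinearMap.id η := isCoder_coder IsCoalgHom.id IsCoalgHom.id (by
    simp [hQ.map_one, hδ.map_one])
  have hηp : ∀ t, pr k B (η t) = T.i (pr k B.HSpace (δ (tmap T.π t))) :=
    LinearMap.congr_fun (pr_coder IsCoalgHom.id IsCoalgHom.id _)
  have hηd : PreservesDeg B.toGradedSpace B.toGradedSpace η := by
    refine hη.preservesDeg ?_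
    rw [hηdef, pr_coder IsCoalgHom.id IsCoalgHom.id]
    exact T.linDeg_i.comp_hasDeg ((hd.comp T.preservesDeg_tmap_π).hasDeg_pr)
  have hπη : ∀ t, tmap T.π (η t) = δ (tmap T.π t) := by
    refine LinearMap.congr_fun ((hη.hom_comp hQ).ext (hδ.comp_hom hQ) hQ hQ
      (LinearMap.ext fun t => ?_))
    have h3 : ∀ s, pr k B.HSpace (tmap T.π s) = T.π (pr k B s) := LinearMap.congr_fun (pr_tmap T.π)
    simp only [LinearMap.comp_apply]
    rw [h3, hηp, T.π_i]
  refine ⟨T.Ψ ∘ₗ η ∘ₗ Ψ', ?_, T.preservesDeg_Ψ.comp (hηd.comp hΨd), fun x => ?_, fun N hN => ?_⟩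
  · have := (hη.comp_hom hΨ').hom_comp T.isCoalgHom_Ψ
    rwa [LinearMap.id_comp, hΨΨ'] at this
  · simp only [LinearMap.comp_apply]
    rw [hΨι, hη.apply_ι IsCoalgHom.id IsCoalgHom.id, T.Ψ_ι, pr_ι, hηp, tmap_ι]
  -- The values of `η` on corestrictions lie in the image of `i`, where `d₁` vanishes. As `π`
  -- intertwines `η` with `δ` and the split codifferential with the transferred one, the claim is
  -- `i` applied to the hypothesis.
  · have h1 : EqBelow N (T.split ∘ₗ η) (η ∘ₗ T.split) := by
      refine eqBelow_comm T.isCoder_split hη hηd fun l hl => ?_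
      have h2 := hN.comp hQ.preservesFil l hl
      have h3 : ∀ s, tmap T.π (T.split s) = T.codiff (tmap T.π s) :=
        LinearMap.congr_fun T.tmap_π_split
      have h4 : ∀ s, pr k B.HSpace (T.codiff s) = T.m s := LinearMap.congr_fun T.pr_codiff
      simp only [LinearMap.comp_apply] at h2 ⊢
      rw [T.pr_split, hηp, hηp, T.d_i, hπη, h3, ← h2, h4, zero_add]
    exact h1.conj hΨ'.preservesFil T.comm hΨs

/-- A coderivation of the bar construction descends to the transferred structure on cohomology. -/
theorem Transfer.exists_descent {A : AInfAlgebra.{u, v} k} (T : A.Transfer)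
    {δ : TensorAlgebra k A →ₗ[k] TensorAlgebra k A}
    (hδ : IsCoder LinearMap.id LinearMap.id δ)
    (hd : PreservesDeg A.toGradedSpace A.toGradedSpace δ) :
    ∃ δ' : TensorAlgebra k A.HSpace →ₗ[k] TensorAlgebra k A.HSpace,
      IsCoder LinearMap.id LinearMap.id δ' ∧ PreservesDeg A.HSpace A.HSpace δ' ∧
      (∀ z, pr k A.HSpace (δ' (ι k z)) = T.π (pr k A (δ (ι k (T.i z))))) ∧
      ∀ N, EqBelow N (A.codiff ∘ₗ δ) (δ ∘ₗ A.codiff) →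
        EqBelow N (T.codiff ∘ₗ δ') (δ' ∘ₗ T.codiff) := by
  obtain ⟨Ψ', hΨ', hΨΨ', hΨ'Ψ, hΨι, hΨs, hΨd⟩ := T.exists_Ψ_inverse
  have hQ : IsCoalgHom (tmap T.π ∘ₗ Ψ') := (isCoalgHom_tmap _).comp hΨ'
  have hJ : IsCoalgHom (T.Ψ ∘ₗ tmap T.i) := T.isCoalgHom_Ψ.comp (isCoalgHom_tmap _)
  -- Cohomology is a strict retract of the bar construction through chain maps of coalgebras.
  -- Sandwiching `δ` between them therefore gives a coderivation along the identity.
  have hQJ : (tmap T.π ∘ₗ Ψ') ∘ₗ T.Ψ ∘ₗ tmap T.i = LinearMap.id := by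
    have e : (tmap T.π ∘ₗ Ψ') ∘ₗ T.Ψ ∘ₗ tmap T.i = tmap T.π ∘ₗ (Ψ' ∘ₗ T.Ψ) ∘ₗ tmap T.i := rfl
    rw [e, hΨ'Ψ, LinearMap.id_comp, T.tmap_π_comp_tmap_i]
  have hQc : T.codiff ∘ₗ tmap T.π ∘ₗ Ψ' = (tmap T.π ∘ₗ Ψ') ∘ₗ A.codiff := by
    rw [← LinearMap.comp_assoc, ← T.tmap_π_split, LinearMap.comp_assoc, hΨs, LinearMap.comp_assoc]
  have hJc : A.codiff ∘ₗ T.Ψ ∘ₗ tmap T.i = (T.Ψ ∘ₗ tmap T.i) ∘ₗ T.codiff := by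
    have hc : A.codiff ∘ₗ T.Ψ = T.Ψ ∘ₗ T.split := T.comm
    rw [← LinearMap.comp_assoc, hc, LinearMap.comp_assoc, T.split_tmap_i, LinearMap.comp_assoc]
  refine ⟨(tmap T.π ∘ₗ Ψ') ∘ₗ δ ∘ₗ T.Ψ ∘ₗ tmap T.i, ?_,
    (T.preservesDeg_tmap_π.comp hΨd).comp (hd.comp (T.preservesDeg_Ψ.comp T.preservesDeg_tmap_i)),
    fun z => ?_, fun N hN => ?_⟩
  · have := (hδ.comp_hom hJ).hom_comp hQ
    rwa [LinearMap.id_comp, hQJ] at this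
  · simp only [LinearMap.comp_apply]
    rw [tmap_ι, T.Ψ_ι, hδ.apply_ι IsCoalgHom.id IsCoalgHom.id, hΨι, tmap_ι, pr_ι, pr_ι]
  · exact hN.conj hJ.preservesFil hQc hJc

/-- A retraction of `f : A → B` pulls coderivations of the bar construction of `B` back to `A`. -/
theorem Hom.Retraction.exists_pullback [CharZero k] {A : AInfAlgebra.{u, v} k}
    {B : AInfAlgebra.{u, w} k} {f : Hom A B} (r : f.Retraction)
    {δ : TensorAlgebra k B →ₗ[k] TensorAlgebra k B} (hδ : IsCoder LinearMap.id LinearMap.id δ)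
    (hd : PreservesDeg B.toGradedSpace B.toGradedSpace δ) :
    ∃ δ' : TensorAlgebra k A →ₗ[k] TensorAlgebra k A,
      IsCoder LinearMap.id LinearMap.id δ' ∧
      PreservesDeg A.toGradedSpace A.toGradedSpace δ' ∧
      (∀ x, pr k A (δ' (ι k x)) = r.linearPart (pr k B (δ (ι k (f.f₁ x))))) ∧
      ∀ N, EqBelow N (B.codiff ∘ₗ δ) (δ ∘ₗ B.codiff) →
        EqBelow N (A.codiff ∘ₗ δ') (δ' ∘ₗ A.codiff) := by
  -- Restriction along `f` gives a coderivation with values in the bimodule `B`, which `r` pushes to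
  -- `A`.
  have hγ : IsCoder f.bar f.bar (δ ∘ₗ f.bar) := hδ.comp_hom f.isCoalgHom_bar
  have hγd : HasDeg 0 (pr k B ∘ₗ δ ∘ₗ f.bar) :=
    (hd.comp (f.isCoalgHom_bar.tdeg_comp f.hasDeg_pr_bar)).hasDeg_pr
  have h1 : (pr k B ∘ₗ δ ∘ₗ f.bar) 1 = 0 := by simp [f.isCoalgHom_bar.map_one, hδ.map_one]
  have hp := pr_coder IsCoalgHom.id IsCoalgHom.id (Hom.Retraction.push r (pr k B ∘ₗ δ ∘ₗ f.bar))
  have hδ' : IsCoder LinearMap.id LinearMap.id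
      (coder LinearMap.id LinearMap.id (Hom.Retraction.push r (pr k B ∘ₗ δ ∘ₗ f.bar))) :=
    isCoder_coder IsCoalgHom.id IsCoalgHom.id (Hom.Retraction.push_one r h1)
  have hδ'd := hδ'.preservesDeg (V := A.toGradedSpace) (by
    rw [hp]; exact Hom.Retraction.hasDeg_push r hγd)
  refine ⟨_, hδ', hδ'd, fun x => ?_, fun N hN => ?_⟩
  · rw [← LinearMap.comp_apply, hp, Hom.Retraction.push_ι r h1]
    have h2 : f.bar (ι k x) = ι k (f.f₁ x) := by
      rw [f.isCoalgHom_bar.apply_ι, ← f.corestr_ι, ← f.pr_bar]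
      rfl
    simp only [LinearMap.comp_apply, h2]
  · refine eqBelow_comm A.isCoder_codiff hδ' hδ'd ?_
    rw [hp, pr_codiff]
    refine Hom.Retraction.push_comm r hγ hγd ?_
    have h2 := hN.comp f.isCoalgHom_bar.preservesFil
    rwa [LinearMap.comp_assoc, LinearMap.comp_assoc, ← f.bar_comp_codiff] at h2

end AInfAlgebra

end Descent


/-! ### Minimal models -/

section MinimalModels

open TensorAlgebra TensorProduct

variable {k : Type u} [Field k]

namespace AInfAlgebra

/-- A codifferential on the tensor coalgebra of the cohomology of `A` with zero linear part,
together with a map to the bar construction of `A` that represents cohomology classes by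
cocycles. -/
structure MinimalModel (A : AInfAlgebra.{u, v} k) (C : A.Contraction) where
  m : TensorAlgebra k A.HSpace →ₗ[k] A.HSpace.carrier
  F : TensorAlgebra k A.HSpace →ₗ[k] TensorAlgebra k A
  m_one : m 1 = 0
  m_ι : ∀ z, m (ι k z) = 0
  hasDeg_m : HasDeg (V := A.HSpace) (W := A.HSpace) 1 m
  m_comp : m ∘ₗ coder A.HSpace.tkoszul LinearMap.id m = 0
  isCoalgHom_F : IsCoalgHom F
  hasDeg_F : HasDeg (V := A.HSpace) (W := A.toGradedSpace) 0 (pr k A ∘ₗ F)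
  F_ι : ∀ z, pr k A (F (ι k z)) = C.i z
  comm : F ∘ₗ coder A.HSpace.tkoszul LinearMap.id m = A.codiff ∘ₗ F

/-- A coderivation of the transferred structure which extends the Euler endomorphism can be used to
kill the operations of arity different from `2`. -/
theorem Transfer.exists_minimalModel [CharZero k] {A : AInfAlgebra.{u, v} k} (T : A.Transfer)
    {δ : TensorAlgebra k A.HSpace →ₗ[k] TensorAlgebra k A.HSpace}
    (hδ : IsCoder LinearMap.id LinearMap.id δ) (hd : PreservesDeg A.HSpace A.HSpace δ)
    (hlin : ∀ z, pr k A.HSpace (δ (ι k z)) = A.HSpace.euler z) :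
    ∃ R : A.MinimalModel T.toContraction, ∀ N, EqBelow N (T.codiff ∘ₗ δ) (δ ∘ₗ T.codiff) →
      ∀ l : List A.HSpace.carrier, l.length < N → l.length ≠ 2 → R.m (word k l) = 0 := by
  obtain ⟨Φ, hΦ, hΦd, hΦι, hΦδ⟩ := exists_conj_teuler hδ hd hlin
  obtain ⟨Φ', hΦ', hΦΦ', hΦ'Φ, hΦ'ι⟩ := exists_inverse hΦ (g := LinearMap.id)
    (fun y => hΦι y) (fun y => hΦι y)
  have hΦι' : ∀ z, Φ (ι k z) = ι k z := fun z => by rw [hΦ.apply_ι, hΦι]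
  have hΦ'd := hΦd.inverse hΦΦ' hΦ'Φ
  have hΦ'δ : A.HSpace.teuler ∘ₗ Φ' = Φ' ∘ₗ δ := by
    have e : (Φ' ∘ₗ Φ) ∘ₗ A.HSpace.teuler ∘ₗ Φ' = Φ' ∘ₗ (Φ ∘ₗ A.HSpace.teuler) ∘ₗ Φ' := rfl
    rw [hΦ'Φ, ← hΦδ, LinearMap.comp_assoc, hΦΦ', LinearMap.id_comp, LinearMap.comp_id] at e
    exact e
  -- The new structure is the transferred one conjugated by `Φ`. It commutes with the strict Euler
  -- coderivation wherever the old one commutes with `δ`.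
  set D := Φ' ∘ₗ T.codiff ∘ₗ Φ with hDdef
  have hD : IsCoder A.HSpace.tkoszul LinearMap.id D := by
    have h1 := (T.isCoder_codiff.comp_hom hΦ).hom_comp hΦ'
    have e : Φ' ∘ₗ A.HSpace.tkoszul ∘ₗ Φ = A.HSpace.tkoszul := by
      rw [hΦ.tkoszul_comp (V := A.HSpace) (W := A.HSpace) hΦd.hasDeg_pr, ← LinearMap.comp_assoc,
        hΦ'Φ, LinearMap.id_comp]
    rwa [LinearMap.id_comp, hΦ'Φ, e] at h1
  have hm1 : (pr k A.HSpace ∘ₗ D) 1 = 0 := by simp [hD.map_one]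
  have hDc : coder A.HSpace.tkoszul LinearMap.id (pr k A.HSpace ∘ₗ D) = D :=
    (isCoder_coder A.HSpace.isCoalgHom_tkoszul IsCoalgHom.id hm1).ext hD
      A.HSpace.isCoalgHom_tkoszul IsCoalgHom.id
      (pr_coder A.HSpace.isCoalgHom_tkoszul IsCoalgHom.id _)
  have hTT : T.codiff ∘ₗ T.codiff = 0 := by
    have hodd := odd_coder T.isCoder_codiff odd_one (by rw [T.pr_codiff]; exact T.hasDeg_m)
    refine (T.isCoder_codiff.sq hodd).ext (IsCoder.zero _ _) IsCoalgHom.id IsCoalgHom.id ?_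
    rw [← LinearMap.comp_assoc, T.pr_codiff, LinearMap.comp_zero]
    exact T.m_comp
  have hDD : D ∘ₗ D = 0 := by
    have e : D ∘ₗ D = Φ' ∘ₗ T.codiff ∘ₗ (Φ ∘ₗ Φ') ∘ₗ T.codiff ∘ₗ Φ := rfl
    rw [e, hΦΦ', LinearMap.id_comp, ← LinearMap.comp_assoc _ T.codiff T.codiff, hTT,
      LinearMap.zero_comp, LinearMap.comp_zero]
  have hTd : HasDeg (V := A.HSpace) (W := A.HSpace) 1 (pr k A.HSpace ∘ₗ D) := by
    have h1 : HasDeg (V := A.HSpace) (W := A.HSpace) (0 + 1) ((pr k A.HSpace ∘ₗ Φ') ∘ₗ T.codiff) :=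
      hΦ'd.hasDeg_pr.comp (coder_tdeg_comp T.isCoder_codiff (by rw [T.pr_codiff]; exact T.hasDeg_m))
    rw [zero_add] at h1
    exact h1.comp_even hΦd
  have hF : IsCoalgHom (T.Ψ ∘ₗ tmap T.i ∘ₗ Φ) :=
    T.isCoalgHom_Ψ.comp ((isCoalgHom_tmap _).comp hΦ)
  refine ⟨⟨pr k A.HSpace ∘ₗ D, T.Ψ ∘ₗ tmap T.i ∘ₗ Φ, hm1, fun z => ?_, hTd, ?_, hF,
    (T.preservesDeg_Ψ.comp (T.preservesDeg_tmap_i.comp hΦd)).hasDeg_pr, fun z => ?_, ?_⟩,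
    fun N hN l hl hl2 => ?_⟩
  · have h1 := T.isCoder_codiff.apply_ι A.HSpace.isCoalgHom_tkoszul IsCoalgHom.id z
    rw [← LinearMap.comp_apply (pr k A.HSpace), T.pr_codiff, T.m_ι, map_zero] at h1
    simp only [hDdef, LinearMap.comp_apply, hΦι']
    rw [h1, map_zero, map_zero]
  · rw [hDc, LinearMap.comp_assoc, hDD, LinearMap.comp_zero]
  · simp only [LinearMap.comp_apply, hΦι']
    rw [tmap_ι, T.Ψ_ι, pr_ι]
  · have hc : A.codiff ∘ₗ T.Ψ = T.Ψ ∘ₗ T.split := T.comm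
    have e : (T.Ψ ∘ₗ tmap T.i ∘ₗ Φ) ∘ₗ Φ' ∘ₗ T.codiff ∘ₗ Φ =
        T.Ψ ∘ₗ tmap T.i ∘ₗ (Φ ∘ₗ Φ') ∘ₗ T.codiff ∘ₗ Φ := rfl
    have e' : T.Ψ ∘ₗ tmap T.i ∘ₗ T.codiff ∘ₗ Φ = T.Ψ ∘ₗ (tmap T.i ∘ₗ T.codiff) ∘ₗ Φ := rfl
    rw [hDc, hDdef, e, hΦΦ', LinearMap.id_comp, e', ← T.split_tmap_i, ← LinearMap.comp_assoc _ T.Ψ,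
      hc]
    rfl
  · have h1 : D (A.HSpace.teuler (word k l)) = A.HSpace.teuler (D (word k l)) := by
      have a1 := congrArg Φ' (hN.comp hΦ.preservesFil l hl)
      have a2 := LinearMap.congr_fun hΦδ (word k l)
      have a3 := LinearMap.congr_fun hΦ'δ (T.codiff (Φ (word k l)))
      simp only [hDdef, LinearMap.comp_apply] at *
      rw [a3, ← a1, a2]
    -- For an operation of degree `1` the coefficient is `2 - l.length`, which in characteristic `0`
    -- is not zero unless the length is `2`.
    have h2 := hTd.euler_word l
    have h3 := LinearMap.congr_fun (pr_lder A.HSpace.euler) (D (word k l))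
    simp only [LinearMap.comp_apply] at h2 h3 ⊢
    rw [h1, GradedSpace.teuler, h3, left_eq_add, smul_eq_zero] at h2
    refine h2.resolve_left fun h => hl2 ?_
    rw [sub_eq_zero] at h
    have : ((2 : ℕ) : k) = l.length := by rw [← h]; push_cast; norm_num
    exact (Nat.cast_injective this).symm

namespace MinimalModel

variable {A : AInfAlgebra.{u, v} k} {C : A.Contraction} (R : A.MinimalModel C)

/-- The minimal `A∞`-algebra underlying a minimal model. -/
noncomputable def algebra : AInfAlgebra.{u, v} k :=
  ofCorestr A.HSpace R.m R.m_one R.hasDeg_m R.m_comp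

theorem corestr_algebra : R.algebra.corestr = R.m := corestr_ofCorestr _ _ _ _ _

theorem d_algebra_eq_zero {n : ℕ} (h : ∀ l : List A.HSpace.carrier, l.length = n →
    R.m (word k l) = 0) : R.algebra.d n = 0 := by
  ext x
  refine (components_apply R.m x).trans (h _ ?_)
  exact List.length_ofFn

theorem isMinimal_algebra : R.algebra.IsMinimal := R.d_algebra_eq_zero fun l hl => by
  obtain ⟨z, rfl⟩ := List.length_eq_one_iff.1 hl
  simpa using R.m_ι z

/-- The linear part of the morphism is `i`, and `π i` is the identity. -/
theorem exists_quasiIso : ∃ q : Hom R.algebra A, q.IsQuasiIso := by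
  have hc : R.algebra.codiff = coder A.HSpace.tkoszul LinearMap.id R.m := by
    rw [codiff, corestr_algebra]
    rfl
  refine ⟨Hom.ofBar (A := R.algebra) R.F R.isCoalgHom_F R.hasDeg_F (hc ▸ R.comm), ?_⟩
  rw [isQuasiIso_iff R.isMinimal_algebra C]
  have e : (fun x => C.π ((Hom.ofBar (A := R.algebra) R.F R.isCoalgHom_F R.hasDeg_F
      (hc ▸ R.comm)).f₁ x)) = id := by
    funext x
    exact (congrArg C.π ((Hom.f₁_ofBar (A := R.algebra) R.F R.isCoalgHom_F R.hasDeg_F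
      (hc ▸ R.comm) x).trans (R.F_ι x))).trans (C.π_i x)
  rw [e]
  exact Function.bijective_id

/-- On a word of length two, `F` gives the word of the two representatives plus a letter. After
applying `π`, the differential of that letter drops out, and the relation `comm` leaves the class of
`d₂` of the representatives. -/
theorem m_pair (x y : A.HSpace.carrier) : R.m (word k [x, y]) = A.HProd x y := by
  have hpF : ∀ z, R.F (ι k z) = ι k (C.i z) := fun z => by rw [R.isCoalgHom_F.apply_ι, R.F_ι]
  have hD := isCoder_coder A.HSpace.isCoalgHom_tkoszul IsCoalgHom.id R.m_one
  have hDp : ∀ t, pr k A.HSpace (coder A.HSpace.tkoszul LinearMap.id R.m t) = R.m t :=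
    LinearMap.congr_fun (pr_coder A.HSpace.isCoalgHom_tkoszul IsCoalgHom.id _)
  have h1 : coder A.HSpace.tkoszul LinearMap.id R.m (word k [x, y]) =
      ι k (R.m (word k [x, y])) := by
    have h2 : EqBelow 2 (coder A.HSpace.tkoszul LinearMap.id R.m) 0 := by
      refine hD.eqBelow_zero A.HSpace.isCoalgHom_tkoszul IsCoalgHom.id fun l hl => ?_
      rw [LinearMap.comp_apply, hDp]
      match l, hl with
      | [], _ => exact R.m_one
      | [z], _ => simpa using R.m_ι z
    have h3 := hD.leading A.HSpace.isCoalgHom_tkoszul IsCoalgHom.id h2 [x, y] (by simp)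
    simpa only [LinearMap.comp_apply, hDp] using h3
  have h2 : R.F (word k [x, y]) = word k [C.i x, C.i y] + ι k (pr k A (R.F (word k [x, y]))) := by
    conv_lhs => rw [R.isCoalgHom_F.eq_conv]
    rw [conv_word]
    have e : ∀ z : A.HSpace.carrier, word k [z] = ι k z := fun z => by simp
    simp only [splitSum_cons, splitSum_nil, LinearMap.comp_apply, word_nil, R.isCoalgHom_F.map_one,
      pr_one, map_zero, zero_mul, zero_add, mul_one, e, hpF, pr_ι]
    simp [counit_ι_mul]
  have h3 := congrArg (pr k A) (LinearMap.congr_fun R.comm (word k [x, y]))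
  have h4 : ∀ s, pr k A (A.codiff s) = A.corestr s := LinearMap.congr_fun A.pr_codiff
  rw [LinearMap.comp_apply, LinearMap.comp_apply, h1, h4, h2, map_add, corestr_ι, corestr_word,
    op_two, hpF, pr_ι] at h3
  have h5 := congrArg C.π h3
  rw [C.π_i, map_add, C.π_d, add_zero, C.π_cls _ (A.d₂_ker (C.d_i x) (C.d_i y)),
    ← HProd_cls A (C.d_i x) (C.d_i y), C.cls_i, C.cls_i] at h5
  exact h5

/-- The graded spaces agree by construction and the products by `m_pair`, so the structures are
equal and a quasi-isomorphism from one is literally a quasi-isomorphism from the other. -/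
theorem cohomology_eq (h : ∀ l : List A.HSpace.carrier, l.length ≠ 2 → R.m (word k l) = 0) :
    A.cohomology = R.algebra := by
  have e : A.HOps = components R.m := by
    funext n
    by_cases hn : n = 2
    · subst hn
      ext x
      rw [components_apply]
      have : List.ofFn x = [x 0, x 1] := by simp
      rw [this, R.m_pair]
      rfl
    · rw [A.HOps_ne hn]
      ext x
      rw [components_apply, h _ (by rwa [List.length_ofFn])]
      rfl
  unfold algebra ofCorestr cohomology
  dsimp only
  congr 1

end MinimalModel

end AInfAlgebra

end MinimalModels


/-! ### Inheritance along homotopy retracts -/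

section Retracts

open TensorAlgebra TensorProduct

variable {k : Type u} [Field k]

namespace AInfAlgebra

/-- A homotopy retract of an `A∞`-algebra inherits the vanishing of the operations of a minimal
model. -/
theorem Hom.HasHomotopyRetract.exists_minimalModel [CharZero k] {A : AInfAlgebra.{u, v} k}
    {B : AInfAlgebra.{u, w} k} {f : Hom A B} (hf : f.HasHomotopyRetract) {M : AInfAlgebra.{u, x} k}
    (hM : M.IsMinimal) {q : Hom M B} (hq : q.IsQuasiIso) {S : Set ℕ}
    (hS : ∀ N ∈ S, ∀ i, 3 ≤ i → i < N → M.d i = 0) :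
    ∃ (C : A.Contraction) (R : A.MinimalModel C), ∀ N ∈ S, ∀ l : List A.HSpace.carrier,
      l.length < N → l.length ≠ 2 → R.m (word k l) = 0 := by
  obtain ⟨r, hr⟩ := hf
  obtain ⟨TB⟩ := B.exists_transfer
  obtain ⟨TA⟩ := A.exists_transfer
  obtain ⟨δ₁, h1, h1d, h1ι, h1c⟩ := TB.exists_coder_of_minimalModel hM hq hS
  obtain ⟨δ₂, h2, h2d, h2ι, h2c⟩ := TB.exists_lift h1 h1d
  obtain ⟨δ₃, h3, h3d, h3ι, h3c⟩ := Hom.Retraction.exists_pullback r h2 h2d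
  obtain ⟨δ₄, h4, h4d, h4ι, h4c⟩ := TA.exists_descent h3 h3d
  have hlin : ∀ z, pr k A.HSpace (δ₄ (ι k z)) = A.HSpace.euler z := by
    intro z
    -- The linear part is now `π r₀₀ i ∘ euler ∘ π f₁ i`. The Euler endomorphism moves past `π f₁
    -- i`, which has degree `0`, and what is left of the composite is the identity by the retract
    -- condition `hr`.
    rw [h4ι, h3ι, h2ι, h1ι]
    have hg : LinDeg (V := A.HSpace) (W := B.HSpace) 0 (TB.π ∘ₗ f.f₁ ∘ₗ TA.i) := by
      intro i x hx
      have := TB.linDeg_π _ _ (linDeg_f₁ f _ _ (TA.linDeg_i i x hx))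
      simpa using this
    have e1 : B.HSpace.euler (TB.π (f.f₁ (TA.i z))) = TB.π (f.f₁ (TA.i (A.HSpace.euler z))) :=
      hg.euler_apply z
    rw [e1]
    generalize A.HSpace.euler z = y
    have hd : B.d₁ (f.f₁ (TA.i y)) = 0 := by rw [← f.f₁_d₁, TA.d_i, map_zero]
    have e2 := LinearMap.congr_fun hr y
    conv_lhs at e2 => rw [← TA.cls_i y]
    have e3 : HMap f.f₁ f.f₁_d₁ (A.cls (TA.i y) (TA.d_i y)) = TB.π (f.f₁ (TA.i y)) :=
      (TB.π_cls _ hd).symm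
    rw [LinearMap.comp_apply, e3, ← TB.cls_i (TB.π (f.f₁ (TA.i y)))] at e2
    exact (TA.π_cls _ (by rw [← f.linearPart_d₁, TB.d_i, map_zero])).trans e2
  obtain ⟨R, hR⟩ := TA.exists_minimalModel h4 h4d hlin
  exact ⟨_, R, fun N hN => hR N (h4c N (h3c N (h2c N (h1c N hN))))⟩

theorem isMinimal_cohomology (A : AInfAlgebra.{u, v} k) : A.cohomology.IsMinimal :=
  A.HOps_ne (by decide)

end AInfAlgebra

end Retracts

end AInf

/-! ### The main theorem -/

theorem theoremB {k : Type u} [Field k] [CharZero k]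
    (A : AInf.AInfAlgebra.{u, v} k) (B : AInf.AInfAlgebra.{u, w} k) (f : AInf.AInfAlgebra.Hom A B)
    (hf : f.HasHomotopyRetract) :
    (B.IsFormal → A.IsFormal) ∧
      ∀ n : ℕ∞, B.HasMinimalModelUpTo n → A.HasMinimalModelUpTo n := by
  refine ⟨fun ⟨q, hq⟩ => ?_, fun n ⟨M, hM, hd, q, hq⟩ => ?_⟩
  -- The cohomology of `B` is itself a minimal model with no higher operations, so every length
  -- bound is allowed.
  · obtain ⟨C, R, hR⟩ := hf.exists_minimalModel B.isMinimal_cohomology hq (S := Set.univ)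
      (fun _ _ i hi _ => B.HOps_ne (by omega))
    unfold AInf.AInfAlgebra.IsFormal
    rw [R.cohomology_eq fun l hl => hR (l.length + 1) trivial l (Nat.lt_succ_self _) hl]
    exact R.exists_quasiIso
  -- The admissible bounds are the `N` with every arity below `N` at most `n`: all `N ≤ n + 1` if
  -- `n` is finite, and all `N` otherwise. Arity `i` is reached with `N = i + 1`.
  · obtain ⟨C, R, hR⟩ := hf.exists_minimalModel hM hq (S := {N | ∀ i < N, (i : ℕ∞) ≤ n})
      (fun N hN i hi hiN => hd i hi (hN i hiN))
    refine ⟨R.algebra, R.isMinimal_algebra, fun i hi hin => R.d_algebra_eq_zero fun l hl => ?_,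
      R.exists_quasiIso⟩
    refine hR (i + 1) (fun j hj => le_trans ?_ hin) l (by omega) (by omega)
    exact_mod_cast Nat.lt_succ_iff.1 hj
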